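/- Let $\{\xi_i\}_{i\ge 0}$ be a centered stationary Gaussian sequence with $\mathbb{E}\,\xi_i^2=1$ and non-negative correlation function $\rho(i):=\mathbb{E}\,\xi_0\xi_i\ge 0$, and let $\{\sigma(i)\}_{i\ge 1}$ be a sequence of positive real numbers. Put $S_\ell:=\sum_{i=1}^{\ell}\sigma(i)\xi_i$ and $q_n:=\mathbb{P}\big(\max_{1\le \ell\le n}S_\ell<0\big)$. Let $H\in(1/2,1)$, let $p\in\mathbb{R}$ with $p+H>0$, and let $\kappa>0$. For $a,b>0$ and $\tau\ge 0$ define $$f_{p,H}(a,b):=\int_0^a\int_0^b x^p y^p|x-y|^{2H-2}\,dy\,dx,\qquad C_{p,H}(\tau):=e^{-\tau(p+H)}\,\frac{f_{p,H}(1,e^\tau)}{f_{p,H}(1,1)} .$$ Then $C_{p,H}$ is the correlation function of a centered stationary Gaussian process $\{Z(t)\}_{t\ge 0}$ with almost surely continuous sample paths (normalized to unit variance), and the limit $$\theta(p,H)=\theta(C_{p,H}):=-\lim_{T\to\infty}\frac1T\log\mathbb{P}\Big(\sup_{t\in[0,T]}Z(t)<0\Big)$$ exists, is the same for every such process, and lies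 in $(0,\infty)$. Moreover, if $$\lim_{i\to\infty}\frac{\rho(i)}{i^{2H-2}}=\kappa\qquad\text{and}\qquad \lim_{i\to\infty}\frac{\sigma(i)}{i^p}=1,$$ then $$\lim_{n\to\infty}\frac{\log q_n}{\log n}=-\theta(C_{p,H}).$$ -/

import Mathlib

open MeasureTheory ProbabilityTheory Filter Topology
open scoped NNReal

universe u v

/-- `Z` is a centered stationary Gaussian process on the time set `ι` (here `ι = ℕ` or
`ι = ℝ≥0`), normalized to unit variance, with correlation function `A`, that is
`E[Z(s) Z(s+t)] = A(t)` for all `s` and `t`. -/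
structure IsStationaryGaussian {ι : Type*} [AddCommMonoid ι] {Ω : Type*} [MeasurableSpace Ω]
    (P : Measure Ω) (Z : ι → Ω → ℝ) (A : ι → ℝ) : Prop where
  gaussian : IsGaussianProcess Z P
  centered : ∀ t, ∫ ω, Z t ω ∂P = 0
  covariance : ∀ s t, ∫ ω, Z s ω * Z (s + t) ω ∂P = A t
  unit_variance : A 0 = 1

/-- `q_n = P(max_{1 ≤ ℓ ≤ n} S_ℓ < 0)` for the weighted sums `S_ℓ = ∑_{i=1}^ℓ σ(i) ξ_i`. -/
noncomputable def persistenceProb {Ω : Type*} [MeasurableSpace Ω] (P : Measure Ω)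
    (σ : ℕ → ℝ) (ξ : ℕ → Ω → ℝ) (n : ℕ) : ℝ :=
  P.real {ω | ∀ l ∈ Finset.Icc 1 n, ∑ i ∈ Finset.Icc 1 l, σ i * ξ i ω < 0}

/-- `P(sup_{t ∈ [0,T]} Z(t) < 0)`. -/
noncomputable def supPersistenceProb {Ω : Type*} [MeasurableSpace Ω] (P : Measure Ω)
    (Z : ℝ≥0 → Ω → ℝ) (T : ℝ≥0) : ℝ :=
  P.real {ω | sSup ((fun t => Z t ω) '' Set.Icc 0 T) < 0}

/-- `A` is the correlation function of a centered stationary Gaussian process on `[0,∞)` with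
almost surely continuous sample paths, and every such process `Z` has
`θ(A) = - lim_{T → ∞} (1/T) log P(sup_{t ∈ [0,T]} Z(t) < 0)` equal to the real number `θ`
(all the probabilities being positive, so that the logarithms are genuine). -/
structure HasPersistenceExponent (A : ℝ≥0 → ℝ) (θ : ℝ) : Prop where
  exists_process : ∃ (Ω : Type u) (_ : MeasurableSpace Ω) (P : Measure Ω) (Z : ℝ≥0 → Ω → ℝ),
    IsProbabilityMeasure P ∧ IsStationaryGaussian P Z A ∧
      ∀ᵐ ω ∂P, Continuous fun t => Z t ω
  pos : ∀ (Ω : Type u) [MeasurableSpace Ω] (P : Measure Ω) [IsProbabilityMeasure P]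
    (Z : ℝ≥0 → Ω → ℝ), IsStationaryGaussian P Z A → (∀ᵐ ω ∂P, Continuous fun t => Z t ω) →
      ∀ T : ℝ≥0, 0 < supPersistenceProb P Z T
  tendsto : ∀ (Ω : Type u) [MeasurableSpace Ω] (P : Measure Ω) [IsProbabilityMeasure P]
    (Z : ℝ≥0 → Ω → ℝ), IsStationaryGaussian P Z A → (∀ᵐ ω ∂P, Continuous fun t => Z t ω) →
      Tendsto (fun T : ℝ≥0 => -(1 / (T : ℝ) * Real.log (supPersistenceProb P Z T))) atTop (𝓝 θ)

/-- `f_{p,H}(a,b) = ∫_0^a ∫_0^b x^p y^p |x-y|^{2H-2} dy dx`. -/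
noncomputable def fpH (p H a b : ℝ) : ℝ :=
  ∫ x in (0 : ℝ)..a, ∫ y in (0 : ℝ)..b, x ^ p * y ^ p * |x - y| ^ (2 * H - 2)

/-- `C_{p,H}(τ) = e^{-τ(p+H)} f_{p,H}(1,e^τ) / f_{p,H}(1,1)`, `τ ≥ 0`. -/
noncomputable def CpH (p H : ℝ) (τ : ℝ≥0) : ℝ :=
  Real.exp (-(τ : ℝ) * (p + H)) * (fpH p H 1 (Real.exp τ) / fpH p H 1 1)

/-! Under the time change n = e^t the partial sums look stationary. Summing σ(i) ~ i^p against ρ(i)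
~ κ i^(2H-2) shows that Cov(S_⌊ax⌋, S_⌊ay⌋) / a^(2(p+H)) tends to κ f_{p,H}(x,y)
(`tendsto_weightedCov`). Hence the correlation of the sums at ⌊a e^s⌋ and ⌊a e^t⌋ tends to
C_{p,H}(|s-t|) (`RegularWeights.tendsto_sumCorr`). Thus q_n should behave like the probability that
the limiting process Z stays negative up to time log n. This has to be proved on the exponential
scale, with only pointwise convergence of correlations on bounded windows and polynomial decay in
l/m between windows.

The main tool is a quantitative Gaussian comparison (`exists_gaussian_comparison`): orthant
probabilities increase with the off-diagonal covariances, up to a small change of level and an error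
proportional to the covariance discrepancy. It is obtained by replacing one Gaussian law by the
other in n small increments, tested against a product of smooth decreasing steps, whose mixed second
derivatives are nonnegative. Its exact case is Slepian's inequality, which, correlations being
nonnegative, makes persistence probabilities supermultiplicative over disjoint index sets. For upper
bounds, `IsCenteredGaussian.real_forall_nonpos_le_prod` dominates weakly correlated blocks by
independent copies of the blocks plus a small common Gaussian field, at the price of raising the
level from 0 to u.

The process Z: C_{p,H} is positive semidefinite as a limit of correlation matrices, and 1 -
C_{p,H}(τ) = O(τ^(2H)) with 2H > 1 gives continuous paths by dyadic chaining. The exponent exists by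
Fekete's lemma, is positive by decoupling since C_{p,H} decays exponentially, and depends on the
correlation alone by Slepian's inequality with equal covariances.

Lower bound for q_n: cut the indices into geometric blocks of fixed ratio e^M. On one block the sums
at finitely many grid points are compared with Z, and a maximal inequality controls the sums between
them (`RegularWeights.eventually_block_ge`). Supermultiplicativity then multiplies about (log n)/M
such factors.

Upper bound for q_n: keep only grid points in blocks of logarithmic length M separated by gaps βM,
decouple them, and compare each block with Z. Both operations raise the level to some u > 0. A
Cameron-Martin shift along a sum of values of Z over a grid
(`IsStationaryGaussian.exists_real_le_shift`) brings it back to -u at a cost e^(βM), harmless once β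
tends to 0. Each block costs at most 5 e^(βM) P(sup_{[0,M]} Z < 0)
(`RegularWeights.eventually_persistenceProb_le_pow`). Letting M grow, and then β shrink, yields -θ.
-/

section SmoothStep

open Real

/-! ### Smooth cutoffs with globally bounded derivatives. -/

theorem exists_bound_iteratedDeriv_smoothTransition (k : ℕ) :
    ∃ K : ℝ, ∀ x, |iteratedDeriv k smoothTransition x| ≤ K := by
  have hc : Continuous (iteratedDeriv k smoothTransition) :=
    (smoothTransition.contDiff (n := (k : ℕ∞))).continuous_iteratedDeriv k le_rfl
  obtain ⟨K, hK⟩ := (isCompact_Icc (a := (-1 : ℝ)) (b := 2)).exists_bound_of_continuousOn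
    hc.continuousOn
  refine ⟨max K 1, fun x => ?_⟩
  -- Outside [0,1] the function is locally constant, equal to 0 or 1. The maximum with 1 is only
  -- needed for order 0.
  have hconst : ∀ (c : ℝ), smoothTransition =ᶠ[𝓝 x] (fun _ => c) → |c| ≤ 1 →
      |iteratedDeriv k smoothTransition x| ≤ max K 1 := by
    intro c h hc1
    rw [Filter.EventuallyEq.iteratedDeriv_eq k h, iteratedDeriv_const]
    refine le_max_of_le_right ?_
    split_ifs <;> simp [hc1]
  by_cases h1 : x < 0
  · refine hconst 0 ?_ (by simp)
    filter_upwards [Iio_mem_nhds h1] with y hy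
    exact smoothTransition.zero_of_nonpos hy.le
  by_cases h2 : 1 < x
  · refine hconst 1 ?_ (by simp)
    filter_upwards [Ioi_mem_nhds h2] with y hy
    exact smoothTransition.one_of_one_le (le_of_lt hy)
  · push Not at h1 h2
    exact le_max_of_le_left (hK x ⟨by linarith, by linarith⟩)

/-- Lagrange's remainder with one constant for all base points. The sign of `g₁` is recorded because
it will force the mixed second derivatives of a product of decreasing steps to be nonnegative. -/
theorem exists_taylor_smoothTransition :
    ∃ (g₁ g₂ : ℝ → ℝ) (K : ℝ), 1 ≤ K ∧ (∀ x, 0 ≤ g₁ x) ∧ (∀ x, |g₁ x| ≤ K) ∧ (∀ x, |g₂ x| ≤ K) ∧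
      ∀ x t, |smoothTransition (x + t) - smoothTransition x - g₁ x * t - g₂ x * t ^ 2 / 2|
        ≤ K * |t| ^ 3 := by
  obtain ⟨K₁, h₁⟩ := exists_bound_iteratedDeriv_smoothTransition 1
  obtain ⟨K₂, h₂⟩ := exists_bound_iteratedDeriv_smoothTransition 2
  obtain ⟨K₃, h₃⟩ := exists_bound_iteratedDeriv_smoothTransition 3
  refine ⟨iteratedDeriv 1 smoothTransition, iteratedDeriv 2 smoothTransition,
    max 1 (max K₁ (max K₂ K₃)), le_max_left _ _, fun x => ?_,
    fun x => (h₁ x).trans (by simp), fun x => (h₂ x).trans (by simp), fun x t => ?_⟩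
  · rw [iteratedDeriv_one]
    exact smoothTransition.monotone.deriv_nonneg
  · rcases eq_or_ne t 0 with rfl | ht
    · simp
    obtain ⟨y, -, hy⟩ := taylor_mean_remainder_lagrange_iteratedDeriv (f := smoothTransition)
      (x₀ := x) (x := x + t) (n := 2) (by simpa using ht)
      (smoothTransition.contDiff (n := (3 : ℕ∞))).contDiffOn
    have hu : UniqueDiffOn ℝ (Set.uIcc x (x + t)) :=
      uniqueDiffOn_Icc (by simpa using ht)
    have hx : x ∈ Set.uIcc x (x + t) := Set.left_mem_uIcc
    have e : ∀ k : ℕ, iteratedDerivWithin k smoothTransition (Set.uIcc x (x + t)) x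
        = iteratedDeriv k smoothTransition x := fun k =>
      iteratedDerivWithin_eq_iteratedDeriv hu
        (smoothTransition.contDiff (n := (k : ℕ∞))).contDiffAt hx
    rw [taylor_within_apply] at hy
    simp only [Finset.sum_range_succ, Finset.sum_range_zero, e] at hy
    have : smoothTransition (x + t) - smoothTransition x - iteratedDeriv 1 smoothTransition x * t
        - iteratedDeriv 2 smoothTransition x * t ^ 2 / 2
        = iteratedDeriv 3 smoothTransition y * t ^ 3 / 6 := by
      simp [Nat.factorial] at hy
      rw [iteratedDeriv_one]
      linarith
    rw [this, abs_div, abs_mul, abs_pow]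
    have h3 : |iteratedDeriv 3 smoothTransition y| ≤ max 1 (max K₁ (max K₂ K₃)) :=
      (h₃ y).trans (by simp)
    have : |iteratedDeriv 3 smoothTransition y| * |t| ^ 3
        ≤ max 1 (max K₁ (max K₂ K₃)) * |t| ^ 3 := by gcongr
    rw [show |(6 : ℝ)| = 6 by norm_num]
    have h0 : 0 ≤ |iteratedDeriv 3 smoothTransition y| * |t| ^ 3 := by positivity
    linarith

end SmoothStep

/-! ### Taylor control for products of smooth steps. -/

/-- A second-order Taylor expansion of `f : ℝ^ι → [0,1]` with a globally controlled remainder,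
non-positive first-order and non-negative mixed second-order coefficients. -/
structure HasTaylorBound {ι : Type*} [Fintype ι] (f : (ι → ℝ) → ℝ) (a : (ι → ℝ) → ι → ℝ)
    (b : (ι → ℝ) → ι → ι → ℝ) (K : ℝ) : Prop where
  nonneg : ∀ w, 0 ≤ f w
  le_one : ∀ w, f w ≤ 1
  first_nonpos : ∀ w i, a w i ≤ 0
  first_bound : ∀ w i, |a w i| ≤ K
  mixed_nonneg : ∀ w i j, i ≠ j → 0 ≤ b w i j
  second_bound : ∀ w i j, |b w i j| ≤ K
  taylor : ∀ w v, |f (w + v) - f w - ∑ i, a w i * v i - (∑ i, ∑ j, b w i j * (v i * v j)) / 2|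
    ≤ K * (∑ i, |v i|) ^ 3

/-- For increments s ≤ 1 the product of the two expansions is multiplied out and every term beyond
second order is O(s³). For s ≥ 1 no cancellation is needed: both functions lie in [0,1] and each
Taylor term is already at most K² s³. -/
theorem abs_mul_taylor_remainder_le {F A B p p₁ p₂ t s K x y : ℝ} (hK : 1 ≤ K) (hs : 0 ≤ s)
    (hF0 : 0 ≤ F) (hF1 : F ≤ 1) (hp0 : 0 ≤ p) (hp1 : p ≤ 1) (hx0 : 0 ≤ x) (hx1 : x ≤ 1)
    (hy0 : 0 ≤ y) (hy1 : y ≤ 1)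
    (hA : |A| ≤ K * s) (hB : |B| ≤ K * s ^ 2) (hR : |x - F - A - B / 2| ≤ K * s ^ 3)
    (ht : |t| ≤ s) (h₁ : |p₁| ≤ K) (h₂ : |p₂| ≤ K) (hr : |y - p - p₁ * t - p₂ * t ^ 2 / 2| ≤ K * s ^ 3) :
    |x * y - F * p - (p * A + F * p₁ * t)
      - (p * B + 2 * (p₁ * t * A) + F * p₂ * t ^ 2) / 2| ≤ 10 * K ^ 2 * s ^ 3 := by
  have hpt : |p₁ * t| ≤ K * s := by rw [abs_mul]; gcongr
  have hpt2 : |p₂ * t ^ 2| ≤ K * s ^ 2 := by rw [abs_mul, abs_pow]; gcongr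
  set P := p₁ * t with hP
  set Q := p₂ * t ^ 2 with hQ
  have e : F * p₁ * t = F * P := by rw [hP]; ring
  have e' : F * p₂ * t ^ 2 = F * Q := by rw [hQ]; ring
  rw [e, e']
  rcases le_total s 1 with h | h
  · have key : x * y - F * p - (p * A + F * P) - (p * B + 2 * (P * A) + F * Q) / 2
        = (x - F - A - B / 2) * y + (F + A + B / 2) * (y - p - P - Q / 2)
          + (A * Q / 2 + B * P / 2 + B * Q / 4) := by ring
    rw [key]
    have hs2 : s ^ 2 ≤ 1 := pow_le_one₀ hs h
    have hs4 : s ^ 4 ≤ s ^ 3 := pow_le_pow_of_le_one hs h (by norm_num)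
    have b1 : |(x - F - A - B / 2) * y| ≤ K * s ^ 3 := by
      rw [abs_mul, abs_of_nonneg hy0]
      calc _ ≤ (K * s ^ 3) * 1 := by gcongr
        _ = _ := by ring
    have b2 : |F + A + B / 2| ≤ 1 + K + K := by
      have : |F| ≤ 1 := by rw [abs_of_nonneg hF0]; exact hF1
      have h4 : |A| ≤ K := hA.trans (by nlinarith)
      have h5 : |B| ≤ K := hB.trans (by nlinarith)
      obtain ⟨l1, u1⟩ := abs_le.1 this
      obtain ⟨l2, u2⟩ := abs_le.1 h4
      obtain ⟨l3, u3⟩ := abs_le.1 h5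
      rw [abs_le]
      constructor <;> linarith
    have b3 : |(F + A + B / 2) * (y - p - P - Q / 2)| ≤ (1 + K + K) * (K * s ^ 3) := by
      rw [abs_mul]; gcongr
    have b7 : K ^ 2 * s ^ 4 ≤ K ^ 2 * s ^ 3 := by gcongr
    have b8 : K * s ^ 3 ≤ K ^ 2 * s ^ 3 := by
      have : K ≤ K ^ 2 := by nlinarith
      gcongr
    have b4 : |A * Q| ≤ K ^ 2 * s ^ 3 := by
      rw [abs_mul]
      calc _ ≤ (K * s) * (K * s ^ 2) := by gcongr
        _ = _ := by ring
    have b5 : |B * P| ≤ K ^ 2 * s ^ 3 := by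
      rw [abs_mul]
      calc _ ≤ (K * s ^ 2) * (K * s) := by gcongr
        _ = _ := by ring
    have b6 : |B * Q| ≤ K ^ 2 * s ^ 3 := by
      rw [abs_mul]
      calc _ ≤ (K * s ^ 2) * (K * s ^ 2) := by gcongr
        _ = K ^ 2 * s ^ 4 := by ring
        _ ≤ _ := b7
    have b9 : (1 + K + K) * (K * s ^ 3) = K * s ^ 3 + 2 * (K ^ 2 * s ^ 3) := by ring
    rw [b9] at b3
    obtain ⟨l1, u1⟩ := abs_le.1 b1
    obtain ⟨l3, u3⟩ := abs_le.1 b3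
    obtain ⟨l4, u4⟩ := abs_le.1 b4
    obtain ⟨l5, u5⟩ := abs_le.1 b5
    obtain ⟨l6, u6⟩ := abs_le.1 b6
    generalize (F + A + B / 2) * (y - p - P - Q / 2) = m1 at *
    generalize (x - F - A - B / 2) * y = m2 at *
    generalize A * Q = m3 at *
    generalize B * P = m4 at *
    generalize B * Q = m5 at *
    rw [mul_assoc 10]
    generalize K ^ 2 * s ^ 3 = m6 at *
    clear hR hr hA hB hpt hpt2 key
    rw [abs_le]
    constructor <;> linarith
  · have s1 : 1 ≤ s ^ 3 := one_le_pow₀ h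
    have s2 : s ≤ s ^ 3 := by
      calc s = s ^ 1 := by ring
        _ ≤ s ^ 3 := pow_le_pow_right₀ h (by norm_num)
    have s3 : s ^ 2 ≤ s ^ 3 := pow_le_pow_right₀ h (by norm_num)
    have K2 : K ≤ K ^ 2 := by nlinarith
    have c0 : |x * y - F * p| ≤ 1 := by
      have a1 : x * y ≤ 1 := mul_le_one₀ hx1 hy0 hy1
      have a2 : F * p ≤ 1 := mul_le_one₀ hF1 hp0 hp1
      have a3 : 0 ≤ x * y := by positivity
      have a4 : 0 ≤ F * p := by positivity
      rw [abs_le]; constructor <;> linarith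
    have c1 : |p * A| ≤ 1 * (K * s) := by rw [abs_mul, abs_of_nonneg hp0]; gcongr
    have c2 : |F * P| ≤ 1 * (K * s) := by rw [abs_mul, abs_of_nonneg hF0]; gcongr
    have c3 : |p * B| ≤ 1 * (K * s ^ 2) := by rw [abs_mul, abs_of_nonneg hp0]; gcongr
    have c4 : |F * Q| ≤ 1 * (K * s ^ 2) := by rw [abs_mul, abs_of_nonneg hF0]; gcongr
    have c5 : |P * A| ≤ (K * s) * (K * s) := by rw [abs_mul]; gcongr
    have d1 : K * s ≤ K ^ 2 * s ^ 3 := by gcongr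
    have d2 : K * s ^ 2 ≤ K ^ 2 * s ^ 3 := by gcongr
    have d3 : (K * s) * (K * s) ≤ K ^ 2 * s ^ 3 := by
      calc (K * s) * (K * s) = K ^ 2 * s ^ 2 := by ring
        _ ≤ _ := by gcongr
    have d4 : 1 ≤ K ^ 2 * s ^ 3 := by
      have : 1 ≤ K ^ 2 := one_le_pow₀ hK
      nlinarith
    obtain ⟨l0, u0⟩ := abs_le.1 c0
    obtain ⟨l1, u1⟩ := abs_le.1 c1
    obtain ⟨l2, u2⟩ := abs_le.1 c2
    obtain ⟨l3, u3⟩ := abs_le.1 c3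
    obtain ⟨l4, u4⟩ := abs_le.1 c4
    obtain ⟨l5, u5⟩ := abs_le.1 c5
    rw [mul_assoc 10]
    rw [abs_le]
    constructor <;> linarith

theorem abs_sum_mul_le {ι : Type*} [Fintype ι] {a v : ι → ℝ} {K : ℝ} (h : ∀ i, |a i| ≤ K) :
    |∑ i, a i * v i| ≤ K * ∑ i, |v i| := by
  rw [Finset.mul_sum]
  refine (Finset.abs_sum_le_sum_abs _ _).trans (Finset.sum_le_sum fun i _ => ?_)
  rw [abs_mul]
  exact mul_le_mul_of_nonneg_right (h i) (abs_nonneg _)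

theorem abs_sum_sum_mul_le {ι : Type*} [Fintype ι] {b : ι → ι → ℝ} {v : ι → ℝ} {K : ℝ}
    (h : ∀ i j, |b i j| ≤ K) :
    |∑ i, ∑ j, b i j * (v i * v j)| ≤ K * (∑ i, |v i|) ^ 2 := by
  rw [sq, Finset.sum_mul_sum, Finset.mul_sum]
  refine (Finset.abs_sum_le_sum_abs _ _).trans (Finset.sum_le_sum fun i _ => ?_)
  rw [Finset.mul_sum]
  refine (Finset.abs_sum_le_sum_abs _ _).trans (Finset.sum_le_sum fun j _ => ?_)
  rw [abs_mul, abs_mul]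
  exact mul_le_mul_of_nonneg_right (h i j) (by positivity)

/-- The new mixed terms are products of two nonpositive first-order coefficients, so multiplying by
a nonincreasing function of one coordinate preserves the sign conditions. -/
theorem HasTaylorBound.mul_eval {ι : Type*} [Fintype ι] [DecidableEq ι] {f : (ι → ℝ) → ℝ} {a b}
    {K : ℝ} (hf : HasTaylorBound f a b K) {g g₁ g₂ : ℝ → ℝ} (hK : 1 ≤ K) (hg0 : ∀ x, 0 ≤ g x)
    (hg1 : ∀ x, g x ≤ 1) (hg₁ : ∀ x, g₁ x ≤ 0) (hg₁K : ∀ x, |g₁ x| ≤ K) (hg₂K : ∀ x, |g₂ x| ≤ K)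
    (ht : ∀ x t, |g (x + t) - g x - g₁ x * t - g₂ x * t ^ 2 / 2| ≤ K * |t| ^ 3) (k : ι) :
    ∃ a' b', HasTaylorBound (fun w => f w * g (w k)) a' b' (10 * K ^ 2) := by
  have hKK : K ≤ K ^ 2 := by nlinarith
  refine ⟨fun w i => g (w k) * a w i + if i = k then f w * g₁ (w k) else 0,
    fun w i j => g (w k) * b w i j + (if i = k then g₁ (w k) * a w j else 0)
      + (if j = k then g₁ (w k) * a w i else 0)
      + if i = k then if j = k then f w * g₂ (w k) else 0 else 0, ?_⟩
  have bf : ∀ w, |f w| ≤ 1 := fun w => abs_le.2 ⟨by linarith [hf.nonneg w], hf.le_one w⟩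
  have bg : ∀ x, |g x| ≤ 1 := fun x => abs_le.2 ⟨by linarith [hg0 x], hg1 x⟩
  have b1 : ∀ w i, |g (w k) * a w i| ≤ K := fun w i => by
    rw [abs_mul]
    calc _ ≤ 1 * K := by gcongr; exacts [bg _, hf.first_bound w i]
      _ = K := one_mul K
  have b2 : ∀ w i j, |g (w k) * b w i j| ≤ K := fun w i j => by
    rw [abs_mul]
    calc _ ≤ 1 * K := by gcongr; exacts [bg _, hf.second_bound w i j]
      _ = K := one_mul K
  have b3 : ∀ w, |f w * g₁ (w k)| ≤ K := fun w => by
    rw [abs_mul]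
    calc _ ≤ 1 * K := by gcongr; exacts [bf _, hg₁K _]
      _ = K := one_mul K
  have b4 : ∀ w, |f w * g₂ (w k)| ≤ K := fun w => by
    rw [abs_mul]
    calc _ ≤ 1 * K := by gcongr; exacts [bf _, hg₂K _]
      _ = K := one_mul K
  have b5 : ∀ w i, |g₁ (w k) * a w i| ≤ K ^ 2 := fun w i => by
    rw [abs_mul, sq]
    gcongr; exacts [hg₁K _, hf.first_bound w i]
  refine ⟨fun w => mul_nonneg (hf.nonneg w) (hg0 _), fun w => mul_le_one₀ (hf.le_one w) (hg0 _)
    (hg1 _), fun w i => ?_, fun w i => ?_, fun w i j hij => ?_, fun w i j => ?_, fun w v => ?_⟩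
  · have := mul_nonpos_of_nonneg_of_nonpos (hg0 (w k)) (hf.first_nonpos w i)
    have := mul_nonpos_of_nonneg_of_nonpos (hf.nonneg w) (hg₁ (w k))
    split_ifs <;> linarith
  · refine (abs_add_le _ _).trans ?_
    have : |if i = k then f w * g₁ (w k) else 0| ≤ K := by
      split_ifs
      · exact b3 w
      · simp; linarith
    linarith [b1 w i]
  · have h1 := mul_nonneg (hg0 (w k)) (hf.mixed_nonneg w i j hij)
    have h2 := mul_nonneg_of_nonpos_of_nonpos (hg₁ (w k)) (hf.first_nonpos w i)
    have h3 := mul_nonneg_of_nonpos_of_nonpos (hg₁ (w k)) (hf.first_nonpos w j)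
    split_ifs with h4 h5 h5
    · exact absurd (h4.trans h5.symm) hij
    all_goals linarith
  · have h1 : |if i = k then g₁ (w k) * a w j else 0| ≤ K ^ 2 := by
      split_ifs
      · exact b5 w j
      · simp; positivity
    have h2 : |if j = k then g₁ (w k) * a w i else 0| ≤ K ^ 2 := by
      split_ifs
      · exact b5 w i
      · simp; positivity
    have h3 : |if i = k then if j = k then f w * g₂ (w k) else 0 else 0| ≤ K := by
      split_ifs
      · exact b4 w
      all_goals simp; linarith
    refine (abs_add_le _ _).trans ?_
    have := abs_add_three (g (w k) * b w i j) (if i = k then g₁ (w k) * a w j else 0)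
      (if j = k then g₁ (w k) * a w i else 0)
    linarith [b2 w i j]
  · have hs : |v k| ≤ ∑ i, |v i| :=
      Finset.single_le_sum (f := fun i => |v i|) (fun i _ => abs_nonneg _) (Finset.mem_univ k)
    have key := abs_mul_taylor_remainder_le (F := f w) (x := f (w + v)) (p := g (w k))
      (y := g (w k + v k)) (t := v k) hK (Finset.sum_nonneg fun i _ => abs_nonneg (v i))
      (hf.nonneg w) (hf.le_one w) (hg0 _) (hg1 _) (hf.nonneg _) (hf.le_one _) (hg0 _) (hg1 _)
      (abs_sum_mul_le (hf.first_bound w)) (abs_sum_sum_mul_le (hf.second_bound w)) (hf.taylor w v)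
      hs (hg₁K (w k)) (hg₂K (w k)) ((ht (w k) (v k)).trans (by gcongr))
    refine le_of_eq_of_le ?_ key
    congr 1
    have e1 : ∑ i, (g (w k) * a w i + if i = k then f w * g₁ (w k) else 0) * v i
        = g (w k) * ∑ i, a w i * v i + f w * g₁ (w k) * v k := by
      simp only [add_mul, Finset.sum_add_distrib, ite_mul, zero_mul, Finset.sum_ite_eq',
        Finset.mem_univ, if_true, Finset.mul_sum, mul_assoc]
    have e2 : ∑ i, ∑ j, (g (w k) * b w i j + (if i = k then g₁ (w k) * a w j else 0)
        + (if j = k then g₁ (w k) * a w i else 0)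
        + if i = k then if j = k then f w * g₂ (w k) else 0 else 0) * (v i * v j)
        = g (w k) * (∑ i, ∑ j, b w i j * (v i * v j))
          + 2 * (g₁ (w k) * v k * ∑ i, a w i * v i) + f w * g₂ (w k) * v k ^ 2 := by
      simp only [add_mul, Finset.sum_add_distrib, ite_mul, zero_mul, Finset.sum_ite_eq',
        Finset.mem_univ, if_true, Finset.mul_sum, mul_assoc]
      have : ∀ i j : ι, (if i = k then g₁ (w k) * (a w j * (v i * v j)) else 0)
          = if i = k then g₁ (w k) * (v k * (a w j * v j)) else 0 := by
        intro i j; split_ifs with h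
        · rw [h]; ring
        · rfl
      simp only [this]
      rw [Finset.sum_comm (f := fun i j => if i = k then g₁ (w k) * (v k * (a w j * v j)) else 0)]
      simp only [Finset.sum_ite_eq', Finset.mem_univ, if_true]
      have h2 : ∀ i : ι, (∑ j, if i = k then if j = k then f w * (g₂ (w k) * (v i * v j)) else 0 else 0)
          = if i = k then f w * (g₂ (w k) * (v k * v k)) else 0 := by
        intro i; split_ifs with h
        · simp [h]
        · simp
      simp only [h2, Finset.sum_ite_eq', Finset.mem_univ, if_true]
      have h3 : ∀ i, g₁ (w k) * (a w i * (v i * v k)) = g₁ (w k) * (v k * (a w i * v i)) :=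
        fun i => by ring
      simp only [h3, ← Finset.mul_sum]
      ring
    rw [e1, e2]
    simp only [Pi.add_apply]

/-- The smooth decreasing step from `1` on `(-∞, c]` to `0` on `[c + δ, ∞)`. -/
noncomputable def smoothStep (δ c x : ℝ) : ℝ := Real.smoothTransition ((c + δ - x) / δ)

theorem smoothStep_nonneg (δ c x : ℝ) : 0 ≤ smoothStep δ c x := Real.smoothTransition.nonneg _

theorem smoothStep_le_one (δ c x : ℝ) : smoothStep δ c x ≤ 1 := Real.smoothTransition.le_one _

theorem smoothStep_eq_one {δ c x : ℝ} (hδ : 0 < δ) (h : x ≤ c) : smoothStep δ c x = 1 :=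
  Real.smoothTransition.one_of_one_le (by rw [le_div_iff₀ hδ]; linarith)

theorem smoothStep_eq_zero {δ c x : ℝ} (hδ : 0 < δ) (h : c + δ ≤ x) : smoothStep δ c x = 0 :=
  Real.smoothTransition.zero_of_nonpos (div_nonpos_of_nonpos_of_nonneg (by linarith) hδ.le)

theorem continuous_smoothStep (δ c : ℝ) : Continuous (smoothStep δ c) :=
  Real.smoothTransition.continuous.comp (by fun_prop)

/-- Factors are multiplied in one coordinate at a time. Translating a step does not change its
derivative bounds, so the constant depends on δ and S but not on the thresholds c. -/
theorem exists_hasTaylorBound_prod_smoothStep {ι : Type*} [Fintype ι] {δ : ℝ} (hδ : 0 < δ)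
    (S : Finset ι) : ∃ K : ℝ, 1 ≤ K ∧ ∀ c : ι → ℝ, ∃ a b,
      HasTaylorBound (fun w => ∏ i ∈ S, smoothStep δ (c i) (w i)) a b K := by
  classical
  obtain ⟨g₁, g₂, K₀, hK₀, h0, h1, h2, ht⟩ := exists_taylor_smoothTransition
  induction S using Finset.induction_on with
  | empty => exact ⟨1, le_rfl, fun c => ⟨fun _ _ => 0, fun _ _ _ => 0, by
      constructor <;> intros <;> simp; positivity⟩⟩
  | insert k S hk ih =>
    obtain ⟨K₁, hK₁, H⟩ := ih
    set K := max K₁ (K₀ * (1 + 1 / δ + 1 / δ ^ 2 + 1 / δ ^ 3)) with hK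
    have hK1 : 1 ≤ K := hK₁.trans (le_max_left _ _)
    have hKle : K₀ * (1 + 1 / δ + 1 / δ ^ 2 + 1 / δ ^ 3) ≤ K := le_max_right _ _
    have p1 : 0 < 1 / δ := by positivity
    have p2 : 0 < 1 / δ ^ 2 := by positivity
    have p3 : 0 < 1 / δ ^ 3 := by positivity
    have q1 : K₀ * (1 / δ) ≤ K := le_trans (by gcongr; linarith) hKle
    have q2 : K₀ * (1 / δ ^ 2) ≤ K := le_trans (by gcongr; linarith) hKle
    have q3 : K₀ * (1 / δ ^ 3) ≤ K := le_trans (by gcongr; linarith) hKle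
    refine ⟨10 * K ^ 2, by nlinarith, fun c => ?_⟩
    obtain ⟨a, b, hab⟩ := H c
    have hab' : HasTaylorBound (fun w => ∏ i ∈ S, smoothStep δ (c i) (w i)) a b K := by
      have hle : K₁ ≤ K := le_max_left _ _
      refine ⟨hab.nonneg, hab.le_one, hab.first_nonpos, fun w i => (hab.first_bound w i).trans hle,
        hab.mixed_nonneg, fun w i j => (hab.second_bound w i j).trans hle,
        fun w v => (hab.taylor w v).trans ?_⟩
      have : 0 ≤ ∑ i, |v i| := Finset.sum_nonneg fun i _ => abs_nonneg _
      gcongr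
    obtain ⟨a', b', h⟩ := hab'.mul_eval (g := smoothStep δ (c k))
      (g₁ := fun x => -(g₁ ((c k + δ - x) / δ) * (1 / δ)))
      (g₂ := fun x => g₂ ((c k + δ - x) / δ) * (1 / δ ^ 2)) hK1 (smoothStep_nonneg _ _)
      (smoothStep_le_one _ _) (fun x => by
        have := h0 ((c k + δ - x) / δ); simp only [Left.neg_nonpos_iff]; positivity)
      (fun x => by
        rw [abs_neg, abs_mul, abs_of_pos p1]; refine le_trans ?_ q1; gcongr; exact h1 _)
      (fun x => by
        rw [abs_mul, abs_of_pos p2]; refine le_trans ?_ q2; gcongr; exact h2 _)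
      (fun x t => by
        have := ht ((c k + δ - x) / δ) (-t / δ)
        have e : (c k + δ - x) / δ + -t / δ = (c k + δ - (x + t)) / δ := by ring
        rw [e, abs_div, abs_neg, abs_of_pos hδ] at this
        unfold smoothStep
        refine le_trans (le_of_eq ?_) (this.trans ?_)
        · congr 1; ring
        · rw [div_pow, div_eq_mul_one_div, mul_comm (|t| ^ 3), ← mul_assoc]
          gcongr) k
    refine ⟨a', b', ?_⟩
    convert h using 2 with w
    rw [Finset.prod_insert hk, mul_comm]

/-! ### Finite centered Gaussian vectors. -/

/-- The finite family `X` is jointly Gaussian and centered, with covariance matrix `K`. -/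
structure IsCenteredGaussian {ι Ω : Type*} [Fintype ι] [MeasurableSpace Ω] (P : Measure Ω)
    (X : ι → Ω → ℝ) (K : ι → ι → ℝ) : Prop where
  aemeasurable : ∀ i, AEMeasurable (X i) P
  symm : ∀ i j, K i j = K j i
  nonneg : ∀ c : ι → ℝ, 0 ≤ ∑ i, ∑ j, c i * c j * K i j
  map_sum : ∀ c : ι → ℝ, P.map (fun ω => ∑ i, c i * X i ω)
    = gaussianReal 0 (∑ i, ∑ j, c i * c j * K i j).toNNReal

namespace IsCenteredGaussian

variable {ι κ Ω : Type*} [Fintype ι] [Fintype κ] [MeasurableSpace Ω] {P : Measure Ω}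
  {X : ι → Ω → ℝ} {K : ι → ι → ℝ}

theorem aemeasurable_sum (h : IsCenteredGaussian P X K) (c : ι → ℝ) :
    AEMeasurable (fun ω => ∑ i, c i * X i ω) P :=
  Finset.aemeasurable_fun_sum _ fun i _ => (h.aemeasurable i).const_mul _

theorem isProbabilityMeasure (h : IsCenteredGaussian P X K) : IsProbabilityMeasure P := by
  have := h.map_sum 0
  have h2 : IsProbabilityMeasure (P.map (fun ω => ∑ i, (0 : ι → ℝ) i * X i ω)) := by
    rw [this]; infer_instance
  refine ⟨?_⟩
  rw [← h2.measure_univ, Measure.map_apply_of_aemeasurable (h.aemeasurable_sum 0) .univ]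
  simp

theorem integral_cexp (h : IsCenteredGaussian P X K) (c : ι → ℝ) :
    ∫ ω, Complex.exp ((∑ i, c i * X i ω : ℝ) * Complex.I) ∂P
      = Complex.exp (-((∑ i, ∑ j, c i * c j * K i j : ℝ) : ℂ) / 2) := by
  have h1 := charFun_gaussianReal (μ := 0) (v := (∑ i, ∑ j, c i * c j * K i j).toNNReal) 1
  rw [← h.map_sum, charFun_apply_real,
    integral_map (h.aemeasurable_sum c) (by fun_prop), Real.coe_toNNReal _ (h.nonneg c)] at h1
  simpa [neg_div] using h1

/-- Rescaling c to t c turns the hypothesis at a single frequency into the full characteristic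
function of every linear form. -/
theorem of_cexp [IsProbabilityMeasure P] (hm : ∀ i, AEMeasurable (X i) P)
    (hs : ∀ i j, K i j = K j i) (hK : ∀ c : ι → ℝ, 0 ≤ ∑ i, ∑ j, c i * c j * K i j)
    (h : ∀ c : ι → ℝ, ∫ ω, Complex.exp ((∑ i, c i * X i ω : ℝ) * Complex.I) ∂P
      = Complex.exp (-((∑ i, ∑ j, c i * c j * K i j : ℝ) : ℂ) / 2)) :
    IsCenteredGaussian P X K := by
  have hm' : ∀ c : ι → ℝ, AEMeasurable (fun ω => ∑ i, c i * X i ω) P := fun c =>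
    Finset.aemeasurable_fun_sum _ fun i _ => (hm i).const_mul _
  refine ⟨hm, hs, hK, fun c => ?_⟩
  have := Measure.isProbabilityMeasure_map (hm' c)
  refine Measure.ext_of_charFun ?_
  ext t
  rw [charFun_gaussianReal, charFun_apply_real, integral_map (hm' c) (by fun_prop),
    Real.coe_toNNReal _ (hK c)]
  have h2 := h (fun i => t * c i)
  have e1 : ∑ i, ∑ j, t * c i * (t * c j) * K i j = t ^ 2 * ∑ i, ∑ j, c i * c j * K i j := by
    simp only [Finset.mul_sum]
    exact Finset.sum_congr rfl fun i _ => Finset.sum_congr rfl fun j _ => by ring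
  have e2 : ∀ ω, ∑ i, t * c i * X i ω = t * ∑ i, c i * X i ω := fun ω => by
    simp only [Finset.mul_sum, mul_assoc]
  simp only [e1, e2] at h2
  push_cast at h2 ⊢
  rw [h2]
  congr 1
  ring

theorem comp_linear (h : IsCenteredGaussian P X K) (L : κ → ι → ℝ) :
    IsCenteredGaussian P (fun k ω => ∑ i, L k i * X i ω)
      (fun k l => ∑ i, ∑ j, L k i * L l j * K i j) := by
  have e : ∀ c : κ → ℝ, ∑ k, ∑ l, c k * c l * ∑ i, ∑ j, L k i * L l j * K i j
      = ∑ i, ∑ j, (∑ k, c k * L k i) * (∑ l, c l * L l j) * K i j := by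
    intro c
    simp only [Finset.sum_mul, Finset.mul_sum]
    calc _ = ∑ k, ∑ i, ∑ l, ∑ j, c k * c l * (L k i * L l j * K i j) :=
          Finset.sum_congr rfl fun k _ => Finset.sum_comm
      _ = ∑ i, ∑ k, ∑ j, ∑ l, c k * c l * (L k i * L l j * K i j) := by
          rw [Finset.sum_comm]
          exact Finset.sum_congr rfl fun k _ => Finset.sum_congr rfl fun _ _ => Finset.sum_comm
      _ = _ := Finset.sum_congr rfl fun i _ => by
          rw [Finset.sum_comm]
          refine Finset.sum_congr rfl fun j _ => ?_
          rw [Finset.sum_comm]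
          exact Finset.sum_congr rfl fun l _ => Finset.sum_congr rfl fun k _ => by ring
  refine ⟨fun k => h.aemeasurable_sum _, fun k l => ?_, fun c => ?_, fun c => ?_⟩
  · rw [Finset.sum_comm]
    exact Finset.sum_congr rfl fun j _ => Finset.sum_congr rfl fun i _ => by rw [h.symm i j]; ring
  · rw [e]; exact h.nonneg _
  · rw [e, ← h.map_sum]
    congr 1
    ext ω
    simp only [Finset.mul_sum, Finset.sum_mul]
    rw [Finset.sum_comm]
    exact Finset.sum_congr rfl fun j _ => Finset.sum_congr rfl fun i _ => by ring

theorem reindex (h : IsCenteredGaussian P X K) (f : κ → ι) :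
    IsCenteredGaussian P (fun k => X (f k)) (fun k l => K (f k) (f l)) := by
  classical
  have := h.comp_linear (fun (k : κ) i => if i = f k then 1 else 0)
  simpa [ite_mul, mul_ite] using this

theorem smul (h : IsCenteredGaussian P X K) (s : ι → ℝ) :
    IsCenteredGaussian P (fun i ω => s i * X i ω) (fun i j => s i * s j * K i j) := by
  classical
  have := h.comp_linear (fun (k : ι) i => if i = k then s k else 0)
  simpa [ite_mul, mul_ite] using this

theorem map_eval (h : IsCenteredGaussian P X K) (i : ι) :
    P.map (X i) = gaussianReal 0 (K i i).toNNReal := by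
  classical
  simpa [ite_mul, mul_ite] using h.map_sum (fun j => if j = i then 1 else 0)

theorem diag_nonneg (h : IsCenteredGaussian P X K) (i : ι) : 0 ≤ K i i := by
  classical
  simpa [ite_mul, mul_ite] using h.nonneg (fun j => if j = i then 1 else 0)

theorem memLp_eval (h : IsCenteredGaussian P X K) (i : ι) (p : ℝ≥0) : MemLp (X i) p P := by
  have h1 : MemLp id p (P.map (X i)) := by rw [h.map_eval]; exact memLp_id_gaussianReal p
  exact (memLp_map_measure_iff aestronglyMeasurable_id (h.aemeasurable i)).1 h1

theorem memLp_two (h : IsCenteredGaussian P X K) (i : ι) : MemLp (X i) 2 P := by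
  simpa using h.memLp_eval i 2

theorem integral_eval (h : IsCenteredGaussian P X K) (i : ι) : ∫ ω, X i ω ∂P = 0 := by
  have := integral_id_gaussianReal (μ := 0) (v := (K i i).toNNReal)
  rwa [← h.map_eval, integral_map (h.aemeasurable i) (by fun_prop)] at this

theorem integral_sq (h : IsCenteredGaussian P X K) (i : ι) : ∫ ω, X i ω ^ 2 ∂P = K i i := by
  have h1 := variance_id_gaussianReal (μ := 0) (v := (K i i).toNNReal)
  rw [variance_of_integral_eq_zero (by fun_prop) (by simp), ← h.map_eval,
    integral_map (h.aemeasurable i) (by fun_prop), Real.coe_toNNReal _ (h.diag_nonneg i)] at h1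
  simpa using h1

theorem sum_map (h : IsCenteredGaussian P X K) (c : ι → ℝ) :
    IsCenteredGaussian P (fun (_ : Unit) ω => ∑ i, c i * X i ω)
      (fun _ _ => ∑ i, ∑ j, c i * c j * K i j) :=
  h.comp_linear fun _ => c

theorem integrable_mul (h : IsCenteredGaussian P X K) (i j : ι) :
    Integrable (fun ω => X i ω * X j ω) P :=
  (h.memLp_two i).integrable_mul (h.memLp_two j)

/-- Polarization: the variance of X_i + X_j is already known. -/
theorem integral_mul (h : IsCenteredGaussian P X K) (i j : ι) :
    ∫ ω, X i ω * X j ω ∂P = K i j := by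
  classical
  have h1 := (h.comp_linear (fun (_ : Unit) k => (if k = i then 1 else 0) +
    if k = j then 1 else 0)).integral_sq ()
  simp only [add_mul, ite_mul, one_mul, zero_mul, Finset.sum_add_distrib, Finset.sum_ite_eq',
    Finset.mem_univ, if_true, mul_add, mul_ite, mul_one, mul_zero] at h1
  have e : ∀ ω, (X i ω + X j ω) ^ 2 = X i ω ^ 2 + X j ω ^ 2 + 2 * (X i ω * X j ω) :=
    fun ω => by ring
  simp only [e] at h1
  have i1 : Integrable (fun ω => X i ω ^ 2) P := (h.memLp_two i).integrable_sq
  have i2 : Integrable (fun ω => X j ω ^ 2) P := (h.memLp_two j).integrable_sq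
  rw [integral_add (f := fun ω => X i ω ^ 2 + X j ω ^ 2) (i1.add i2) ((h.integrable_mul i j).const_mul 2), integral_add i1 i2,
    integral_const_mul, h.integral_sq, h.integral_sq] at h1
  have := h.symm i j
  linarith

theorem congr_cov (h : IsCenteredGaussian P X K) {K' : ι → ι → ℝ} (e : ∀ i j, K i j = K' i j) :
    IsCenteredGaussian P X K' := by
  have : K = K' := by ext i j; exact e i j
  exact this ▸ h

end IsCenteredGaussian

namespace IsCenteredGaussian

variable {ι Ω : Type*} [Fintype ι] [MeasurableSpace Ω] {P : Measure Ω}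
  {X : ι → Ω → ℝ} {K : ι → ι → ℝ}

theorem aemeasurable_pi (h : IsCenteredGaussian P X K) : AEMeasurable (fun ω i => X i ω) P :=
  aemeasurable_pi_lambda _ h.aemeasurable

theorem canonical (h : IsCenteredGaussian P X K) :
    IsCenteredGaussian (P.map fun ω i => X i ω) (fun i x => x i) K := by
  refine ⟨fun i => (measurable_pi_apply i).aemeasurable, h.symm, h.nonneg, fun c => ?_⟩
  rw [AEMeasurable.map_map_of_aemeasurable
    (Continuous.measurable (by fun_prop)).aemeasurable h.aemeasurable_pi]
  exact h.map_sum c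

end IsCenteredGaussian

/-- Two measures on `ℝ^ι` for which the coordinates are Gaussian with the same covariance agree. -/
theorem IsCenteredGaussian.measure_ext {ι : Type*} [Fintype ι] {μ ν : Measure (ι → ℝ)}
    {K : ι → ι → ℝ} (hμ : IsCenteredGaussian μ (fun i x => x i) K)
    (hν : IsCenteredGaussian ν (fun i x => x i) K) : μ = ν := by
  classical
  have := hμ.isProbabilityMeasure
  have := hν.isProbabilityMeasure
  refine Measure.ext_of_charFunDual ?_
  ext L
  obtain ⟨c, e⟩ : ∃ c : ι → ℝ, ∀ x : ι → ℝ, L x = ∑ i, c i * x i :=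
    ⟨fun i => L (fun j => if i = j then 1 else 0), fun x =>
      (L.toLinearMap.pi_apply_eq_sum_univ x).trans (Finset.sum_congr rfl fun i _ => mul_comm _ _)⟩
  rw [charFunDual_apply, charFunDual_apply]
  simp only [e]
  rw [hμ.integral_cexp, hν.integral_cexp]

/-! ### Gaussian comparison by replacement in small increments. -/

section Lindeberg

set_option linter.unusedSectionVars false

variable {ι : Type*} [Fintype ι] {μ ν : Measure (ι → ℝ)} {K K' : ι → ι → ℝ} {f : (ι → ℝ) → ℝ}

/-- Averaging of `f` over the dilation by `α` of the measure `μ`. -/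
noncomputable def smoothing (μ : Measure (ι → ℝ)) (α : ℝ) (f : (ι → ℝ) → ℝ) (w : ι → ℝ) : ℝ :=
  ∫ x, f (w + α • x) ∂μ

theorem measurable_smoothing [SFinite μ] (α : ℝ) (hf : Measurable f) :
    Measurable (smoothing μ α f) := by
  have : StronglyMeasurable (Function.uncurry fun w x => f (w + α • x)) :=
    (hf.comp (by fun_prop)).stronglyMeasurable
  exact this.integral_prod_right.measurable

theorem smoothing_mem_Icc [IsProbabilityMeasure μ] (α : ℝ) (hf : ∀ w, f w ∈ Set.Icc (0 : ℝ) 1)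
    (w : ι → ℝ) : smoothing μ α f w ∈ Set.Icc (0 : ℝ) 1 := by
  refine ⟨integral_nonneg fun x => (hf _).1, ?_⟩
  have := norm_integral_le_of_norm_le_const (μ := μ) (f := fun x => f (w + α • x)) (C := 1)
    (.of_forall fun x => by
      rw [Real.norm_eq_abs, abs_of_nonneg (hf _).1]; exact (hf _).2)
  simp only [probReal_univ, mul_one] at this
  exact (le_abs_self _).trans this

theorem integrable_comp_add_smul [IsFiniteMeasure μ] (hm : Measurable f)
    (hf : ∀ w, f w ∈ Set.Icc (0 : ℝ) 1) (α : ℝ) (w : ι → ℝ) :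
    Integrable (fun x => f (w + α • x)) μ :=
  .of_bound (hm.comp (by fun_prop)).aestronglyMeasurable 1 (.of_forall fun x => by
      rw [Real.norm_eq_abs, abs_of_nonneg (hf _).1]; exact (hf _).2)

theorem smoothing_comm [IsProbabilityMeasure μ] [IsProbabilityMeasure ν] (hm : Measurable f)
    (hf : ∀ w, f w ∈ Set.Icc (0 : ℝ) 1) (α β : ℝ) (w : ι → ℝ) :
    smoothing μ α (smoothing ν β f) w = smoothing ν β (smoothing μ α f) w := by
  unfold smoothing
  rw [integral_integral_swap]
  · refine integral_congr_ae (.of_forall fun y => integral_congr_ae (.of_forall fun x => ?_))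
    simp only [add_right_comm]
  · refine .of_bound (C := 1) ?_ (.of_forall fun x => ?_)
    · exact (hm.comp (by fun_prop)).aestronglyMeasurable
    · simp only [Function.uncurry]
      rw [Real.norm_eq_abs, abs_of_nonneg (hf _).1]; exact (hf _).2

/-- Stability of centered Gaussian laws under independent sums, where the squares of the scales add.
-/
theorem IsCenteredGaussian.map_prod_add_smul (hμ : IsCenteredGaussian μ (fun i x => x i) K)
    (α β : ℝ) : (μ.prod μ).map (fun z => α • z.1 + β • z.2) = μ.map (√(α ^ 2 + β ^ 2) • ·) := by
  have := hμ.isProbabilityMeasure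
  set γ := √(α ^ 2 + β ^ 2) with hγ
  have hγ2 : γ ^ 2 = α ^ 2 + β ^ 2 := Real.sq_sqrt (by positivity)
  have hm1 : AEMeasurable (fun z : (ι → ℝ) × (ι → ℝ) => α • z.1 + β • z.2) (μ.prod μ) := by
    fun_prop
  have hm2 : AEMeasurable (fun z : (ι → ℝ) => γ • z) μ := by fun_prop
  have h2 : IsCenteredGaussian (μ.map (γ • ·)) (fun i x => x i) (fun i j => γ * γ * K i j) :=
    (hμ.smul fun _ => γ).canonical
  have := Measure.isProbabilityMeasure_map hm1
  refine IsCenteredGaussian.measure_ext (.of_cexp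
    (fun i => (measurable_pi_apply i).aemeasurable) h2.symm h2.nonneg fun c => ?_) h2
  rw [integral_map hm1 (Continuous.aestronglyMeasurable (by fun_prop))]
  have e : ∀ z : (ι → ℝ) × (ι → ℝ), Complex.exp ((∑ i, c i * (α • z.1 + β • z.2) i : ℝ) * Complex.I)
      = Complex.exp ((∑ i, (α * c i) * z.1 i : ℝ) * Complex.I)
        * Complex.exp ((∑ i, (β * c i) * z.2 i : ℝ) * Complex.I) := fun z => by
    rw [← Complex.exp_add, ← add_mul, ← Complex.ofReal_add, ← Finset.sum_add_distrib]
    congr 3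
    refine Finset.sum_congr rfl fun i _ => ?_
    simp only [Pi.add_apply, Pi.smul_apply, smul_eq_mul]
    ring
  simp only [e]
  rw [integral_prod_mul (fun x : ι → ℝ => Complex.exp ((∑ i, (α * c i) * x i : ℝ) * Complex.I))
    (fun x : ι → ℝ => Complex.exp ((∑ i, (β * c i) * x i : ℝ) * Complex.I)), hμ.integral_cexp,
    hμ.integral_cexp, ← Complex.exp_add]
  have q : ∀ s t : ℝ, ∑ i, ∑ j, (s * c i) * (s * c j) * K i j = s ^ 2 * ∑ i, ∑ j, c i * c j * K i j := by
    intro s t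
    simp only [Finset.mul_sum]
    exact Finset.sum_congr rfl fun i _ => Finset.sum_congr rfl fun j _ => by ring
  have q' : ∑ i, ∑ j, c i * c j * (γ * γ * K i j) = γ ^ 2 * ∑ i, ∑ j, c i * c j * K i j := by
    simp only [Finset.mul_sum]
    exact Finset.sum_congr rfl fun i _ => Finset.sum_congr rfl fun j _ => by ring
  rw [q α 0, q β 0, q', hγ2]
  push_cast
  congr 1
  ring

theorem IsCenteredGaussian.smoothing_smoothing (hμ : IsCenteredGaussian μ (fun i x => x i) K)
    (hm : Measurable f) (hf : ∀ w, f w ∈ Set.Icc (0 : ℝ) 1) (α β : ℝ) (w : ι → ℝ) :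
    smoothing μ α (smoothing μ β f) w = smoothing μ √(α ^ 2 + β ^ 2) f w := by
  have := hμ.isProbabilityMeasure
  have h := hμ.map_prod_add_smul α β
  have h1 : ∫ z, f (w + (α • z.1 + β • z.2)) ∂(μ.prod μ) = smoothing μ √(α ^ 2 + β ^ 2) f w := by
    have hmw : Measurable fun z => f (w + z) := hm.comp (by fun_prop)
    have e1 := integral_map (μ := μ.prod μ) (φ := fun z => α • z.1 + β • z.2) (by fun_prop)
      (f := fun z => f (w + z)) hmw.aestronglyMeasurable
    rw [h, integral_map (by fun_prop) hmw.aestronglyMeasurable] at e1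
    exact e1.symm
  rw [← h1, integral_prod]
  · unfold smoothing
    simp only [add_assoc]
  · refine .of_bound (C := 1) (hm.comp (by fun_prop)).aestronglyMeasurable (.of_forall fun x => ?_)
    rw [Real.norm_eq_abs, abs_of_nonneg (hf _).1]; exact (hf _).2

theorem IsCenteredGaussian.integrable_sum_abs_pow (hμ : IsCenteredGaussian μ (fun i x => x i) K) :
    Integrable (fun x : ι → ℝ => (∑ i, |x i|) ^ 3) μ := by
  have h1 : MemLp (fun x : ι → ℝ => ∑ i, |x i|) (3 : ℝ≥0) μ :=
    memLp_finsetSum _ fun i _ => (hμ.memLp_eval i 3).abs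
  have h2 := h1.integrable_norm_pow (p := 3) (by norm_num)
  refine h2.congr (.of_forall fun x => ?_)
  simp only [Real.norm_eq_abs]
  rw [abs_of_nonneg (Finset.sum_nonneg fun i _ => abs_nonneg _)]

/-- Integrating the Taylor expansion, the linear term vanishes by centering and the quadratic one
produces the covariance. The cubic remainder is integrable because Gaussian vectors have third
moments. -/
theorem IsCenteredGaussian.abs_smoothing_sub_le (hμ : IsCenteredGaussian μ (fun i x => x i) K)
    {a b} {C : ℝ} (hf : HasTaylorBound f a b C) (hm : Measurable f) {α : ℝ} (hα : 0 ≤ α)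
    (w : ι → ℝ) :
    |smoothing μ α f w - f w - α ^ 2 * (∑ i, ∑ j, b w i j * K i j) / 2|
      ≤ C * α ^ 3 * ∫ x, (∑ i, |x i|) ^ 3 ∂μ := by
  have := hμ.isProbabilityMeasure
  have hI : ∀ w, f w ∈ Set.Icc (0 : ℝ) 1 := fun w => ⟨hf.nonneg w, hf.le_one w⟩
  have i0 := integrable_comp_add_smul (μ := μ) hm hI α w
  have i1 : ∀ i, Integrable (fun x : ι → ℝ => x i) μ := fun i =>
    (hμ.memLp_two i).integrable (by norm_num)
  have i2 : Integrable (fun x : ι → ℝ => ∑ i, a w i * (α • x) i) μ :=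
    integrable_finsetSum _ fun i _ => ((i1 i).const_mul α).const_mul _
  have i3 : Integrable (fun x : ι → ℝ => ∑ i, ∑ j, b w i j * ((α • x) i * (α • x) j)) μ := by
    refine integrable_finsetSum _ fun i _ => integrable_finsetSum _ fun j _ => ?_
    refine Integrable.const_mul ?_ _
    refine ((hμ.integrable_mul i j).const_mul (α ^ 2)).congr (.of_forall fun x => ?_)
    simp only [Pi.smul_apply, smul_eq_mul]; ring
  have e2 : ∫ x, ∑ i, a w i * (α • x) i ∂μ = 0 := by
    simp only [Pi.smul_apply, smul_eq_mul]
    rw [integral_finsetSum _ fun i _ => ((i1 i).const_mul α).const_mul _]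
    simp only [integral_const_mul, hμ.integral_eval, mul_zero,
      Finset.sum_const_zero]
  have e3 : ∫ x, ∑ i, ∑ j, b w i j * ((α • x) i * (α • x) j) ∂μ
      = α ^ 2 * (∑ i, ∑ j, b w i j * K i j) := by
    have e : ∀ x : ι → ℝ, ∑ i, ∑ j, b w i j * ((α • x) i * (α • x) j)
        = ∑ i, ∑ j, (b w i j * α ^ 2) * (x i * x j) := fun x => by
      refine Finset.sum_congr rfl fun i _ => Finset.sum_congr rfl fun j _ => ?_
      simp only [Pi.smul_apply, smul_eq_mul]; ring
    simp only [e]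
    rw [integral_finsetSum _ fun i _ => integrable_finsetSum _ fun j _ =>
      (hμ.integrable_mul i j).const_mul _, Finset.mul_sum]
    refine Finset.sum_congr rfl fun i _ => ?_
    rw [integral_finsetSum _ fun j _ => (hμ.integrable_mul i j).const_mul _, Finset.mul_sum]
    refine Finset.sum_congr rfl fun j _ => ?_
    rw [integral_const_mul, hμ.integral_mul]
    ring
  have key : smoothing μ α f w - f w - α ^ 2 * (∑ i, ∑ j, b w i j * K i j) / 2
      = ∫ x, (f (w + α • x) - f w - ∑ i, a w i * (α • x) i
        - (∑ i, ∑ j, b w i j * ((α • x) i * (α • x) j)) / 2) ∂μ := by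
    rw [integral_sub (f := fun x => f (w + α • x) - f w - ∑ i, a w i * (α • x) i)
      ((i0.sub (integrable_const _)).sub i2) (i3.div_const 2),
      integral_sub (f := fun x => f (w + α • x) - f w) (i0.sub (integrable_const _)) i2,
      integral_sub i0 (integrable_const _), e2, integral_div, e3]
    simp [smoothing]
  rw [key, ← integral_const_mul, ← Real.norm_eq_abs]
  refine (norm_integral_le_integral_norm _).trans ?_
  refine integral_mono_of_nonneg (.of_forall fun x => norm_nonneg _)
    (hμ.integrable_sum_abs_pow.const_mul _) (.of_forall fun x => ?_)
  refine (hf.taylor w (α • x)).trans (le_of_eq ?_)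
  simp only [Pi.smul_apply, smul_eq_mul, abs_mul, ← Finset.mul_sum, abs_of_nonneg hα]
  ring

theorem smoothing_le_smoothing_add {g h : (ι → ℝ) → ℝ} [IsProbabilityMeasure μ] {e α : ℝ}
    (hgm : Measurable g) (hg : ∀ w, g w ∈ Set.Icc (0 : ℝ) 1) (hhm : Measurable h)
    (hh : ∀ w, h w ∈ Set.Icc (0 : ℝ) 1) (hle : ∀ w, g w ≤ h w + e) (w : ι → ℝ) :
    smoothing μ α g w ≤ smoothing μ α h w + e := by
  have i1 := integrable_comp_add_smul (μ := μ) hgm hg α w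
  have i2 := integrable_comp_add_smul (μ := μ) hhm hh α w
  have : smoothing μ α h w + e = ∫ x, (h (w + α • x) + e) ∂μ := by
    rw [integral_add i2 (integrable_const _)]; simp [smoothing]
  rw [this]
  exact integral_mono i1 (i2.add (integrable_const _)) fun x => hle _

/-- Smoothings at scales α and √k α compose to the scale √(k+1) α, and smoothings by the two
measures commute. Hence increments can be swapped one at a time and the one-step errors add. -/
theorem IsCenteredGaussian.smoothing_iterate_le (hμ : IsCenteredGaussian μ (fun i x => x i) K)
    (hν : IsCenteredGaussian ν (fun i x => x i) K') (hm : Measurable f)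
    (hf : ∀ w, f w ∈ Set.Icc (0 : ℝ) 1) {α e : ℝ} (hα : 0 ≤ α)
    (h : ∀ w, smoothing μ α f w ≤ smoothing ν α f w + e) (k : ℕ) (w : ι → ℝ) :
    smoothing μ (√k * α) f w ≤ smoothing ν (√k * α) f w + k * e := by
  have := hμ.isProbabilityMeasure
  have := hν.isProbabilityMeasure
  induction k generalizing w with
  | zero => simp [smoothing]
  | succ k ih =>
    have hr : √(α ^ 2 + (√k * α) ^ 2) = √((k + 1 : ℕ) : ℝ) * α := by
      rw [mul_pow, Real.sq_sqrt (Nat.cast_nonneg k), Nat.cast_add_one,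
        show α ^ 2 + k * α ^ 2 = (k + 1) * α ^ 2 by ring, Real.sqrt_mul (by positivity),
        Real.sqrt_sq hα]
    have hr' : √((√k * α) ^ 2 + α ^ 2) = √((k + 1 : ℕ) : ℝ) * α := by rw [add_comm, hr]
    have s1 := smoothing_le_smoothing_add (μ := μ) (α := α) (measurable_smoothing (√k * α) hm)
      (smoothing_mem_Icc (√k * α) hf) (measurable_smoothing (√k * α) hm)
      (smoothing_mem_Icc (√k * α) hf) ih w
    have s2 := smoothing_le_smoothing_add (μ := ν) (α := √k * α) (measurable_smoothing α hm)
      (smoothing_mem_Icc α hf) (measurable_smoothing α hm) (smoothing_mem_Icc α hf) h w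
    rw [hμ.smoothing_smoothing hm hf, hr, smoothing_comm hm hf] at s1
    rw [hν.smoothing_smoothing hm hf, hr'] at s2
    push_cast at s1 s2 ⊢
    linarith

/-- With n increments of scale 1/√n, the quadratic errors sum to a bounded multiple of η, while the
n cubic errors of order n^(-3/2) disappear as n grows. -/
theorem IsCenteredGaussian.integral_le_of_hasTaylorBound
    (hμ : IsCenteredGaussian μ (fun i x => x i) K)
    (hν : IsCenteredGaussian ν (fun i x => x i) K') {a b} {C η : ℝ}
    (hf : HasTaylorBound f a b C) (hm : Measurable f)
    (hoff : ∀ i j, i ≠ j → K i j ≤ K' i j + η) (hdiag : ∀ i, |K i i - K' i i| ≤ η) :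
    ∫ x, f x ∂μ ≤ ∫ x, f x ∂ν + C * (Fintype.card ι) ^ 2 * η := by
  classical
  have := hμ.isProbabilityMeasure
  have := hν.isProbabilityMeasure
  rcases isEmpty_or_nonempty ι with hι | ⟨⟨i₀⟩⟩
  · have e : ∀ x : ι → ℝ, f x = f 0 := fun x => congrArg f (Subsingleton.elim _ _)
    simp [e]
  have hC : 0 ≤ C := (abs_nonneg _).trans (hf.first_bound 0 i₀)
  have hη : 0 ≤ η := (abs_nonneg _).trans (hdiag i₀)
  have hI : ∀ w, f w ∈ Set.Icc (0 : ℝ) 1 := fun w => ⟨hf.nonneg w, hf.le_one w⟩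
  set M := ∫ x, (∑ i, |x i|) ^ 3 ∂μ
  set N := ∫ x, (∑ i, |x i|) ^ 3 ∂ν
  -- Off the diagonal b is nonnegative, so a one-sided covariance bound is enough. The diagonal
  -- entries of b have no sign, hence the two-sided hypothesis on variances.
  have hquad : ∀ w, ∑ i, ∑ j, b w i j * K i j
      ≤ ∑ i, ∑ j, b w i j * K' i j + C * (Fintype.card ι) ^ 2 * η := by
    intro w
    have : C * (Fintype.card ι : ℝ) ^ 2 * η = ∑ i : ι, ∑ j : ι, C * η := by
      simp; ring
    rw [this, ← Finset.sum_add_distrib]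
    refine Finset.sum_le_sum fun i _ => ?_
    rw [← Finset.sum_add_distrib]
    refine Finset.sum_le_sum fun j _ => ?_
    by_cases hij : i = j
    · subst hij
      have h1 : b w i i * (K i i - K' i i) ≤ C * η := by
        refine (le_abs_self _).trans ?_
        rw [abs_mul]
        exact mul_le_mul (hf.second_bound w i i) (hdiag i) (abs_nonneg _) hC
      linarith
    · have h1 := hf.mixed_nonneg w i j hij
      have h2 := mul_le_mul_of_nonneg_left (hoff i j hij) h1
      have h3 := mul_le_mul_of_nonneg_right ((le_abs_self _).trans (hf.second_bound w i j)) hη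
      linarith
  have step : ∀ n : ℕ, 0 < n → ∫ x, f x ∂μ ≤ ∫ x, f x ∂ν + C * (Fintype.card ι) ^ 2 * η / 2
      + C * (M + N) * (1 / √n) := by
    intro n hn
    have hn' : (0 : ℝ) < n := by exact_mod_cast hn
    have hs : 0 < √(n : ℝ) := Real.sqrt_pos.2 hn'
    set α : ℝ := 1 / √n with hα
    have hα0 : 0 ≤ α := by positivity
    have hα2 : α ^ 2 = 1 / n := by rw [hα, div_pow, one_pow, Real.sq_sqrt hn'.le]
    have h1 := hμ.smoothing_iterate_le hν hm hI (e := α ^ 2 * (C * (Fintype.card ι) ^ 2 * η) / 2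
      + C * α ^ 3 * (M + N)) hα0 (fun w => by
        have u1 := (abs_le.1 (hμ.abs_smoothing_sub_le hf hm hα0 w)).2
        have u2 := (abs_le.1 (hν.abs_smoothing_sub_le hf hm hα0 w)).1
        have u3 := mul_le_mul_of_nonneg_left (hquad w) (sq_nonneg α)
        linarith) n 0
    have e1 : √(n : ℝ) * α = 1 := by rw [hα]; field_simp
    rw [e1] at h1
    simp only [smoothing, one_smul, zero_add] at h1
    refine h1.trans (le_of_eq ?_)
    have e2 : (n : ℝ) * α ^ 2 = 1 := by rw [hα2]; field_simp
    have e3 : α ^ 3 = α ^ 2 * α := by ring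
    rw [e3]
    linear_combination ((C * (Fintype.card ι) ^ 2 * η) / 2 + C * α * (M + N)) * e2
  have lim : Tendsto (fun n : ℕ => ∫ x, f x ∂ν + C * (Fintype.card ι) ^ 2 * η / 2
      + C * (M + N) * (1 / √n)) atTop
      (𝓝 (∫ x, f x ∂ν + C * (Fintype.card ι) ^ 2 * η / 2 + C * (M + N) * 0)) := by
    refine tendsto_const_nhds.add (tendsto_const_nhds.mul ?_)
    simp only [one_div]
    exact (Real.tendsto_sqrt_atTop.comp tendsto_natCast_atTop_atTop).inv_tendsto_atTop
  have := ge_of_tendsto lim (eventually_atTop.2 ⟨1, fun n hn => step n hn⟩)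
  have h0 : 0 ≤ C * (Fintype.card ι : ℝ) ^ 2 * η := by positivity
  linarith

end Lindeberg

/-- Quantitative Gaussian comparison. -/
theorem exists_gaussian_comparison (ι : Type*) [Fintype ι] {δ : ℝ} (hδ : 0 < δ) :
    ∃ C : ℝ, 0 ≤ C ∧ ∀ {Ω : Type u} {Ω' : Type v} [MeasurableSpace Ω] [MeasurableSpace Ω']
      {P : Measure Ω} {P' : Measure Ω'} {X : ι → Ω → ℝ} {Y : ι → Ω' → ℝ} {K K' : ι → ι → ℝ}
      (_ : IsCenteredGaussian P X K) (_ : IsCenteredGaussian P' Y K') {η : ℝ} (c : ι → ℝ),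
      (∀ i j, i ≠ j → K i j ≤ K' i j + η) → (∀ i, |K i i - K' i i| ≤ η) →
      P.real {ω | ∀ i, X i ω ≤ c i} ≤ P'.real {ω | ∀ i, Y i ω ≤ c i + δ} + C * η := by
  obtain ⟨C, hC1, hC⟩ := exists_hasTaylorBound_prod_smoothStep hδ (Finset.univ : Finset ι)
  refine ⟨C * (Fintype.card ι) ^ 2, by positivity, fun {Ω Ω'} _ _ {P P' X Y K K'} hX hY η c h1 h2 => ?_⟩
  obtain ⟨a, b, hab⟩ := hC c
  have := hX.isProbabilityMeasure
  have := hY.isProbabilityMeasure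
  have hcont : Continuous (fun w : ι → ℝ => ∏ i, smoothStep δ (c i) (w i)) :=
    continuous_finsetProd _ fun i _ => (continuous_smoothStep _ _).comp (continuous_apply i)
  have hm := hcont.measurable
  have hI : ∀ w : ι → ℝ, ∏ i, smoothStep δ (c i) (w i) ∈ Set.Icc (0 : ℝ) 1 :=
    fun w => ⟨hab.nonneg w, hab.le_one w⟩
  have key := hX.canonical.integral_le_of_hasTaylorBound hY.canonical hab hm h1 h2
  rw [integral_map hX.aemeasurable_pi hm.aestronglyMeasurable,
    integral_map hY.aemeasurable_pi hm.aestronglyMeasurable] at key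
  have nX : NullMeasurableSet {ω | ∀ i, X i ω ≤ c i} P := by
    have : {ω | ∀ i, X i ω ≤ c i} = (fun ω i => X i ω) ⁻¹' (Set.Iic c) := by
      ext ω; simp [Pi.le_def]
    rw [this]
    exact hX.aemeasurable_pi.nullMeasurableSet_preimage measurableSet_Iic
  have nY : NullMeasurableSet {ω | ∀ i, Y i ω ≤ c i + δ} P' := by
    have : {ω | ∀ i, Y i ω ≤ c i + δ} = (fun ω i => Y i ω) ⁻¹' (Set.Iic fun i => c i + δ) := by
      ext ω; simp [Pi.le_def]
    rw [this]
    exact hY.aemeasurable_pi.nullMeasurableSet_preimage measurableSet_Iic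
  have iX : Integrable (fun ω => ∏ i, smoothStep δ (c i) (X i ω)) P :=
    .of_bound (hm.comp_aemeasurable hX.aemeasurable_pi).aestronglyMeasurable 1
      (.of_forall fun ω => by
        rw [Real.norm_eq_abs, abs_of_nonneg (hI fun i => X i ω).1]; exact (hI fun i => X i ω).2)
  have iY : Integrable (fun ω => ∏ i, smoothStep δ (c i) (Y i ω)) P' :=
    .of_bound (hm.comp_aemeasurable hY.aemeasurable_pi).aestronglyMeasurable 1
      (.of_forall fun ω => by
        rw [Real.norm_eq_abs, abs_of_nonneg (hI fun i => Y i ω).1]; exact (hI fun i => Y i ω).2)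
  -- The product of steps lies between the indicators of the orthants at levels c and c + δ.
  have lX : P.real {ω | ∀ i, X i ω ≤ c i} ≤ ∫ ω, ∏ i, smoothStep δ (c i) (X i ω) ∂P := by
    have e1 : P.real {ω | ∀ i, X i ω ≤ c i}
        = ∫ ω, {ω | ∀ i, X i ω ≤ c i}.indicator (fun _ => (1 : ℝ)) ω ∂P := by
      rw [integral_indicator₀ nX]; simp
    rw [e1]
    refine integral_mono_of_nonneg (.of_forall fun ω => Set.indicator_nonneg (by simp) _) iX
      (.of_forall fun ω => ?_)
    by_cases h : ω ∈ {ω | ∀ i, X i ω ≤ c i}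
    · rw [Set.indicator_of_mem h]
      exact (Finset.prod_eq_one fun i _ => smoothStep_eq_one hδ (h i)).ge
    · rw [Set.indicator_of_notMem h]
      exact (hI _).1
  have lY : ∫ ω, ∏ i, smoothStep δ (c i) (Y i ω) ∂P' ≤ P'.real {ω | ∀ i, Y i ω ≤ c i + δ} := by
    have e1 : P'.real {ω | ∀ i, Y i ω ≤ c i + δ}
        = ∫ ω, {ω | ∀ i, Y i ω ≤ c i + δ}.indicator (fun _ => (1 : ℝ)) ω ∂P' := by
      rw [integral_indicator₀ nY]; simp
    rw [e1]
    refine integral_mono_of_nonneg (.of_forall fun ω => (hI _).1)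
      ((integrable_const (1 : ℝ)).indicator₀ nY) (.of_forall fun ω => ?_)
    by_cases h : ω ∈ {ω | ∀ i, Y i ω ≤ c i + δ}
    · rw [Set.indicator_of_mem h]
      exact (hI _).2
    · rw [Set.indicator_of_notMem h]
      simp only [Set.mem_ofPred_eq, not_forall, not_le] at h
      obtain ⟨i, hi⟩ := h
      exact (Finset.prod_eq_zero (Finset.mem_univ i) (smoothStep_eq_zero hδ hi.le)).le
  linarith

/-! ### Slepian's inequality and its consequences. -/

namespace IsCenteredGaussian

section Basic

variable {ι κ Ω : Type*} [Fintype ι] [Fintype κ] [MeasurableSpace Ω] {P : Measure Ω}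
  {X : ι → Ω → ℝ} {K : ι → ι → ℝ}

theorem nullMeasurableSet_le (h : IsCenteredGaussian P X K) (c : ι → ℝ) :
    NullMeasurableSet {ω | ∀ i, X i ω ≤ c i} P := by
  have : {ω | ∀ i, X i ω ≤ c i} = (fun ω i => X i ω) ⁻¹' (Set.Iic c) := by
    ext ω; simp [Pi.le_def]
  rw [this]
  exact h.aemeasurable_pi.nullMeasurableSet_preimage measurableSet_Iic

theorem tendsto_real_le_add (h : IsCenteredGaussian P X K) (c : ι → ℝ) :
    Tendsto (fun m : ℕ => P.real {ω | ∀ i, X i ω ≤ c i + 1 / ((m : ℝ) + 1)}) atTop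
      (𝓝 (P.real {ω | ∀ i, X i ω ≤ c i})) := by
  have := h.isProbabilityMeasure
  have e : {ω | ∀ i, X i ω ≤ c i} = ⋂ m : ℕ, {ω | ∀ i, X i ω ≤ c i + 1 / ((m : ℝ) + 1)} := by
    ext ω
    simp only [Set.mem_iInter, Set.mem_ofPred_eq]
    refine ⟨fun H m i => (H i).trans (by have : 0 < 1 / ((m : ℝ) + 1) := by positivity
                                         linarith), fun H i => ?_⟩
    have l : Tendsto (fun m : ℕ => c i + 1 / ((m : ℝ) + 1)) atTop (𝓝 (c i + 0)) :=
      tendsto_const_nhds.add tendsto_one_div_add_atTop_nhds_zero_nat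
    rw [add_zero] at l
    exact ge_of_tendsto l (.of_forall fun m => H m i)
  rw [e]
  refine (ENNReal.tendsto_toReal (measure_ne_top _ _)).comp
    (tendsto_measure_iInter_atTop (fun m => h.nullMeasurableSet_le _) ?_ ⟨0, measure_ne_top _ _⟩)
  intro m n hmn ω H i
  refine (H i).trans ?_
  gcongr

theorem tendsto_real_le_neg (P : Measure Ω) [IsFiniteMeasure P] (X : ι → Ω → ℝ) :
    Tendsto (fun m : ℕ => P.real {ω | ∀ i, X i ω ≤ -(1 / ((m : ℝ) + 1))}) atTop
      (𝓝 (P.real {ω | ∀ i, X i ω < 0})) := by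
  have e : {ω | ∀ i, X i ω < 0} = ⋃ m : ℕ, {ω | ∀ i, X i ω ≤ -(1 / ((m : ℝ) + 1))} := by
    ext ω
    simp only [Set.mem_iUnion, Set.mem_ofPred_eq]
    constructor
    · intro H
      have l : Tendsto (fun m : ℕ => -(1 / ((m : ℝ) + 1))) atTop (𝓝 (-0)) :=
        tendsto_one_div_add_atTop_nhds_zero_nat.neg
      rw [neg_zero] at l
      have : ∀ i, ∀ᶠ m : ℕ in atTop, X i ω ≤ -(1 / ((m : ℝ) + 1)) := fun i =>
        (l.eventually (lt_mem_nhds (H i))).mono fun m hm => hm.le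
      exact (eventually_all.2 this).exists
    · rintro ⟨m, hm⟩ i
      have : 0 < 1 / ((m : ℝ) + 1) := by positivity
      linarith [hm i]
  rw [e]
  refine (ENNReal.tendsto_toReal (measure_ne_top _ _)).comp (tendsto_measure_iUnion_atTop ?_)
  intro m n hmn ω H i
  refine (H i).trans ?_
  gcongr

theorem of_gaussian_family {T : Type*} {Z : T → Ω → ℝ} (hZ : IsGaussianProcess Z P)
    (h0 : ∀ t, ∫ ω, Z t ω ∂P = 0) {A : T → T → ℝ} (hA : ∀ s t, ∫ ω, Z s ω * Z t ω ∂P = A s t)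
    (f : ι → T) : IsCenteredGaussian P (fun i => Z (f i)) (fun i j => A (f i) (f j)) := by
  classical
  have := hZ.isProbabilityMeasure
  have hL : ∀ c : ι → ℝ, HasGaussianLaw (fun ω => ∑ i, c i * Z (f i) ω) P := fun c => by
    let I : Finset T := Finset.univ.image f
    let L : (I → ℝ) →L[ℝ] ℝ :=
      ∑ i, c i • ContinuousLinearMap.proj ⟨f i, Finset.mem_image_of_mem f (Finset.mem_univ i)⟩
    have h := (hZ.hasGaussianLaw I).map_fun L
    refine h.congr (.of_forall fun ω => ?_)
    simp [L]
  have hm : ∀ t, MemLp (Z t) 2 P := fun t => (hZ.hasGaussianLaw_eval t).memLp_two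
  have hi : ∀ s t, Integrable (fun ω => Z s ω * Z t ω) P := fun s t => (hm s).integrable_mul (hm t)
  have hv : ∀ c : ι → ℝ, ∫ ω, (∑ i, c i * Z (f i) ω) ^ 2 ∂P
      = ∑ i, ∑ j, c i * c j * A (f i) (f j) := fun c => by
    have e : ∀ ω, (∑ i, c i * Z (f i) ω) ^ 2
        = ∑ i, ∑ j, (c i * c j) * (Z (f i) ω * Z (f j) ω) := fun ω => by
      rw [sq, Finset.sum_mul_sum]
      exact Finset.sum_congr rfl fun i _ => Finset.sum_congr rfl fun j _ => by ring
    simp only [e]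
    rw [integral_finsetSum _ fun i _ => integrable_finsetSum _ fun j _ => (hi _ _).const_mul _]
    refine Finset.sum_congr rfl fun i _ => ?_
    rw [integral_finsetSum _ fun j _ => (hi _ _).const_mul _]
    refine Finset.sum_congr rfl fun j _ => ?_
    rw [integral_const_mul, hA]
  refine ⟨fun i => hZ.aemeasurable _, fun i j => ?_, fun c => ?_, fun c => ?_⟩
  · rw [← hA, ← hA]; simp only [mul_comm]
  · rw [← hv]; exact integral_nonneg fun ω => sq_nonneg _
  · rw [(hL c).map_eq_gaussianReal]
    have h1 : ∫ ω, ∑ i, c i * Z (f i) ω ∂P = 0 := by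
      rw [integral_finsetSum _ fun i _ => ((hm _).integrable (by norm_num)).const_mul _]
      simp [integral_const_mul, h0]
    rw [variance_of_integral_eq_zero (hL c).aemeasurable h1, h1, hv]

theorem add_prod {Ω' : Type*} [MeasurableSpace Ω'] {P' : Measure Ω'} {Y : ι → Ω' → ℝ}
    {L : ι → ι → ℝ} (hX : IsCenteredGaussian P X K) (hY : IsCenteredGaussian P' Y L) :
    IsCenteredGaussian (P.prod P') (fun i ω => X i ω.1 + Y i ω.2) (fun i j => K i j + L i j) := by
  have := hX.isProbabilityMeasure
  have := hY.isProbabilityMeasure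
  have e : ∀ c : ι → ℝ, ∑ i, ∑ j, c i * c j * (K i j + L i j)
      = ∑ i, ∑ j, c i * c j * K i j + ∑ i, ∑ j, c i * c j * L i j := fun c => by
    simp only [mul_add, Finset.sum_add_distrib]
  refine .of_cexp (fun i => ((hX.aemeasurable i).comp_fst).add ((hY.aemeasurable i).comp_snd))
    (fun i j => by rw [hX.symm, hY.symm]) (fun c => ?_) fun c => ?_
  · rw [e]; exact add_nonneg (hX.nonneg c) (hY.nonneg c)
  · have e2 : ∀ ω : Ω × Ω', Complex.exp ((∑ i, c i * (X i ω.1 + Y i ω.2) : ℝ) * Complex.I)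
        = Complex.exp ((∑ i, c i * X i ω.1 : ℝ) * Complex.I)
          * Complex.exp ((∑ i, c i * Y i ω.2 : ℝ) * Complex.I) := fun ω => by
      rw [← Complex.exp_add, ← add_mul, ← Complex.ofReal_add, ← Finset.sum_add_distrib]
      simp only [mul_add]
    simp only [e2]
    rw [integral_prod_mul (fun x : Ω => Complex.exp ((∑ i, c i * X i x : ℝ) * Complex.I))
      (fun x : Ω' => Complex.exp ((∑ i, c i * Y i x : ℝ) * Complex.I)), hX.integral_cexp,
      hY.integral_cexp, ← Complex.exp_add, e]
    push_cast
    congr 1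
    ring

/-- Reading each block in its own factor of the product space keeps the inner covariances and erases
the cross ones. This supplies the independent model used in decoupling. -/
theorem pi_blocks [DecidableEq κ] {K : κ → ι → ι → ℝ} {X : κ → ι → Ω → ℝ}
    (h : ∀ k, IsCenteredGaussian P (X k) (K k)) [IsProbabilityMeasure P] :
    IsCenteredGaussian (Measure.pi fun _ : κ => P) (fun (p : κ × ι) ω => X p.1 p.2 (ω p.1))
      (fun p q => if p.1 = q.1 then K p.1 p.2 q.2 else 0) := by
  have e : ∀ c : κ × ι → ℝ, ∑ p, ∑ q, c p * c q * (if p.1 = q.1 then K p.1 p.2 q.2 else 0)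
      = ∑ k, ∑ i, ∑ j, c (k, i) * c (k, j) * K k i j := fun c => by
    simp only [Fintype.sum_prod_type, mul_ite, mul_zero]
    refine Finset.sum_congr rfl fun k _ => Finset.sum_congr rfl fun i _ => ?_
    rw [Finset.sum_comm]
    simp
  refine .of_cexp (fun p => ?_) (fun p q => ?_) (fun c => ?_) fun c => ?_
  · exact ((h p.1).aemeasurable p.2).comp_quasiMeasurePreserving
      (measurePreserving_eval (fun _ : κ => P) p.1).quasiMeasurePreserving
  · by_cases hpq : p.1 = q.1
    · rw [if_pos hpq, if_pos hpq.symm, hpq, (h q.1).symm]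
    · rw [if_neg hpq, if_neg (Ne.symm hpq)]
  · rw [e]
    exact Finset.sum_nonneg fun k _ => (h k).nonneg fun i => c (k, i)
  · have e2 : ∀ ω : κ → Ω, Complex.exp ((∑ p : κ × ι, c p * X p.1 p.2 (ω p.1) : ℝ) * Complex.I)
        = ∏ k, Complex.exp ((∑ i, c (k, i) * X k i (ω k) : ℝ) * Complex.I) := fun ω => by
      rw [← Complex.exp_sum, ← Finset.sum_mul, ← Complex.ofReal_sum, Fintype.sum_prod_type]
    simp only [e2]
    rw [integral_fintype_prod_eq_prod
      (fun k (x : Ω) => Complex.exp ((∑ i, c (k, i) * X k i x : ℝ) * Complex.I))]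
    simp only [(h _).integral_cexp, ← Complex.exp_sum]
    rw [e]
    congr 1
    push_cast
    rw [← Finset.sum_div, Finset.sum_neg_distrib]

end Basic

/-- **Slepian's inequality**. -/
theorem real_le_of_cov_le {ι : Type*} [Fintype ι] {Ω : Type u} {Ω' : Type v} [MeasurableSpace Ω]
    [MeasurableSpace Ω'] {P : Measure Ω} {P' : Measure Ω'} {X : ι → Ω → ℝ} {Y : ι → Ω' → ℝ}
    {K K' : ι → ι → ℝ} (hX : IsCenteredGaussian P X K) (hY : IsCenteredGaussian P' Y K')
    (hoff : ∀ i j, i ≠ j → K i j ≤ K' i j) (hdiag : ∀ i, K i i = K' i i) (c : ι → ℝ) :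
    P.real {ω | ∀ i, X i ω ≤ c i} ≤ P'.real {ω | ∀ i, Y i ω ≤ c i} := by
  -- The quantitative comparison with η = 0 leaves only the shift of level, which tends to 0 by
  -- continuity from above.
  refine ge_of_tendsto (hY.tendsto_real_le_add c) (.of_forall fun m => ?_)
  obtain ⟨C, -, hC⟩ := exists_gaussian_comparison.{u, v} ι (δ := 1 / ((m : ℝ) + 1)) (by positivity)
  simpa using hC hX hY (η := 0) c (by simpa using hoff) (fun i => by simp [hdiag])

/-- Placing the two groups of coordinates on separate factors of a product makes them independent,
which lowers the nonnegative cross covariances to zero; Slepian's inequality compares the two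
vectors. -/
theorem mul_real_le {ι : Type*} [Fintype ι] {Ω : Type u} [MeasurableSpace Ω] {P : Measure Ω}
    {X : ι → Ω → ℝ} {K : ι → ι → ℝ} (hX : IsCenteredGaussian P X K) (p : ι → Prop)
    (hK : ∀ i j, p i → ¬ p j → 0 ≤ K i j) (c : ι → ℝ) :
    P.real {ω | ∀ i, p i → X i ω ≤ c i} * P.real {ω | ∀ i, ¬ p i → X i ω ≤ c i}
      ≤ P.real {ω | ∀ i, X i ω ≤ c i} := by
  classical
  have := hX.isProbabilityMeasure
  have h1 := hX.smul fun i => if p i then 1 else 0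
  have h2 := hX.smul fun i => if p i then 0 else 1
  have h := (h1.add_prod h2).real_le_of_cov_le hX (fun i j _ => ?_) (fun i => ?_) c
  · refine le_trans (le_of_eq ?_) h
    rw [← measureReal_prod_prod]
    congr 1
    ext ω
    simp only [Set.mem_prod, Set.mem_ofPred_eq]
    constructor
    · rintro ⟨a, b⟩ i
      by_cases hi : p i
      · simpa [hi] using a i hi
      · simpa [hi] using b i hi
    · intro a
      refine ⟨fun i hi => ?_, fun i hi => ?_⟩
      · simpa [hi] using a i
      · simpa [hi] using a i
  · by_cases hi : p i <;> by_cases hj : p j <;> simp [hi, hj]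
    · exact hK i j hi hj
    · rw [hX.symm]; exact hK j i hj hi
  · by_cases hi : p i <;> simp [hi]

theorem mul_real_neg_le {ι : Type*} [Fintype ι] {Ω : Type u} [MeasurableSpace Ω] {P : Measure Ω}
    {X : ι → Ω → ℝ} {K : ι → ι → ℝ} (hX : IsCenteredGaussian P X K) (p : ι → Prop)
    (hK : ∀ i j, p i → ¬ p j → 0 ≤ K i j) :
    P.real {ω | ∀ i, p i → X i ω < 0} * P.real {ω | ∀ i, ¬ p i → X i ω < 0}
      ≤ P.real {ω | ∀ i, X i ω < 0} := by
  classical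
  have := hX.isProbabilityMeasure
  have t0 := tendsto_real_le_neg P X
  have t1 := tendsto_real_le_neg P fun i : {i // p i} => X i
  have t2 := tendsto_real_le_neg P fun i : {i // ¬ p i} => X i
  simp only [Subtype.forall] at t1 t2
  exact le_of_tendsto_of_tendsto' (t1.mul t2) t0 fun m => hX.mul_real_le p hK _

/-- Chernoff bound for a block of coordinates. -/
theorem real_forall_lt_le {ι Ω : Type*} [Fintype ι] [MeasurableSpace Ω] {P : Measure Ω}
    {X : ι → Ω → ℝ} {K : ι → ι → ℝ} (hX : IsCenteredGaussian P X K) (A : Finset ι) {R u : ℝ}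
    (hR : 0 < R) (hu : 0 ≤ u) (h : ∑ i ∈ A, ∑ j ∈ A, K i j ≤ R * A.card) :
    P.real {ω | ∀ i ∈ A, X i ω < -u} ≤ Real.exp (-(u ^ 2 / (2 * R))) ^ A.card := by
  classical
  have := hX.isProbabilityMeasure
  rcases A.eq_empty_or_nonempty with rfl | hA
  · simp
  have hc : (0 : ℝ) < A.card := by exact_mod_cast hA.card_pos
  -- On the event, minus the sum over A exceeds u |A|, while its variance is at most R |A|.
  have hm := hX.map_sum fun i => if i ∈ A then -1 else 0
  have e : ∑ i, ∑ j, (if i ∈ A then (-1 : ℝ) else 0) * (if j ∈ A then -1 else 0) * K i j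
      = ∑ i ∈ A, ∑ j ∈ A, K i j := by
    simp [ite_mul, mul_ite, Finset.sum_ite_mem]
  rw [e] at hm
  have hsub : HasSubgaussianMGF (fun ω => ∑ i, (if i ∈ A then (-1 : ℝ) else 0) * X i ω)
      (R * A.card).toNNReal P := by
    refine ⟨fun t => ?_, fun t => ?_⟩
    · rw [← mgf_pos_iff]
      rw [mgf_gaussianReal hm]
      positivity
    · rw [mgf_gaussianReal hm]
      gcongr
      rw [zero_mul, zero_add]
      gcongr
  have h1 := hsub.measure_ge_le (ε := u * A.card) (by positivity)
  refine (measureReal_mono fun ω hω => ?_).trans (h1.trans (le_of_eq ?_))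
  · simp only [Set.mem_ofPred_eq, ite_mul, zero_mul, Finset.sum_ite_mem, Finset.univ_inter] at hω ⊢
    calc u * A.card = ∑ i ∈ A, u := by simp [mul_comm]
      _ ≤ ∑ i ∈ A, -1 * X i ω := Finset.sum_le_sum fun i hi => by linarith [hω i hi]
  · rw [← Real.exp_nat_mul, Real.coe_toNNReal _ (by positivity)]
    congr 1
    field_simp

end IsCenteredGaussian

/-! ### Realization of covariance matrices and geometric correlations. -/

theorem exists_isCenteredGaussian {ι : Type*} [Fintype ι] {K : ι → ι → ℝ}
    (hs : ∀ i j, K i j = K j i) (hK : ∀ c : ι → ℝ, 0 ≤ ∑ i, ∑ j, c i * c j * K i j) :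
    ∃ μ : Measure (ι → ℝ), IsProbabilityMeasure μ ∧ IsCenteredGaussian μ (fun i x => x i) K := by
  classical
  have hS : (Matrix.of K).PosSemidef := by
    refine Matrix.PosSemidef.of_dotProduct_mulVec_nonneg ?_ fun x => ?_
    · ext i j; simp [hs i j]
    · refine le_of_le_of_eq (hK x) ?_
      simp only [dotProduct, Matrix.mulVec, Finset.mul_sum]
      exact Finset.sum_congr rfl fun i _ => Finset.sum_congr rfl fun j _ => by simp; ring
  have hX : IsCenteredGaussian (multivariateGaussian 0 (Matrix.of K))
      (fun i (x : EuclideanSpace ℝ ι) => x i) K := by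
    refine .of_cexp (fun i => Measurable.aemeasurable (by fun_prop)) hs hK fun c => ?_
    have := charFun_multivariateGaussian (μ := 0) hS (WithLp.toLp 2 c)
    rw [charFun_apply] at this
    simp only [PiLp.inner_apply, inner_zero_right] at this
    have e : (c ⬝ᵥ (Matrix.of K).mulVec c) = ∑ i, ∑ j, c i * c j * K i j := by
      simp only [dotProduct, Matrix.mulVec, Finset.mul_sum]
      exact Finset.sum_congr rfl fun i _ => Finset.sum_congr rfl fun j _ => by simp; ring
    rw [e] at this
    simpa [neg_div] using this
  have := hX.canonical
  exact ⟨_, this.isProbabilityMeasure, this⟩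

section Geometric

/-- This is the covariance of a stationary first-order autoregression, with innovation variance 1 at
time 0 and 1 - r² afterwards. -/
theorem sum_geometric_kernel (r : ℝ) (d m : ℕ) :
    ∑ k ∈ Finset.range (m + 1), (if k = 0 then 1 else 1 - r ^ 2) * (r ^ (m - k) * r ^ (m + d - k))
      = r ^ d := by
  induction m with
  | zero => simp
  | succ m ih =>
    rw [Finset.sum_range_succ]
    have : ∑ k ∈ Finset.range (m + 1),
        (if k = 0 then 1 else 1 - r ^ 2) * (r ^ (m + 1 - k) * r ^ (m + 1 + d - k))
        = r ^ 2 * r ^ d := by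
      rw [← ih, Finset.mul_sum]
      refine Finset.sum_congr rfl fun k hk => ?_
      have hk' : k ≤ m := Nat.lt_succ_iff.1 (Finset.mem_range.1 hk)
      rw [show m + 1 - k = (m - k) + 1 by omega, show m + 1 + d - k = (m + d - k) + 1 by omega]
      ring
    rw [this]
    simp
    ring

theorem pow_dist_eq_sum (r : ℝ) {m n N : ℕ} (hm : m < N) (hn : n < N) :
    r ^ Nat.dist m n = ∑ k ∈ Finset.range N, (if k = 0 then 1 else 1 - r ^ 2)
      * ((if k ≤ m then r ^ (m - k) else 0) * (if k ≤ n then r ^ (n - k) else 0)) := by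
  wlog h : m ≤ n generalizing m n
  · rw [Nat.dist_comm, this hn hm (by omega)]
    exact Finset.sum_congr rfl fun k _ => by ring
  obtain ⟨d, rfl⟩ := Nat.exists_eq_add_of_le h
  rw [Nat.dist_eq_sub_of_le h, Nat.add_sub_cancel_left, ← sum_geometric_kernel r d m]
  refine Finset.sum_subset_zero_on_sdiff (fun k hk => ?_) (fun k hk => ?_) (fun k hk => ?_)
  · simp at hk ⊢; omega
  · simp only [Finset.mem_sdiff, Finset.mem_range] at hk
    rw [if_neg (by omega : ¬ k ≤ m)]; simp
  · simp only [Finset.mem_range] at hk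
    rw [if_pos (by omega : k ≤ m), if_pos (by omega : k ≤ m + d)]

/-- The autoregressive representation writes the quadratic form as a sum of squares with weights 1
and 1 - r². -/
theorem pow_dist_nonneg_definite {ι : Type*} [Fintype ι] {r : ℝ} (hr0 : 0 ≤ r) (hr1 : r ≤ 1)
    (t : ι → ℕ) (c : ι → ℝ) : 0 ≤ ∑ i, ∑ j, c i * c j * r ^ Nat.dist (t i) (t j) := by
  obtain ⟨N, hN⟩ : ∃ N, ∀ i, t i < N :=
    ⟨Finset.univ.sup t + 1, fun i => Nat.lt_succ_of_le (Finset.le_sup (Finset.mem_univ i))⟩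
  have : ∑ i, ∑ j, c i * c j * r ^ Nat.dist (t i) (t j)
      = ∑ k ∈ Finset.range N, (if k = 0 then 1 else 1 - r ^ 2)
        * (∑ i, c i * (if k ≤ t i then r ^ (t i - k) else 0)) ^ 2 := by
    have hsq : ∀ k, (∑ i, c i * (if k ≤ t i then r ^ (t i - k) else 0)) ^ 2
        = ∑ i, ∑ j, (c i * (if k ≤ t i then r ^ (t i - k) else 0))
          * (c j * (if k ≤ t j then r ^ (t j - k) else 0)) := fun k => by
      rw [sq, Finset.sum_mul_sum]
    simp only [pow_dist_eq_sum r (hN _) (hN _), hsq, Finset.mul_sum]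
    calc _ = ∑ i, ∑ k ∈ Finset.range N, ∑ j, _ := Finset.sum_congr rfl fun i _ => Finset.sum_comm
      _ = _ := by
        rw [Finset.sum_comm]
        exact Finset.sum_congr rfl fun k _ => Finset.sum_congr rfl fun i _ =>
          Finset.sum_congr rfl fun j _ => by ring
  rw [this]
  refine Finset.sum_nonneg fun k _ => mul_nonneg ?_ (sq_nonneg _)
  split_ifs
  · exact zero_le_one
  · nlinarith

end Geometric

theorem sum_pow_dist_le {s : ℝ} (hs0 : 0 ≤ s) (hs : s < 1) (i n : ℕ) :
    ∑ j ∈ Finset.range n, s ^ Nat.dist i j ≤ 2 * (1 - s)⁻¹ := by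
  have hg : ∀ m : ℕ, ∑ k ∈ Finset.range m, s ^ k ≤ (1 - s)⁻¹ := fun m => by
    rw [← tsum_geometric_of_lt_one hs0 hs]
    exact (summable_geometric_of_lt_one hs0 hs).sum_le_tsum (Finset.range m)
      (fun k _ => pow_nonneg hs0 k)
  calc ∑ j ∈ Finset.range n, s ^ Nat.dist i j
      ≤ ∑ j ∈ Finset.range (i + 1 + n), s ^ Nat.dist i j :=
        Finset.sum_le_sum_of_subset_of_nonneg (Finset.range_mono (by omega))
          fun _ _ _ => pow_nonneg hs0 _
    _ = ∑ j ∈ Finset.range (i + 1), s ^ Nat.dist i j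
        + ∑ j ∈ Finset.range n, s ^ Nat.dist i (i + 1 + j) := Finset.sum_range_add _ _ _
    _ ≤ (1 - s)⁻¹ + (1 - s)⁻¹ := by
        gcongr
        · rw [← Finset.sum_range_reflect]
          refine (Finset.sum_congr rfl fun j hj => ?_).trans_le (hg (i + 1))
          have := Finset.mem_range.1 hj
          rw [Nat.dist_comm, Nat.dist_eq_sub_of_le (by omega)]
          congr 1; omega
        · refine (Finset.sum_le_sum fun j _ => ?_).trans (hg n)
          rw [Nat.dist_eq_sub_of_le (by omega)]
          exact pow_le_pow_of_le_one hs0 hs.le (by omega)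
    _ = _ := (two_mul _).symm

/-! ### Decoupling of weakly correlated blocks. -/

namespace IsCenteredGaussian

theorem cov_le_of_unit {ι Ω : Type*} [Fintype ι] [MeasurableSpace Ω] {P : Measure Ω}
    {X : ι → Ω → ℝ} {K : ι → ι → ℝ} (hX : IsCenteredGaussian P X K) (h1 : ∀ i, K i i = 1)
    (i j : ι) : K i j ≤ 1 := by
  classical
  have h := hX.nonneg fun k => (if k = i then 1 else 0) - if k = j then 1 else 0
  simp only [sub_mul, mul_sub, ite_mul, mul_ite, one_mul, zero_mul, mul_one, mul_zero,
    Finset.sum_sub_distrib, Finset.sum_ite_eq', Finset.mem_univ, if_true] at h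
  rw [h1, h1, hX.symm j i] at h
  linarith

/-- Decoupling of weakly correlated blocks of a Gaussian vector. -/
theorem real_forall_nonpos_le_prod {n : ℕ} {J : Type*} [Fintype J] {Ω : Type*} [MeasurableSpace Ω]
    {P : Measure Ω} {U : Fin n × J → Ω → ℝ} {K : Fin n × J → Fin n × J → ℝ}
    (hU : IsCenteredGaussian P U K) (h1 : ∀ p, K p p = 1) {D s u : ℝ} (hD : 0 < D) (hs0 : 0 < s)
    (hs : s ≤ 1 / 2) (hDs : 2 * D * s ≤ 1) (hu : 0 ≤ u)
    (hcross : ∀ p q, p.1 ≠ q.1 → K p q ≤ D * (s ^ 2) ^ Nat.dist p.1 q.1) :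
    P.real {ω | ∀ p, U p ω ≤ 0}
      ≤ ∏ i, (P.real {ω | ∀ j, U (i, j) ω ≤ u} + Real.exp (-(u ^ 2 / (16 * D * s)))) := by
  classical
  have := hU.isProbabilityMeasure
  set η := 2 * D * s with hη
  have hη0 : 0 < η := by positivity
  -- A small field, constant on each block, carries all the dependence: independent copies of the
  -- blocks plus this field have the same variances as √(1+η) U and at least its covariances.
  obtain ⟨μ, hμ, hx⟩ := exists_isCenteredGaussian (ι := Fin n)
    (K := fun i j => η * s ^ Nat.dist i j) (fun i j => by rw [Nat.dist_comm]) (fun c => by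
      have := pow_dist_nonneg_definite hs0.le (by linarith : s ≤ 1) (fun i : Fin n => (i : ℕ)) c
      have e : ∑ i, ∑ j, c i * c j * (η * s ^ Nat.dist i j)
          = η * ∑ i, ∑ j, c i * c j * s ^ Nat.dist i j := by
        simp only [Finset.mul_sum]
        exact Finset.sum_congr rfl fun i _ => Finset.sum_congr rfl fun j _ => by ring
      rw [e]; positivity)
  have hW := (pi_blocks (P := P) (X := fun (k : Fin n) j => U (k, j))
    (fun k => hU.reindex fun j => (k, j))).add_prod (hx.reindex fun p : Fin n × J => p.1)
  have hV := hU.smul fun _ => √(1 + η)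
  have hsq : √(1 + η) * √(1 + η) = 1 + η := Real.mul_self_sqrt (by positivity)
  have hslep := hV.real_le_of_cov_le hW (fun p q _ => ?_) (fun p => ?_) 0
  rotate_left
  · rw [hsq]
    by_cases hpq : p.1 = q.1
    · have hle := hU.cov_le_of_unit h1 p q
      have e : K (p.1, p.2) (p.1, q.2) = K p q := by
        have : (p.1, q.2) = q := by rw [hpq]
        rw [this]
      rw [if_pos hpq, hpq, Nat.dist_self, pow_zero, ← hpq, e]
      nlinarith
    · rw [if_neg hpq, zero_add]
      have hd : 1 ≤ Nat.dist p.1 q.1 := Nat.one_le_iff_ne_zero.2 fun h =>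
        hpq (Fin.ext (Nat.eq_of_dist_eq_zero h))
      have h3 := hcross p q hpq
      -- Distinct blocks are at distance at least 1, so half of the decay can be traded for a factor
      -- s. This is what makes the field's variance η = 2Ds small.
      have h4 : (s ^ 2) ^ Nat.dist p.1 q.1 ≤ s * s ^ Nat.dist p.1 q.1 := by
        rw [← pow_mul, two_mul, pow_add]
        gcongr
        calc s ^ Nat.dist p.1 q.1 ≤ s ^ 1 := pow_le_pow_of_le_one hs0.le (by linarith) hd
          _ = s := pow_one s
      calc (1 + η) * K p q ≤ (1 + η) * (D * (s ^ 2) ^ Nat.dist p.1 q.1) := by gcongr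
        _ ≤ 2 * (D * (s * s ^ Nat.dist p.1 q.1)) := by
          gcongr
          linarith
        _ = _ := by rw [hη]; ring
  · rw [hsq, if_pos rfl, Nat.dist_self, pow_zero, h1]
    ring
  set q := Real.exp (-(u ^ 2 / (16 * D * s))) with hq
  set E : Fin n → Set Ω := fun i => {ω | ∀ j, U (i, j) ω ≤ u} with hE
  have hleft : {ω | ∀ p, U p ω ≤ 0} = {ω | ∀ p, √(1 + η) * U p ω ≤ (0 : Fin n × J → ℝ) p} := by
    ext ω
    simp only [Set.mem_ofPred_eq, Pi.zero_apply]
    refine forall_congr' fun p => ?_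
    rw [mul_nonpos_iff_pos_imp_nonpos]
    have : 0 < √(1 + η) := Real.sqrt_pos.2 (by positivity)
    constructor
    · intro h; exact ⟨fun _ => h, fun _ => this.le⟩
    · intro h; exact h.1 this
  rw [hleft]
  refine hslep.trans ?_
  -- Let A collect the blocks where the field is below -u. Every other block has its independent
  -- copy below u. Summing over A reproduces the expansion of a product of sums.
  have hsub : {ω : (Fin n → Ω) × (Fin n → ℝ) | ∀ p : Fin n × J, U (p.1, p.2) (ω.1 p.1) + ω.2 p.1
      ≤ (0 : Fin n × J → ℝ) p} ⊆ ⋃ A ∈ (Finset.univ : Finset (Fin n)).powerset,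
        (Set.univ.pi fun i => if i ∈ A then Set.univ else E i) ×ˢ {x | ∀ i ∈ A, x i < -u} := by
    rintro ⟨ω, x⟩ h
    simp only [Set.mem_iUnion]
    refine ⟨Finset.univ.filter fun i => x i < -u, by simp, ?_⟩
    simp only [Set.mem_prod, Set.mem_pi, Set.mem_univ, true_implies, Finset.mem_filter,
      Finset.mem_univ, true_and, Set.mem_ofPred_eq, imp_self, implies_true, and_true]
    intro i
    split_ifs with hi
    · trivial
    · intro j
      have := h (i, j)
      simp only [Pi.zero_apply] at this
      linarith
  refine (measureReal_mono hsub (measure_ne_top _ _)).trans ?_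
  refine (measureReal_biUnion_finset_le _ _).trans ?_
  simp only [add_comm (P.real _) q]
  rw [Finset.prod_add]
  refine Finset.sum_le_sum fun A _ => ?_
  rw [measureReal_prod_prod, mul_comm]
  gcongr
  -- As s ≤ 1/2, the row sums of s^|i-j| are at most 4, so those of the field are at most 4η = 8Ds.
  -- The Chernoff bound then has exponent u²/(16Ds) per block.
  · have hsum : ∑ i ∈ A, ∑ j ∈ A, η * s ^ Nat.dist (i : ℕ) j ≤ (8 * D * s) * A.card := by
      have : ∀ i ∈ A, ∑ j ∈ A, η * s ^ Nat.dist (i : ℕ) j ≤ 8 * D * s := fun i _ => by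
        rw [← Finset.mul_sum]
        have h5 : ∑ j ∈ A, s ^ Nat.dist (i : ℕ) j ≤ 4 := by
          refine (Finset.sum_le_univ_sum_of_nonneg fun j => pow_nonneg hs0.le _).trans ?_
          have : ∑ j ∈ Finset.range n, s ^ Nat.dist i j ≤ 4 := by
            refine (sum_pow_dist_le hs0.le (by linarith) i n).trans ?_
            have : (1 - s)⁻¹ ≤ 2 := by
              rw [inv_le_comm₀ (by linarith) (by norm_num)]
              linarith
            linarith
          rwa [← Fin.sum_univ_eq_sum_range (fun j => s ^ Nat.dist (i : ℕ) j) n] at this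
        calc η * ∑ j ∈ A, s ^ Nat.dist (i : ℕ) j ≤ η * 4 := by gcongr
          _ = 8 * D * s := by rw [hη]; ring
      refine (Finset.sum_le_sum this).trans (le_of_eq ?_)
      simp [mul_comm]
    have := hx.real_forall_lt_le A (R := 8 * D * s) (by positivity) hu hsum
    refine this.trans (le_of_eq ?_)
    rw [Finset.prod_const, hq]
    congr 4
    ring
  · refine le_of_eq ?_
    rw [measureReal_def, Measure.pi_pi, ENNReal.toReal_prod]
    rw [← Finset.prod_sdiff (Finset.subset_univ A)]
    rw [Finset.prod_congr (s₂ := A) (g := fun _ => 1) rfl fun i hi => by simp [hi],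
      Finset.prod_const_one, mul_one]
    refine Finset.prod_congr rfl fun i hi => ?_
    rw [if_neg (Finset.mem_sdiff.1 hi).2, measureReal_def]

end IsCenteredGaussian

/-! ### Gaussian sequences with prescribed covariance. -/

section Existence

open Finset Preorder

/-- Reassembling a trajectory up to time `n + 1` from its restriction to `{0, …, n}` and its last
value. -/
noncomputable def snocIic (n : ℕ) (p : (Iic n → ℝ) × ℝ) (i : Iic (n + 1)) : ℝ :=
  if h : (i : ℕ) ≤ n then p.1 ⟨i, mem_Iic.2 h⟩ else p.2

theorem measurable_snocIic (n : ℕ) : Measurable (snocIic n) := by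
  refine measurable_pi_lambda _ fun i => ?_
  by_cases h : (i : ℕ) ≤ n
  · simp only [snocIic, h, dif_pos]
    fun_prop
  · simp only [snocIic, h, dif_neg, not_false_eq_true]
    fun_prop

/-- Each law on {0, …, n+1} disintegrates into its restriction to {0, …, n} and a conditional law of
the last coordinate. The Ionescu-Tulcea construction glues these kernels into one measure on
sequences. -/
theorem exists_measure_map_frestrictLe (ν : ∀ n : ℕ, Measure (Iic n → ℝ))
    [∀ n, IsProbabilityMeasure (ν n)]
    (hν : ∀ n, (ν (n + 1)).map (fun y (i : Iic n) => y ⟨i, mem_Iic.2 (by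
      have := mem_Iic.1 i.2; omega)⟩) = ν n) :
    ∃ M : Measure (ℕ → ℝ), IsProbabilityMeasure M ∧
      ∀ n, M.map (fun x (i : Iic n) => x i) = ν n := by
  let res : ∀ n : ℕ, (Iic (n + 1) → ℝ) → (Iic n → ℝ) := fun n y i =>
    y ⟨i, mem_Iic.2 (by have := mem_Iic.1 i.2; omega)⟩
  let lst : ∀ n : ℕ, (Iic (n + 1) → ℝ) → ℝ := fun n y => y ⟨n + 1, mem_Iic.2 le_rfl⟩
  have hres : ∀ n, Measurable (res n) := fun n => measurable_pi_lambda _ fun i =>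
    measurable_pi_apply _
  have hlst : ∀ n, Measurable (lst n) := fun n => measurable_pi_apply _
  let κ : ∀ n : ℕ, Kernel (∀ _ : Iic n, ℝ) ℝ := fun n => condDistrib (lst n) (res n) (ν (n + 1))
  have : ∀ n, IsMarkovKernel (κ n) := fun n => by dsimp only [κ]; infer_instance
  let e : (∀ _ : Iic 0, ℝ) ≃ᵐ ℝ := MeasurableEquiv.piUnique (fun _ : Iic 0 => ℝ)
  let μ₀ : Measure ℝ := (ν 0).map e
  have : IsProbabilityMeasure μ₀ := Measure.isProbabilityMeasure_map e.measurable.aemeasurable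
  let M : Measure (ℕ → ℝ) := Kernel.trajMeasure (X := fun _ => ℝ) μ₀ κ
  refine ⟨M, inferInstanceAs (IsProbabilityMeasure (Kernel.trajMeasure (X := fun _ => ℝ) μ₀ κ)),
    fun n => ?_⟩
  induction n with
  | zero =>
    change M.map (frestrictLe 0) = _
    have h0 : μ₀.map e.symm = ν 0 := by
      rw [Measure.map_map e.symm.measurable e.measurable]
      simp
    have hM : M = (Kernel.traj (X := fun _ => ℝ) κ 0) ∘ₘ (ν 0) := by
      rw [← h0]; rfl
    rw [hM, Measure.map_comp _ _ (by fun_prop), Kernel.traj_map_frestrictLe,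
      Kernel.partialTraj_self, Measure.id_comp]
  | succ n ih =>
    have h1 := Kernel.map_frestrictLe_trajMeasure_compProd_eq_map_trajMeasure
      (X := fun _ => ℝ) (κ := κ) (μ₀ := μ₀) (a := n)
    have h2 : (ν (n + 1)).map (res n) ⊗ₘ κ n = (ν (n + 1)).map fun y => (res n y, lst n y) :=
      compProd_map_condDistrib (hlst n).aemeasurable
    have h3 : M.map (fun x => (frestrictLe n x, x (n + 1)))
        = (ν (n + 1)).map fun y => (res n y, lst n y) := by
      rw [← h2, ← h1]
      congr 1
      rw [hν]
      exact ih
    have h4 := congrArg (Measure.map (snocIic n)) h3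
    rw [Measure.map_map (measurable_snocIic n) (by fun_prop),
      Measure.map_map (measurable_snocIic n) ((hres n).prodMk (hlst n))] at h4
    have e1 : (snocIic n ∘ fun x : ℕ → ℝ => (frestrictLe n x, x (n + 1)))
        = fun x (i : Iic (n + 1)) => x i := by
      ext x i
      have := mem_Iic.1 i.2
      by_cases h : (i : ℕ) ≤ n
      · simp [snocIic, h]
      · have : (i : ℕ) = n + 1 := by omega
        simp [snocIic, this]
    have e2 : (snocIic n ∘ fun y => (res n y, lst n y)) = id := by
      ext y i
      have := mem_Iic.1 i.2
      by_cases h : (i : ℕ) ≤ n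
      · simp [snocIic, h, res]
      · have h5 : i = ⟨n + 1, mem_Iic.2 le_rfl⟩ := Subtype.ext (by simp; omega)
        subst h5
        simp [snocIic, lst]
    rw [e1, e2, Measure.map_id] at h4
    exact h4

theorem exists_gaussian_sequence {K : ℕ → ℕ → ℝ} (hs : ∀ i j, K i j = K j i)
    (hK : ∀ (n : ℕ) (c : Iic n → ℝ), 0 ≤ ∑ i, ∑ j, c i * c j * K i j) :
    ∃ M : Measure (ℕ → ℝ), IsProbabilityMeasure M ∧ ∀ {ι : Type} [Fintype ι] (f : ι → ℕ),
      IsCenteredGaussian M (fun i x => x (f i)) (fun i j => K (f i) (f j)) := by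
  have h := fun n : ℕ => exists_isCenteredGaussian (ι := Iic n) (K := fun i j => K i j)
    (fun i j => hs i j) (hK n)
  choose ν hν hνK using h
  obtain ⟨M, hM, hMν⟩ := exists_measure_map_frestrictLe ν fun n => by
    have := ((hνK (n + 1)).reindex (fun i : Iic n => (⟨i, mem_Iic.2 (by
      have := mem_Iic.1 i.2; omega)⟩ : Iic (n + 1)))).canonical
    exact this.measure_ext (hνK n)
  refine ⟨M, hM, fun {ι} _ f => ?_⟩
  obtain ⟨n, hn⟩ : ∃ n, ∀ i, f i ≤ n := ⟨univ.sup f, fun i => Finset.le_sup (mem_univ i)⟩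
  have h1 := (hνK n).reindex fun i : ι => (⟨f i, mem_Iic.2 (hn i)⟩ : Iic n)
  have hmeas : Measurable fun (x : ℕ → ℝ) (i : Iic n) => x i :=
    measurable_pi_lambda _ fun i => measurable_pi_apply _
  refine ⟨fun i => (measurable_pi_apply _).aemeasurable, h1.symm, h1.nonneg, fun c => ?_⟩
  rw [← h1.map_sum c, ← hMν n, Measure.map_map (Continuous.measurable (by fun_prop)) hmeas]
  rfl

end Existence

/-- The sequence space is lifted so that processes are available in whichever universe the
persistence exponent quantifies over. -/
theorem exists_gaussian_sequence_universe {K : ℕ → ℕ → ℝ} (hs : ∀ i j, K i j = K j i)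
    (hK : ∀ (n : ℕ) (c : Finset.Iic n → ℝ), 0 ≤ ∑ i, ∑ j, c i * c j * K i j) :
    ∃ (Ω : Type u) (_ : MeasurableSpace Ω) (P : Measure Ω) (ξ : ℕ → Ω → ℝ),
      IsProbabilityMeasure P ∧ (∀ n, Measurable (ξ n)) ∧ ∀ {ι : Type} [Fintype ι] (f : ι → ℕ),
        IsCenteredGaussian P (fun i => ξ (f i)) (fun i j => K (f i) (f j)) := by
  obtain ⟨M, hM, h⟩ := exists_gaussian_sequence hs hK
  have hup : Measurable (ULift.up.{u} : (ℕ → ℝ) → ULift.{u} (ℕ → ℝ)) :=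
    MeasurableEquiv.ulift.symm.measurable
  have hξ : ∀ n, Measurable fun (ω : ULift.{u} (ℕ → ℝ)) => ω.down n := fun n =>
    (measurable_pi_apply n).comp MeasurableEquiv.ulift.measurable
  refine ⟨ULift.{u} (ℕ → ℝ), inferInstance, M.map ULift.up, fun n ω => ω.down n,
    Measure.isProbabilityMeasure_map hup.aemeasurable, hξ, fun {ι} _ f => ?_⟩
  refine ⟨fun i => (hξ _).aemeasurable, (h f).symm, (h f).nonneg, fun c => ?_⟩
  rw [← (h f).map_sum c, Measure.map_map (Finset.measurable_fun_sum _ fun i _ =>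
    (hξ (f i)).const_mul (c i)) hup]
  rfl

/-! ### Limits of Gaussian vectors and Gaussian processes. -/

namespace IsCenteredGaussian

/-- Characteristic functions converge on one side by dominated convergence and on the other by
convergence of the covariances. -/
theorem of_tendsto_ae {ι Ω : Type*} [Fintype ι] [MeasurableSpace Ω] {P : Measure Ω}
    [IsProbabilityMeasure P] {X : ℕ → ι → Ω → ℝ} {K : ℕ → ι → ι → ℝ} {Y : ι → Ω → ℝ}
    {L : ι → ι → ℝ} (hX : ∀ n, IsCenteredGaussian P (X n) (K n))
    (hXY : ∀ i, ∀ᵐ ω ∂P, Tendsto (fun n => X n i ω) atTop (𝓝 (Y i ω)))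
    (hKL : ∀ i j, Tendsto (fun n => K n i j) atTop (𝓝 (L i j))) : IsCenteredGaussian P Y L := by
  have hQ : ∀ c : ι → ℝ, Tendsto (fun n => ∑ i, ∑ j, c i * c j * K n i j) atTop
      (𝓝 (∑ i, ∑ j, c i * c j * L i j)) := fun c =>
    tendsto_finsetSum _ fun i _ => tendsto_finsetSum _ fun j _ => (hKL i j).const_mul _
  have hY : ∀ i, AEMeasurable (Y i) P := fun i =>
    aemeasurable_of_tendsto_metrizable_ae atTop (fun n => (hX n).aemeasurable i) (hXY i)
  refine .of_cexp hY (fun i j => ?_) (fun c => ?_) fun c => ?_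
  · refine tendsto_nhds_unique (hKL i j) ?_
    simp only [(hX _).symm i j]
    exact hKL j i
  · exact ge_of_tendsto' (hQ c) fun n => (hX n).nonneg c
  · have h1 : Tendsto (fun n => ∫ ω, Complex.exp ((∑ i, c i * X n i ω : ℝ) * Complex.I) ∂P) atTop
        (𝓝 (∫ ω, Complex.exp ((∑ i, c i * Y i ω : ℝ) * Complex.I) ∂P)) := by
      refine tendsto_integral_of_dominated_convergence (fun _ => 1) (fun n => ?_)
        (integrable_const _) (fun n => .of_forall fun ω => ?_) ?_
      · have : Continuous fun x : ℝ => Complex.exp (x * Complex.I) := by fun_prop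
        exact (this.measurable.comp_aemeasurable ((hX n).aemeasurable_sum c)).aestronglyMeasurable
      · rw [Complex.norm_exp_ofReal_mul_I]
      · filter_upwards [ae_all_iff.2 hXY] with ω hω
        have : Continuous fun x : ℝ => Complex.exp (x * Complex.I) := by fun_prop
        exact (this.tendsto _).comp (tendsto_finsetSum _ fun i _ => (hω i).const_mul _)
    refine tendsto_nhds_unique h1 ?_
    simp only [(hX _).integral_cexp]
    have : Continuous fun x : ℝ => Complex.exp (-(x : ℂ) / 2) := by fun_prop
    exact (this.tendsto _).comp (hQ c)

theorem isGaussianProcess {T Ω : Type*} [MeasurableSpace Ω] {P : Measure Ω} {Z : T → Ω → ℝ}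
    (h : ∀ I : Finset T, ∃ K, IsCenteredGaussian P (fun (i : I) => Z i) K) :
    IsGaussianProcess Z P := by
  refine ⟨fun I => ⟨isGaussian_of_map_eq_gaussianReal fun L => ?_⟩⟩
  classical
  obtain ⟨K, hK⟩ := h I
  obtain ⟨c, e⟩ : ∃ c : I → ℝ, ∀ x : I → ℝ, L x = ∑ i, c i * x i :=
    ⟨fun i => L (fun j => if i = j then 1 else 0), fun x =>
      (L.toLinearMap.pi_apply_eq_sum_univ x).trans (Finset.sum_congr rfl fun i _ => mul_comm _ _)⟩
  refine ⟨0, (∑ i, ∑ j, c i * c j * K i j).toNNReal, ?_⟩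
  change (P.map fun ω (i : I) => Z i ω).map L = _
  rw [AEMeasurable.map_map_of_aemeasurable L.continuous.measurable.aemeasurable hK.aemeasurable_pi,
    ← hK.map_sum c]
  congr 1
  ext ω
  exact e _

end IsCenteredGaussian

/-! ### Stationary correlation functions and continuous sample paths. -/

/-- The matrix `A(|t_i - t_j|)` is positive semidefinite for all finite families of times. -/
def IsNonnegDefinite (A : ℝ≥0 → ℝ) : Prop :=
  ∀ {ι : Type} [Fintype ι] (t : ι → ℝ≥0) (c : ι → ℝ),
    0 ≤ ∑ i, ∑ j, c i * c j * A (nndist (t i) (t j))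

theorem IsNonnegDefinite.sq_sub_le {A : ℝ≥0 → ℝ} (hA : IsNonnegDefinite A) (h0 : A 0 = 1)
    (x y : ℝ≥0) : (A x - A y) ^ 2 ≤ 2 * (1 - A (nndist x y)) := by
  -- The coefficient at time 0 minimizes the quadratic form once the coefficients at x and y are 1
  -- and -1.
  have h := hA (ι := Fin 3) ![0, x, y] ![-(A x - A y), 1, -1]
  have e : ∀ z : ℝ≥0, nndist z 0 = z := fun z => by
    rw [NNReal.nndist_eq]; simp
  have e' : ∀ z : ℝ≥0, nndist 0 z = z := fun z => by rw [nndist_comm, e]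
  simp only [Fin.sum_univ_three, Matrix.cons_val_zero, Matrix.cons_val_one, Matrix.cons_val,
    nndist_self, h0, e, e', nndist_comm y x] at h
  nlinarith

/-- `IsNonnegDefinite.sq_sub_le` transports the modulus of continuity at 0 to every point. -/
theorem IsNonnegDefinite.continuous {A : ℝ≥0 → ℝ} (hA : IsNonnegDefinite A) (h0 : A 0 = 1)
    {C α : ℝ} (hα : 0 < α) (hC : ∀ τ : ℝ≥0, τ ≤ 1 → 1 - A τ ≤ C * (τ : ℝ) ^ α) :
    Continuous A := by
  rw [continuous_iff_continuousAt]
  intro x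
  have h1 : Tendsto (fun y : ℝ≥0 => nndist y x) (𝓝 x) (𝓝 0) := by
    have : Continuous fun y : ℝ≥0 => nndist y x := by fun_prop
    simpa using this.tendsto x
  have h2 : Tendsto (fun y => 2 * (C * ((nndist y x : ℝ≥0) : ℝ) ^ α)) (𝓝 x) (𝓝 0) := by
    have : Tendsto (fun y : ℝ≥0 => ((nndist y x : ℝ≥0) : ℝ) ^ α) (𝓝 x) (𝓝 ((0 : ℝ) ^ α)) :=
      (NNReal.tendsto_coe.2 h1).rpow_const (Or.inr hα.le)
    rw [Real.zero_rpow hα.ne'] at this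
    simpa using (this.const_mul C).const_mul 2
  have h3 : Tendsto (fun y => (A y - A x) ^ 2) (𝓝 x) (𝓝 0) := by
    refine tendsto_of_tendsto_of_tendsto_of_le_of_le' tendsto_const_nhds h2
      (.of_forall fun y => sq_nonneg _) ?_
    filter_upwards [h1.eventually (gt_mem_nhds zero_lt_one)] with y hy
    have := hA.sq_sub_le h0 y x
    linarith [hC _ hy.le]
  have h4 : Tendsto (fun y => √((A y - A x) ^ 2)) (𝓝 x) (𝓝 √0) :=
    (Real.continuous_sqrt.tendsto 0).comp h3
  simp only [Real.sqrt_sq_eq_abs, Real.sqrt_zero] at h4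
  exact tendsto_sub_nhds_zero_iff.1 ((tendsto_zero_iff_abs_tendsto_zero _).2 h4)

section Chaining

theorem floor_two_pow_succ (t : ℝ≥0) (n : ℕ) :
    ⌊t * 2 ^ (n + 1)⌋₊ = 2 * ⌊t * 2 ^ n⌋₊ ∨ ⌊t * 2 ^ (n + 1)⌋₊ = 2 * ⌊t * 2 ^ n⌋₊ + 1 := by
  set k := ⌊t * 2 ^ n⌋₊ with hk
  have h1 : (k : ℝ≥0) ≤ t * 2 ^ n := Nat.floor_le zero_le
  have h2 : t * 2 ^ n < k + 1 := Nat.lt_floor_add_one _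
  have e : t * 2 ^ (n + 1) = 2 * (t * 2 ^ n) := by ring
  have h3 : 2 * k ≤ ⌊t * 2 ^ (n + 1)⌋₊ := by
    rw [e]
    refine Nat.le_floor ?_
    push_cast
    gcongr
  have h4 : ⌊t * 2 ^ (n + 1)⌋₊ < 2 * k + 2 := by
    rw [e, Nat.floor_lt zero_le]
    push_cast
    calc 2 * (t * 2 ^ n) < 2 * (k + 1) := by gcongr
      _ = _ := by ring
  omega

theorem tendsto_floor_div_two_pow (t : ℝ≥0) :
    Tendsto (fun n : ℕ => (⌊t * 2 ^ n⌋₊ : ℝ≥0) / 2 ^ n) atTop (𝓝 t) := by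
  have h : Tendsto (fun n : ℕ => (2 : ℝ) ^ n) atTop atTop :=
    tendsto_pow_atTop_atTop_of_one_lt one_lt_two
  rw [← NNReal.tendsto_coe]
  refine ((tendsto_nat_floor_mul_div_atTop t.coe_nonneg).comp h).congr fun n => ?_
  have e : ⌊(t : ℝ) * 2 ^ n⌋₊ = ⌊t * 2 ^ n⌋₊ := by
    rw [Nat.floor_eq_iff (by positivity)]
    exact ⟨by exact_mod_cast Nat.floor_le (a := t * 2 ^ n) zero_le,
      by exact_mod_cast Nat.lt_floor_add_one (t * 2 ^ n)⟩
  simp only [Function.comp_apply, NNReal.coe_div, NNReal.coe_pow, NNReal.coe_natCast,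
    NNReal.coe_ofNat, e]

/-- A dyadic array whose increments are geometrically small extends to a continuous function. -/
theorem exists_continuous_of_dyadic {x : ℕ → ℕ → ℝ} {r : ℝ} (hr0 : 0 < r) (hr1 : r < 1)
    (h : ∀ N : ℕ, ∃ C : ℝ, ∀ n, ∀ k ≤ N * 2 ^ n, |x (2 * k) (n + 1) - x k n| ≤ C * r ^ n ∧
      |x (2 * k + 1) (n + 1) - x k n| ≤ C * r ^ n ∧ |x (k + 1) n - x k n| ≤ C * r ^ n) :
    ∃ f : ℝ≥0 → ℝ, Continuous f ∧
      ∀ t, Tendsto (fun n => x ⌊t * 2 ^ n⌋₊ n) atTop (𝓝 (f t)) := by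
  have hfl : ∀ (N : ℕ) (t : ℝ≥0) (n : ℕ), t ≤ N → ⌊t * 2 ^ n⌋₊ ≤ N * 2 ^ n := by
    intro N t n ht
    have : (⌊t * 2 ^ n⌋₊ : ℝ≥0) ≤ (N * 2 ^ n : ℕ) := by
      refine (Nat.floor_le zero_le).trans ?_
      push_cast
      gcongr
    exact_mod_cast this
  have step : ∀ (N : ℕ), ∃ C : ℝ, 0 ≤ C ∧ ∀ t : ℝ≥0, t ≤ N → ∀ n,
      dist (x ⌊t * 2 ^ n⌋₊ n) (x ⌊t * 2 ^ (n + 1)⌋₊ (n + 1)) ≤ C * r ^ n := by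
    intro N
    obtain ⟨C, hC⟩ := h N
    have h0 := (hC 0 0 (Nat.zero_le _)).1
    refine ⟨C, by simpa using (abs_nonneg _).trans h0, fun t ht n => ?_⟩
    obtain ⟨h1, h2, -⟩ := hC n _ (hfl N t n ht)
    rw [dist_comm, Real.dist_eq]
    rcases floor_two_pow_succ t n with e | e <;> rw [e]
    · exact h1
    · exact h2
  have hex : ∀ t : ℝ≥0, ∃ y, Tendsto (fun n => x ⌊t * 2 ^ n⌋₊ n) atTop (𝓝 y) := by
    intro t
    obtain ⟨N, hN⟩ := exists_nat_ge t
    obtain ⟨C, -, hC⟩ := step N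
    exact cauchySeq_tendsto_of_complete (cauchySeq_of_le_geometric r C hr1 (hC t hN))
  choose f hf using hex
  refine ⟨f, ?_, hf⟩
  rw [Metric.continuous_iff]
  intro t ε hε
  obtain ⟨N, hN⟩ := exists_nat_ge (t + 1)
  obtain ⟨C, hC0, hC⟩ := step N
  obtain ⟨C', hC'⟩ := h N
  have hC'0 : 0 ≤ C' := by
    simpa using (abs_nonneg _).trans (hC' 0 0 (Nat.zero_le _)).1
  have hlim : Tendsto (fun n : ℕ => (C / (1 - r) + C' + C / (1 - r)) * r ^ n) atTop (𝓝 0) := by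
    simpa using (tendsto_pow_atTop_nhds_zero_of_lt_one hr0.le hr1).const_mul
      (C / (1 - r) + C' + C / (1 - r))
  obtain ⟨n, hn⟩ := (hlim.eventually (gt_mem_nhds hε)).exists
  have happ : ∀ s : ℝ≥0, s ≤ N → dist (x ⌊s * 2 ^ n⌋₊ n) (f s) ≤ C * r ^ n / (1 - r) := fun s hs =>
    dist_le_of_le_geometric_of_tendsto r C hr1 (hC s hs) (hf s) n
  -- Points closer than 2^(-n) have level-n dyadic floors that are equal or adjacent.
  have hclose : ∀ s s' : ℝ≥0, s ≤ s' → s' ≤ N → dist s s' < (2 ^ n)⁻¹ →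
      dist (x ⌊s * 2 ^ n⌋₊ n) (x ⌊s' * 2 ^ n⌋₊ n) ≤ C' * r ^ n := by
    intro s s' hss hs' hd
    have h1 : ⌊s * 2 ^ n⌋₊ ≤ ⌊s' * 2 ^ n⌋₊ := Nat.floor_mono (by gcongr)
    have h2 : ⌊s' * 2 ^ n⌋₊ < ⌊s * 2 ^ n⌋₊ + 2 := by
      rw [Nat.floor_lt zero_le]
      have h3 : s * 2 ^ n < ⌊s * 2 ^ n⌋₊ + 1 := Nat.lt_floor_add_one _
      rw [NNReal.dist_eq, abs_sub_comm, abs_of_nonneg (by simpa using hss)] at hd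
      have h4 : ((s' : ℝ) - s) * 2 ^ n < 1 := by
        have : (0 : ℝ) < 2 ^ n := by positivity
        calc ((s' : ℝ) - s) * 2 ^ n < (2 ^ n)⁻¹ * 2 ^ n := by gcongr
          _ = 1 := inv_mul_cancel₀ this.ne'
      rw [← NNReal.coe_lt_coe] at h3 ⊢
      push_cast at h3 ⊢
      linarith
    have hk := hfl N s n (hss.trans hs')
    rcases (show ⌊s' * 2 ^ n⌋₊ = ⌊s * 2 ^ n⌋₊ ∨ ⌊s' * 2 ^ n⌋₊ = ⌊s * 2 ^ n⌋₊ + 1 by omega)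
      with e | e
    · rw [e, dist_self]; positivity
    · rw [e, dist_comm, Real.dist_eq]
      exact (hC' n _ hk).2.2
  refine ⟨min 1 ((2 ^ n)⁻¹), by positivity, fun s hs => ?_⟩
  have hs1 : dist s t < 1 := hs.trans_le (min_le_left _ _)
  have hs2 : dist s t < (2 ^ n)⁻¹ := hs.trans_le (min_le_right _ _)
  have htN : t ≤ N := le_trans (by simp) hN
  have hsN : s ≤ N := by
    refine le_trans ?_ hN
    rw [NNReal.dist_eq] at hs1
    have := (abs_lt.1 hs1).2
    rw [← NNReal.coe_le_coe]
    push_cast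
    linarith
  have hmid : dist (x ⌊s * 2 ^ n⌋₊ n) (x ⌊t * 2 ^ n⌋₊ n) ≤ C' * r ^ n := by
    rcases le_total s t with hst | hst
    · exact hclose s t hst htN hs2
    · rw [dist_comm]
      exact hclose t s hst hsN (by rwa [dist_comm])
  calc dist (f s) (f t) ≤ dist (f s) (x ⌊s * 2 ^ n⌋₊ n) + dist (x ⌊s * 2 ^ n⌋₊ n) (x ⌊t * 2 ^ n⌋₊ n)
        + dist (x ⌊t * 2 ^ n⌋₊ n) (f t) := dist_triangle4 _ _ _ _
    _ ≤ C * r ^ n / (1 - r) + C' * r ^ n + C * r ^ n / (1 - r) := by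
        gcongr
        · rw [dist_comm]; exact happ s hsN
        · exact happ t htN
    _ = (C / (1 - r) + C' + C / (1 - r)) * r ^ n := by ring
    _ < ε := hn

end Chaining

theorem IsNonnegDefinite.one_sub_nonneg {A : ℝ≥0 → ℝ} (hA : IsNonnegDefinite A) (h0 : A 0 = 1)
    (x : ℝ≥0) : 0 ≤ 1 - A x := by
  have h := hA.sq_sub_le h0 x 0
  have e : nndist x 0 = x := by rw [NNReal.nndist_eq]; simp
  rw [e] at h
  nlinarith [sq_nonneg (A x - A 0)]

theorem ae_exists_forall_le_of_sum_lintegral {Ω : Type*} [MeasurableSpace Ω] {P : Measure Ω}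
    {Y : ℕ → Ω → ℝ} (hY : ∀ n, Integrable (Y n) P) (h0 : ∀ n ω, 0 ≤ Y n ω)
    (hs : Summable fun n => ∫ ω, Y n ω ∂P) : ∀ᵐ ω ∂P, ∃ B, 0 ≤ B ∧ ∀ n, Y n ω ≤ B := by
  have h1 : ∫⁻ ω, ∑' n, ENNReal.ofReal (Y n ω) ∂P ≠ ⊤ := by
    rw [lintegral_tsum fun n => (hY n).aemeasurable.ennreal_ofReal]
    simp only [← ofReal_integral_eq_lintegral_ofReal (hY _) (.of_forall (h0 _))]
    rw [← ENNReal.ofReal_tsum_of_nonneg (fun n => integral_nonneg (h0 n)) hs]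
    exact ENNReal.ofReal_ne_top
  filter_upwards [ae_lt_top' (AEMeasurable.tsum fun n =>
    (hY n).aemeasurable.ennreal_ofReal) h1] with ω hω
  refine ⟨(∑' n, ENNReal.ofReal (Y n ω)).toReal, ENNReal.toReal_nonneg, fun n => ?_⟩
  have := ENNReal.toReal_mono hω.ne (ENNReal.le_tsum (f := fun n => ENNReal.ofReal (Y n ω)) n)
  rwa [ENNReal.toReal_ofReal (h0 n ω)] at this

/-- A correlation function with `1 - A(τ) = O(τ ^ α)`, `α > 1`, is realized by a stationary
Gaussian process with continuous paths. -/
theorem exists_continuous_stationary_gaussian {A : ℝ≥0 → ℝ} (hA : IsNonnegDefinite A)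
    (h0 : A 0 = 1) {C α : ℝ} (hα : 1 < α) (hC : ∀ τ : ℝ≥0, τ ≤ 1 → 1 - A τ ≤ C * (τ : ℝ) ^ α) :
    ∃ (Ω : Type u) (_ : MeasurableSpace Ω) (P : Measure Ω) (Z : ℝ≥0 → Ω → ℝ),
      IsProbabilityMeasure P ∧ IsStationaryGaussian P Z A ∧
        ∀ᵐ ω ∂P, Continuous fun t => Z t ω := by
  have hAc := hA.continuous h0 (zero_lt_one.trans hα) hC
  have hC0 : 0 ≤ C := by
    have := (hA.one_sub_nonneg h0 1).trans (hC 1 le_rfl)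
    simpa using this
  -- The integer coding (k, n) stands for the dyadic time k/2^n. One time carries several codes;
  -- their increments have variance zero.
  let q : ℕ → ℝ≥0 := fun m => m.unpair.1 / 2 ^ m.unpair.2
  obtain ⟨Ω, mΩ, P, ξ, hP, hξ, hG⟩ := exists_gaussian_sequence_universe.{u}
    (K := fun m m' => A (nndist (q m) (q m'))) (fun i j => by rw [nndist_comm])
    (fun n c => hA (fun i : Finset.Iic n => q i) c)
  have hincr : ∀ m m', Integrable (fun ω => (ξ m ω - ξ m' ω) ^ 2) P ∧
      ∫ ω, (ξ m ω - ξ m' ω) ^ 2 ∂P = 2 * (1 - A (nndist (q m) (q m'))) := by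
    intro m m'
    have hX := (hG (fun b : Bool => cond b m m')).sum_map (fun b => cond b 1 (-1))
    have e := hX.integral_sq ()
    have i1 := (hX.memLp_two ()).integrable_sq
    simp only [Fintype.sum_bool, cond_true, cond_false, one_mul, neg_one_mul, ← sub_eq_add_neg,
      nndist_self, h0, nndist_comm (q m') (q m)] at e i1
    refine ⟨i1, e.trans (by ring)⟩
  have hincr' : ∀ m m' n, nndist (q m) (q m') ≤ (2 ^ n)⁻¹ →
      ∫ ω, (ξ m ω - ξ m' ω) ^ 2 ∂P ≤ 2 * C * ((2 : ℝ) ^ (-α)) ^ n := by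
    intro m m' n h
    rw [(hincr m m').2, mul_assoc]
    have h1 : nndist (q m) (q m') ≤ 1 := h.trans (inv_le_one_of_one_le₀ (one_le_pow₀ one_le_two))
    refine mul_le_mul_of_nonneg_left ((hC _ h1).trans (mul_le_mul_of_nonneg_left ?_ hC0)) two_pos.le
    have h2 : ((nndist (q m) (q m') : ℝ≥0) : ℝ) ≤ ((2 : ℝ) ^ n)⁻¹ := by exact_mod_cast h
    calc ((nndist (q m) (q m') : ℝ≥0) : ℝ) ^ α ≤ (((2 : ℝ) ^ n)⁻¹) ^ α :=
          Real.rpow_le_rpow (NNReal.coe_nonneg _) h2 (by linarith)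
      _ = ((2 : ℝ) ^ (-α)) ^ n := by
          rw [Real.inv_rpow (by positivity), ← Real.rpow_natCast, ← Real.rpow_natCast,
            ← Real.rpow_mul two_pos.le, ← Real.rpow_mul two_pos.le, ← Real.rpow_neg two_pos.le]
          congr 1; ring
  let x : ℕ → ℕ → Ω → ℝ := fun k n => ξ (Nat.pair k n)
  have hq : ∀ k n, q (Nat.pair k n) = k / 2 ^ n := fun k n => by simp [q]
  have hd0 : ∀ k n, nndist (q (Nat.pair (2 * k) (n + 1))) (q (Nat.pair k n)) ≤ (2 ^ n)⁻¹ := by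
    intro k n
    rw [hq, hq]
    have : ((2 * k : ℕ) : ℝ≥0) / 2 ^ (n + 1) = k / 2 ^ n := by
      push_cast; rw [pow_succ]; field_simp
    rw [this, nndist_self]; exact zero_le
  have hd1 : ∀ k n, nndist (q (Nat.pair (2 * k + 1) (n + 1))) (q (Nat.pair k n)) ≤ (2 ^ n)⁻¹ := by
    intro k n
    rw [hq, hq, ← NNReal.coe_le_coe, coe_nndist, NNReal.dist_eq]
    push_cast
    have : ((2 : ℝ) * k + 1) / 2 ^ (n + 1) - k / 2 ^ n = (2 ^ n)⁻¹ * (1 / 2) := by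
      rw [pow_succ]; field_simp; ring
    rw [this, abs_of_nonneg (by positivity)]
    have : (0 : ℝ) < (2 ^ n)⁻¹ := by positivity
    linarith
  have hd2 : ∀ k n, nndist (q (Nat.pair (k + 1) n)) (q (Nat.pair k n)) ≤ (2 ^ n)⁻¹ := by
    intro k n
    rw [hq, hq, ← NNReal.coe_le_coe, coe_nndist, NNReal.dist_eq]
    push_cast
    have : ((k : ℝ) + 1) / 2 ^ n - k / 2 ^ n = (2 ^ n)⁻¹ := by field_simp; ring
    rw [this, abs_of_nonneg (by positivity)]
  let D : ℕ → ℕ → Ω → ℝ := fun k n ω => (x (2 * k) (n + 1) ω - x k n ω) ^ 2 +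
    (x (2 * k + 1) (n + 1) ω - x k n ω) ^ 2 + (x (k + 1) n ω - x k n ω) ^ 2
  have hDi : ∀ k n, Integrable (D k n) P := fun k n =>
    ((hincr _ _).1.add (hincr _ _).1).add (hincr _ _).1
  have hDE : ∀ k n, ∫ ω, D k n ω ∂P ≤ 6 * C * ((2 : ℝ) ^ (-α)) ^ n := by
    intro k n
    have : ∫ ω, D k n ω ∂P = ∫ ω, (x (2 * k) (n + 1) ω - x k n ω) ^ 2 ∂P +
        ∫ ω, (x (2 * k + 1) (n + 1) ω - x k n ω) ^ 2 ∂P + ∫ ω, (x (k + 1) n ω - x k n ω) ^ 2 ∂P :=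
      (integral_add ((hincr _ _).1.add (hincr _ _).1) (hincr _ _).1).trans
        (congrArg (· + _) (integral_add (hincr _ _).1 (hincr _ _).1))
    rw [this]
    linarith [hincr' _ _ n (hd0 k n), hincr' _ _ n (hd1 k n), hincr' _ _ n (hd2 k n)]
  -- At level n there are of order 2^n increments, each with second moment of order 2^(-αn). The
  -- total is of order g^n, and g < 1 exactly because α > 1.
  set g : ℝ := 2 * 2 ^ (-α) with hg
  have hg0 : 0 < g := by positivity
  have hg1 : g < 1 := by
    have : g = 2 ^ (1 + -α) := by rw [Real.rpow_add two_pos, Real.rpow_one]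
    rw [this]
    exact Real.rpow_lt_one_of_one_lt_of_neg one_lt_two (by linarith)
  -- Dividing squared increments by r^(2n) = √g^n leaves expectations of order √g^n, still summable,
  -- so that almost surely all increments are O(r^n).
  set r : ℝ := √√g with hr
  have hr0 : 0 < r := by positivity
  have hr2 : r ^ 2 = √g := Real.sq_sqrt (Real.sqrt_nonneg _)
  have hsg1 : √g < 1 := by rw [Real.sqrt_lt' one_pos]; linarith
  have hr1 : r < 1 := by rw [hr, Real.sqrt_lt' one_pos]; linarith
  have hbound : ∀ N : ℕ, ∀ᵐ ω ∂P, ∃ B, 0 ≤ B ∧ ∀ n,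
      ∑ k ∈ Finset.range (N * 2 ^ n + 1), D k n ω / r ^ (2 * n) ≤ B := by
    intro N
    have hD0 : ∀ k n ω, 0 ≤ D k n ω := fun k n ω => by positivity
    refine ae_exists_forall_le_of_sum_lintegral (fun n => integrable_finsetSum _ fun k _ =>
      (hDi k n).div_const _) (fun n ω => Finset.sum_nonneg fun k _ => div_nonneg (hD0 k n ω)
        (by positivity)) ?_
    refine Summable.of_nonneg_of_le (fun n => integral_nonneg fun ω => Finset.sum_nonneg fun k _ =>
      div_nonneg (hD0 k n ω) (by positivity)) (fun n => ?_)
      ((summable_geometric_of_lt_one (Real.sqrt_nonneg g) hsg1).mul_left ((N + 1) * (6 * C)))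
    rw [integral_finsetSum _ fun k _ => (hDi k n).div_const _]
    simp only [integral_div]
    calc ∑ k ∈ Finset.range (N * 2 ^ n + 1), (∫ ω, D k n ω ∂P) / r ^ (2 * n)
        ≤ ∑ k ∈ Finset.range (N * 2 ^ n + 1), 6 * C * ((2 : ℝ) ^ (-α)) ^ n / r ^ (2 * n) :=
          Finset.sum_le_sum fun k _ => by gcongr; exact hDE k n
      _ = (N * 2 ^ n + 1) * (6 * C * ((2 : ℝ) ^ (-α)) ^ n / r ^ (2 * n)) := by
          simp
      _ ≤ ((N + 1) * 2 ^ n) * (6 * C * ((2 : ℝ) ^ (-α)) ^ n / r ^ (2 * n)) := by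
          gcongr
          nlinarith [one_le_pow₀ (one_le_two : (1 : ℝ) ≤ 2) (n := n)]
      _ = (N + 1) * (6 * C) * (√g) ^ n := by
          rw [pow_mul, hr2]
          have e1 : ((2 : ℝ) ^ n) * (2 ^ (-α)) ^ n = √g ^ n * √g ^ n := by
            rw [← mul_pow, ← mul_pow, Real.mul_self_sqrt hg0.le]
          have e2 : (0 : ℝ) < √g ^ n := by positivity
          field_simp
          linear_combination C * e1
  have hgood : ∀ᵐ ω ∂P, ∃ f : ℝ≥0 → ℝ, Continuous f ∧
      ∀ t, Tendsto (fun n => x ⌊t * 2 ^ n⌋₊ n ω) atTop (𝓝 (f t)) := by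
    filter_upwards [ae_all_iff.2 hbound] with ω hω
    refine exists_continuous_of_dyadic (x := fun k n => x k n ω) hr0 hr1 fun N => ?_
    obtain ⟨B, hB0, hB⟩ := hω N
    refine ⟨√B, fun n k hk => ?_⟩
    have h1 : D k n ω ≤ (√B * r ^ n) ^ 2 := by
      have h2 : D k n ω / r ^ (2 * n) ≤ B := le_trans (Finset.single_le_sum
        (f := fun k => D k n ω / r ^ (2 * n)) (fun k _ => by positivity)
        (Finset.mem_range.2 (Nat.lt_succ_of_le hk))) (hB n)
      rw [div_le_iff₀ (by positivity)] at h2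
      rw [mul_pow, Real.sq_sqrt hB0, ← pow_mul, mul_comm n]
      exact h2
    have h3 : 0 ≤ √B * r ^ n := by positivity
    refine ⟨abs_le_of_sq_le_sq ?_ h3, abs_le_of_sq_le_sq ?_ h3, abs_le_of_sq_le_sq ?_ h3⟩ <;>
    · simp only [D] at h1
      nlinarith [sq_nonneg (x (2 * k) (n + 1) ω - x k n ω),
        sq_nonneg (x (2 * k + 1) (n + 1) ω - x k n ω), sq_nonneg (x (k + 1) n ω - x k n ω)]
  -- Where chaining fails the path is set to 0. Measurability is recovered afterwards from the
  -- almost sure limits.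
  have hex : ∀ ω, ∃ f : ℝ≥0 → ℝ, (∃ f : ℝ≥0 → ℝ, Continuous f ∧
      ∀ t, Tendsto (fun n => x ⌊t * 2 ^ n⌋₊ n ω) atTop (𝓝 (f t))) → Continuous f ∧
      ∀ t, Tendsto (fun n => x ⌊t * 2 ^ n⌋₊ n ω) atTop (𝓝 (f t)) := fun ω => by
    by_cases h : ∃ f : ℝ≥0 → ℝ, Continuous f ∧
      ∀ t, Tendsto (fun n => x ⌊t * 2 ^ n⌋₊ n ω) atTop (𝓝 (f t))
    · exact ⟨h.choose, fun _ => h.choose_spec⟩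
    · exact ⟨0, fun h' => absurd h' h⟩
  choose f hf using hex
  have hZ : ∀ {ι : Type} [Fintype ι] (t : ι → ℝ≥0), IsCenteredGaussian P (fun i ω => f ω (t i))
      (fun i j => A (nndist (t i) (t j))) := by
    intro ι _ t
    refine .of_tendsto_ae (fun n => hG fun i => Nat.pair ⌊t i * 2 ^ n⌋₊ n) (fun i => ?_)
      fun i j => ?_
    · filter_upwards [hgood] with ω hω
      exact (hf ω hω).2 (t i)
    · simp only [hq]
      exact (hAc.tendsto _).comp ((tendsto_floor_div_two_pow _).nndist
        (tendsto_floor_div_two_pow _))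
  have hgp : IsGaussianProcess (fun t ω => f ω t) P := by
    refine IsCenteredGaussian.isGaussianProcess fun I => ⟨_, hZ fun i : I => (i : ℝ≥0)⟩
  refine ⟨Ω, mΩ, P, fun t ω => f ω t, hP, ⟨hgp, fun t => ?_, fun s t => ?_, h0⟩, ?_⟩
  · exact (hZ fun _ : Unit => t).integral_eval ()
  · have := (hZ fun b : Bool => cond b s (s + t)).integral_mul true false
    simp only [cond_true, cond_false] at this
    rw [this]
    congr 1
    ext
    rw [coe_nndist, NNReal.dist_eq, NNReal.coe_add, abs_sub_comm, add_sub_cancel_left,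
      abs_of_nonneg t.coe_nonneg]
  · filter_upwards [hgood] with ω hω
    exact (hf ω hω).1

/-! ### Persistence probabilities of stationary Gaussian processes. -/

namespace IsStationaryGaussian

section Covariance

variable {Ω : Type*} [MeasurableSpace Ω] {P : Measure Ω} {Z : ℝ≥0 → Ω → ℝ} {A : ℝ≥0 → ℝ}

theorem integral_mul_eq (hZ : IsStationaryGaussian P Z A) (s t : ℝ≥0) :
    ∫ ω, Z s ω * Z t ω ∂P = A (nndist s t) := by
  wlog h : s ≤ t generalizing s t
  · rw [nndist_comm, ← this t s (le_of_not_ge h)]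
    simp only [mul_comm]
  obtain ⟨r, rfl⟩ := exists_add_of_le h
  rw [hZ.covariance]
  congr 1
  ext
  rw [coe_nndist, NNReal.dist_eq, NNReal.coe_add, abs_sub_comm, add_sub_cancel_left,
    abs_of_nonneg r.coe_nonneg]

theorem isCenteredGaussian (hZ : IsStationaryGaussian P Z A) {ι : Type*} [Fintype ι]
    (t : ι → ℝ≥0) :
    IsCenteredGaussian P (fun i => Z (t i)) (fun i j => A (nndist (t i) (t j))) :=
  .of_gaussian_family (A := fun s t => A (nndist s t)) hZ.gaussian hZ.centered
    hZ.integral_mul_eq t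

theorem map_eval_eq (hZ : IsStationaryGaussian P Z A) (t : ℝ≥0) :
    P.map (Z t) = gaussianReal 0 1 := by
  have := (hZ.isCenteredGaussian fun _ : Unit => t).map_eval ()
  simpa [hZ.unit_variance] using this

theorem aemeasurable (hZ : IsStationaryGaussian P Z A) (t : ℝ≥0) : AEMeasurable (Z t) P :=
  (hZ.isCenteredGaussian fun _ : Unit => t).aemeasurable ()

theorem measureReal_pos (hZ : IsStationaryGaussian P Z A) (t : ℝ≥0) {S : Set ℝ} (hS : IsOpen S)
    (hS' : S.Nonempty) : 0 < P.real {ω | Z t ω ∈ S} := by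
  have := hZ.gaussian.isProbabilityMeasure
  have h1 : P {ω | Z t ω ∈ S} = gaussianReal 0 1 S := by
    rw [← hZ.map_eval_eq t, Measure.map_apply_of_aemeasurable (hZ.aemeasurable t) hS.measurableSet]
    rfl
  refine ENNReal.toReal_pos ?_ (measure_ne_top _ _)
  rw [h1]
  intro h2
  exact (hS.measure_pos volume hS').ne' (gaussianReal_absolutelyContinuous' 0 one_ne_zero h2)

end Covariance

section Paths

variable {Ω : Type u} [MeasurableSpace Ω] {P : Measure Ω} {Z : ℝ≥0 → Ω → ℝ} {A : ℝ≥0 → ℝ}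

/-- A continuous path attains its supremum on the compact interval, so the strict bound can be
tested pointwise. -/
theorem supPersistenceProb_eq (hc : ∀ᵐ ω ∂P, Continuous fun t => Z t ω) (T : ℝ≥0) :
    supPersistenceProb P Z T = P.real {ω | ∀ t ≤ T, Z t ω < 0} := by
  refine measureReal_congr ?_
  filter_upwards [hc] with ω hω
  refine propext ((isCompact_Icc.sSup_lt_iff_of_continuous ⟨0, le_rfl, zero_le⟩
    hω.continuousOn 0).trans ?_)
  exact ⟨fun h t ht => h t ⟨zero_le, ht⟩, fun h t ht => h t ht.2⟩

/-- Negativity of the path forces a uniform gap, up to small probability. -/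
theorem exists_gap (hZ : IsStationaryGaussian P Z A) (hc : ∀ᵐ ω ∂P, Continuous fun t => Z t ω)
    (T : ℝ≥0) {ε : ℝ} (hε : 0 < ε) :
    ∃ δ > 0, ∀ {ι : Type} [Fintype ι] (t : ι → ℝ≥0), (∀ i, t i ≤ T) →
      supPersistenceProb P Z T ≤ P.real {ω | ∀ i, Z (t i) ω ≤ -δ} + ε := by
  have := hZ.gaussian.isProbabilityMeasure
  have e : P.real {ω | ∀ t ≤ T, Z t ω < 0}
      = P.real (⋃ m : ℕ, {ω | ∀ t ≤ T, Z t ω ≤ -(1 / ((m : ℝ) + 1))}) := by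
    refine measureReal_congr ?_
    filter_upwards [hc] with ω hω
    refine propext ⟨fun h => ?_, fun h t ht => ?_⟩
    · obtain ⟨x, hx, hmax⟩ := isCompact_Icc.exists_isMaxOn (s := Set.Icc 0 T)
        ⟨0, le_rfl, zero_le⟩ hω.continuousOn
      obtain ⟨m, hm⟩ := exists_nat_one_div_lt (neg_pos.2 (h x hx.2))
      exact Set.mem_iUnion.2 ⟨m, fun t ht =>
        (hmax (show t ∈ Set.Icc 0 T from ⟨zero_le, ht⟩)).trans (by linarith)⟩
    · obtain ⟨m, hm⟩ := Set.mem_iUnion.1 h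
      have : 0 < 1 / ((m : ℝ) + 1) := by positivity
      linarith [hm t ht]
  have hlim : Tendsto (fun m : ℕ => P.real {ω | ∀ t ≤ T, Z t ω ≤ -(1 / ((m : ℝ) + 1))}) atTop
      (𝓝 (supPersistenceProb P Z T)) := by
    rw [supPersistenceProb_eq hc, e]
    refine (ENNReal.tendsto_toReal (measure_ne_top _ _)).comp (tendsto_measure_iUnion_atTop ?_)
    intro m n hmn ω H t ht
    refine (H t ht).trans (neg_le_neg ?_)
    gcongr
  obtain ⟨m, hm⟩ := (hlim.eventually (lt_mem_nhds (sub_lt_self _ hε))).exists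
  refine ⟨1 / ((m : ℝ) + 1), by positivity, fun t ht => ?_⟩
  have : P.real {ω | ∀ t ≤ T, Z t ω ≤ -(1 / ((m : ℝ) + 1))}
      ≤ P.real {ω | ∀ i, Z (t i) ω ≤ -(1 / ((m : ℝ) + 1))} :=
    measureReal_mono fun ω h i => h _ (ht i)
  linarith

/-- Negativity of the path is detected on a finite grid, up to small probability. -/
theorem exists_grid (hZ : IsStationaryGaussian P Z A) (hc : ∀ᵐ ω ∂P, Continuous fun t => Z t ω)
    (T : ℝ≥0) {x : ℝ} (hx : x < 0) {ε : ℝ} (hε : 0 < ε) :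
    ∃ (n : ℕ) (t : Fin n → ℝ≥0), (∀ i, t i ≤ T) ∧
      P.real {ω | ∀ i, Z (t i) ω ≤ x} ≤ supPersistenceProb P Z T + ε := by
  have := hZ.gaussian.isProbabilityMeasure
  let d : ℕ → ℝ≥0 := fun m => min (TopologicalSpace.denseSeq ℝ≥0 m) T
  have hlim : Tendsto (fun n : ℕ => P.real {ω | ∀ i : Fin n, Z (d i) ω ≤ x}) atTop
      (𝓝 (P.real (⋂ n : ℕ, {ω | ∀ i : Fin n, Z (d i) ω ≤ x}))) := by
    refine (ENNReal.tendsto_toReal (measure_ne_top _ _)).comp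
      (tendsto_measure_iInter_atTop (fun n => ?_) ?_ ⟨0, measure_ne_top _ _⟩)
    · exact (hZ.isCenteredGaussian fun i : Fin n => d i).nullMeasurableSet_le _
    · intro m n hmn ω H i
      exact H (Fin.castLE hmn i)
  have hle : P.real (⋂ n : ℕ, {ω | ∀ i : Fin n, Z (d i) ω ≤ x}) ≤ supPersistenceProb P Z T := by
    rw [supPersistenceProb_eq hc]
    refine ENNReal.toReal_mono (measure_ne_top _ _) (measure_mono_ae ?_)
    filter_upwards [hc] with ω hω h
    have h1 : ∀ m, Z (d m) ω ≤ x := fun m => (Set.mem_iInter.1 h (m + 1)) ⟨m, Nat.lt_succ_self m⟩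
    have h2 : ∀ s : ℝ≥0, Z (min s T) ω ≤ x := fun s => by
      have hcl : IsClosed {s : ℝ≥0 | Z (min s T) ω ≤ x} :=
        isClosed_le (hω.comp (continuous_id.min continuous_const)) continuous_const
      have := (TopologicalSpace.denseRange_denseSeq ℝ≥0).closure_range
      have hsub : closure (Set.range (TopologicalSpace.denseSeq ℝ≥0))
          ⊆ {s : ℝ≥0 | Z (min s T) ω ≤ x} :=
        hcl.closure_subset_iff.2 (by rintro _ ⟨m, rfl⟩; exact h1 m)
      rw [this] at hsub
      exact hsub (Set.mem_univ s)
    intro t ht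
    have := h2 t
    rw [min_eq_left ht] at this
    exact this.trans_lt hx
  obtain ⟨n, hn⟩ := (hlim.eventually (gt_mem_nhds (lt_add_of_pos_right _ hε))).exists
  exact ⟨n, fun i => d i, fun i => min_le_right _ _, by linarith⟩

theorem supPersistenceProb_le_one (hZ : IsStationaryGaussian P Z A) (T : ℝ≥0) :
    supPersistenceProb P Z T ≤ 1 := by
  have := hZ.gaussian.isProbabilityMeasure
  exact measureReal_le_one

theorem supPersistenceProb_anti (hZ : IsStationaryGaussian P Z A)
    (hc : ∀ᵐ ω ∂P, Continuous fun t => Z t ω) {S T : ℝ≥0} (h : S ≤ T) :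
    supPersistenceProb P Z T ≤ supPersistenceProb P Z S := by
  have := hZ.gaussian.isProbabilityMeasure
  rw [supPersistenceProb_eq hc, supPersistenceProb_eq hc]
  exact measureReal_mono fun ω H t ht => H t (ht.trans h)

/-- Persistence depends on the correlation function alone: the gap for one process meets a finite
grid for the other, and on that grid Slepian's inequality applies with equal covariances. -/
theorem supPersistenceProb_congr {Ω' : Type v} [MeasurableSpace Ω'] {P' : Measure Ω'}
    {Z' : ℝ≥0 → Ω' → ℝ} (hZ : IsStationaryGaussian P Z A)
    (hc : ∀ᵐ ω ∂P, Continuous fun t => Z t ω) (hZ' : IsStationaryGaussian P' Z' A)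
    (hc' : ∀ᵐ ω ∂P', Continuous fun t => Z' t ω) (T : ℝ≥0) :
    supPersistenceProb P Z T ≤ supPersistenceProb P' Z' T := by
  refine le_of_forall_pos_le_add fun ε hε => ?_
  obtain ⟨δ, hδ, h1⟩ := hZ.exists_gap hc T (half_pos hε)
  obtain ⟨n, t, ht, h2⟩ := hZ'.exists_grid hc' T (neg_lt_zero.2 hδ) (half_pos hε)
  have h3 := (hZ.isCenteredGaussian t).real_le_of_cov_le (hZ'.isCenteredGaussian t)
    (fun _ _ _ => le_rfl) (fun _ => rfl) fun _ => -δ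
  linarith [h1 t ht]

/-- On a finite grid of [0, S+T], nonnegative correlations allow splitting at S, and stationarity
moves the second half to [0, T]. The gap and grid lemmas pass between grids and paths. -/
theorem mul_supPersistenceProb_le (hZ : IsStationaryGaussian P Z A)
    (hc : ∀ᵐ ω ∂P, Continuous fun t => Z t ω) (hA : ∀ τ, 0 ≤ A τ) (S T : ℝ≥0) :
    supPersistenceProb P Z S * supPersistenceProb P Z T ≤ supPersistenceProb P Z (S + T) := by
  have := hZ.gaussian.isProbabilityMeasure
  refine le_of_forall_pos_le_add fun ε hε => ?_
  obtain ⟨δ₁, hδ₁, h1⟩ := hZ.exists_gap hc S (show 0 < ε / 3 by positivity)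
  obtain ⟨δ₂, hδ₂, h2⟩ := hZ.exists_gap hc T (show 0 < ε / 3 by positivity)
  have hδ : 0 < min δ₁ δ₂ := lt_min hδ₁ hδ₂
  obtain ⟨n, t, ht, h3⟩ := hZ.exists_grid hc (S + T) (neg_lt_zero.2 hδ)
    (show 0 < ε / 3 by positivity)
  have h4 := (hZ.isCenteredGaussian t).mul_real_le (fun i => t i ≤ S) (fun _ _ _ _ => hA _)
    fun _ => -min δ₁ δ₂
  have h5 : supPersistenceProb P Z S
      ≤ P.real {ω | ∀ i, t i ≤ S → Z (t i) ω ≤ -min δ₁ δ₂} + ε / 3 := by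
    refine (h1 (fun i : {i // t i ≤ S} => t i) fun i => i.2).trans (add_le_add ?_ le_rfl)
    exact measureReal_mono fun ω H i hi => (H ⟨i, hi⟩).trans (neg_le_neg (min_le_left _ _))
  have h6 : supPersistenceProb P Z T
      ≤ P.real {ω | ∀ i, ¬ t i ≤ S → Z (t i) ω ≤ -min δ₁ δ₂} + ε / 3 := by
    refine (h2 (fun i : {i // ¬ t i ≤ S} => t i - S) fun i => tsub_le_iff_left.2 (ht i)).trans
      (add_le_add ?_ le_rfl)
    refine ((hZ.isCenteredGaussian _).real_le_of_cov_le
      (hZ.isCenteredGaussian fun i : {i // ¬ t i ≤ S} => t i) (fun i j _ => le_of_eq ?_)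
      (fun i => by simp) fun _ => -δ₂).trans
      (measureReal_mono fun ω H i hi => (H ⟨i, hi⟩).trans (neg_le_neg (min_le_right _ _)))
    congr 1
    ext
    rw [coe_nndist, coe_nndist, NNReal.dist_eq, NNReal.dist_eq,
      NNReal.coe_sub (le_of_not_ge i.2), NNReal.coe_sub (le_of_not_ge j.2), sub_sub_sub_cancel_right]
  have h7 : supPersistenceProb P Z S ≤ 1 := hZ.supPersistenceProb_le_one S
  have h8 : P.real {ω | ∀ i, ¬ t i ≤ S → Z (t i) ω ≤ -min δ₁ δ₂} ≤ 1 := measureReal_le_one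
  have h9 : 0 ≤ P.real {ω | ∀ i, ¬ t i ≤ S → Z (t i) ω ≤ -min δ₁ δ₂} := measureReal_nonneg
  have h10 : 0 ≤ supPersistenceProb P Z S := measureReal_nonneg
  nlinarith

/-- A path that is negative at 0 stays negative for a short random time, so some interval of length
T/(m+1) has positive probability. Supermultiplicativity covers [0, T] with m+1 copies. -/
theorem supPersistenceProb_pos (hZ : IsStationaryGaussian P Z A)
    (hc : ∀ᵐ ω ∂P, Continuous fun t => Z t ω) (hA : ∀ τ, 0 ≤ A τ) (T : ℝ≥0) :
    0 < supPersistenceProb P Z T := by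
  have := hZ.gaussian.isProbabilityMeasure
  have h0 : 0 < P.real {ω | Z 0 ω < 0} :=
    hZ.measureReal_pos 0 isOpen_Iio ⟨-1, by norm_num [Set.mem_Iio]⟩
  have h1 : P.real {ω | Z 0 ω < 0}
      ≤ P.real (⋃ m : ℕ, {ω | ∀ t ≤ T / (m + 1), Z t ω < 0}) := by
    refine ENNReal.toReal_mono (measure_ne_top _ _) (measure_mono_ae ?_)
    filter_upwards [hc] with ω hω h
    have h2 : ∀ᶠ t in 𝓝 (0 : ℝ≥0), Z t ω < 0 := hω.continuousAt.eventually (gt_mem_nhds h)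
    obtain ⟨η, hη, h3⟩ := Metric.eventually_nhds_iff.1 h2
    obtain ⟨m, hm⟩ := exists_nat_gt ((T : ℝ) / η)
    refine Set.mem_iUnion.2 ⟨m, fun t ht => h3 ?_⟩
    rw [NNReal.dist_eq, NNReal.coe_zero, sub_zero, abs_of_nonneg t.coe_nonneg]
    have h4 : (t : ℝ) ≤ T / (m + 1) := by exact_mod_cast ht
    refine h4.trans_lt ?_
    rw [div_lt_iff₀ (by positivity)]
    rw [div_lt_iff₀ hη] at hm
    nlinarith
  have hlim : Tendsto (fun m : ℕ => P.real {ω | ∀ t ≤ T / (m + 1), Z t ω < 0}) atTop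
      (𝓝 (P.real (⋃ m : ℕ, {ω | ∀ t ≤ T / (m + 1), Z t ω < 0}))) := by
    refine (ENNReal.tendsto_toReal (measure_ne_top _ _)).comp (tendsto_measure_iUnion_atTop ?_)
    intro m n hmn ω H t ht
    refine H t (ht.trans ?_)
    gcongr
  obtain ⟨m, hm⟩ := (hlim.eventually (lt_mem_nhds (h0.trans_le h1))).exists
  have h5 : ∀ k : ℕ, 0 < supPersistenceProb P Z ((k + 1) * (T / (m + 1))) := by
    intro k
    induction k with
    | zero => simpa [supPersistenceProb_eq hc] using hm
    | succ k ih =>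
      have h6 : 0 < supPersistenceProb P Z (T / (m + 1)) := by rwa [supPersistenceProb_eq hc]
      have h7 := hZ.mul_supPersistenceProb_le hc hA ((k + 1) * (T / (m + 1))) (T / (m + 1))
      have e : ((k + 1 : ℕ) + 1 : ℝ≥0) * (T / (m + 1))
          = (k + 1) * (T / (m + 1)) + T / (m + 1) := by push_cast; ring
      rw [e]
      exact (mul_pos ih h6).trans_le h7
  have h8 := h5 m
  rwa [mul_div_cancel₀] at h8
  positivity

end Paths

end IsStationaryGaussian

/-! ### Existence and positivity of the persistence exponent. -/

theorem Nat.cast_dist_eq_abs (i j : ℕ) : ((Nat.dist i j : ℕ) : ℝ) = |(i : ℝ) - j| := by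
  rcases le_total i j with h | h
  · rw [Nat.dist_eq_sub_of_le h, Nat.cast_sub h, abs_sub_comm, abs_of_nonneg]
    exact sub_nonneg.2 (by exact_mod_cast h)
  · rw [Nat.dist_eq_sub_of_le_right h, Nat.cast_sub h, abs_of_nonneg]
    exact sub_nonneg.2 (by exact_mod_cast h)

/-- Fekete's lemma for a supermultiplicative nonincreasing function of a real variable. -/
theorem exists_tendsto_neg_log_div {q : ℝ≥0 → ℝ} (hpos : ∀ T, 0 < q T) (h1 : ∀ T, q T ≤ 1)
    (hanti : Antitone q) (hmul : ∀ S T, q S * q T ≤ q (S + T)) :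
    ∃ θ, Tendsto (fun T : ℝ≥0 => -(1 / (T : ℝ) * Real.log (q T))) atTop (𝓝 θ) := by
  let w : ℕ → ℝ := fun n => -Real.log (q n)
  have hw0 : ∀ n, 0 ≤ w n := fun n => neg_nonneg.2 (Real.log_nonpos (hpos _).le (h1 _))
  have hsub : Subadditive w := fun m n => by
    have := Real.log_le_log (mul_pos (hpos m) (hpos n)) (hmul m n)
    rw [Real.log_mul (hpos _).ne' (hpos _).ne'] at this
    simp only [w]
    push_cast
    linarith
  have hlim := hsub.tendsto_lim ⟨0, by rintro _ ⟨n, rfl⟩; exact div_nonneg (hw0 n) n.cast_nonneg⟩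
  -- The limit is known along integers. Monotonicity traps the value at T between those at ⌊T⌋ and
  -- ⌊T⌋ + 1.
  refine ⟨hsub.lim, ?_⟩
  have hT : Tendsto (fun T : ℝ≥0 => (T : ℝ)) atTop atTop := NNReal.tendsto_coe_atTop.2 tendsto_id
  have hfl : Tendsto (fun T : ℝ≥0 => ⌊(T : ℝ)⌋₊) atTop atTop := tendsto_nat_floor_atTop.comp hT
  have hr : Tendsto (fun T : ℝ≥0 => (⌊(T : ℝ)⌋₊ : ℝ) / T) atTop (𝓝 1) :=
    (tendsto_nat_floor_div_atTop (R := ℝ)).comp hT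
  have hr' : Tendsto (fun T : ℝ≥0 => ((⌊(T : ℝ)⌋₊ + 1 : ℕ) : ℝ) / T) atTop (𝓝 1) := by
    have := hr.add (tendsto_inv_atTop_zero.comp hT)
    rw [add_zero] at this
    refine this.congr fun T => ?_
    simp only [Function.comp_apply]
    push_cast
    ring
  have hlo : Tendsto (fun T : ℝ≥0 => w ⌊(T : ℝ)⌋₊ / T) atTop (𝓝 hsub.lim) := by
    have := (hlim.comp hfl).mul hr
    rw [mul_one] at this
    refine this.congr' ?_
    filter_upwards [hfl.eventually_ge_atTop 1] with T hT1
    have : (0 : ℝ) < ⌊(T : ℝ)⌋₊ := by exact_mod_cast hT1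
    simp only [Function.comp_apply]
    field_simp
  have hhi : Tendsto (fun T : ℝ≥0 => w (⌊(T : ℝ)⌋₊ + 1) / T) atTop (𝓝 hsub.lim) := by
    have := ((hlim.comp (tendsto_add_atTop_nat 1)).comp hfl).mul hr'
    rw [mul_one] at this
    refine this.congr fun T => ?_
    have : (0 : ℝ) < ((⌊(T : ℝ)⌋₊ + 1 : ℕ) : ℝ) := by positivity
    simp only [Function.comp_apply]
    field_simp
  refine tendsto_of_tendsto_of_tendsto_of_le_of_le hlo hhi (fun T => ?_) fun T => ?_
  · have h2 : q T ≤ q (⌊(T : ℝ)⌋₊ : ℝ≥0) :=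
      hanti (by rw [← NNReal.coe_le_coe]; exact_mod_cast Nat.floor_le T.coe_nonneg)
    have := Real.log_le_log (hpos _) h2
    simp only [w]
    rw [← mul_neg, one_div_mul_eq_div]
    gcongr
  · have h2 : q (⌊(T : ℝ)⌋₊ + 1 : ℕ) ≤ q T :=
      hanti (by rw [← NNReal.coe_le_coe]; exact_mod_cast (Nat.lt_floor_add_one (T : ℝ)).le)
    have := Real.log_le_log (hpos _) h2
    simp only [w]
    rw [← mul_neg, one_div_mul_eq_div]
    gcongr

namespace IsStationaryGaussian

variable {Ω : Type u} [MeasurableSpace Ω] {P : Measure Ω} {Z : ℝ≥0 → Ω → ℝ} {A : ℝ≥0 → ℝ}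

/-- Exponential decay of correlations forces exponentially small persistence probabilities. -/
theorem exists_supPersistenceProb_le_pow (hZ : IsStationaryGaussian P Z A)
    (hc : ∀ᵐ ω ∂P, Continuous fun t => Z t ω) {D c : ℝ} (hD : 0 < D) (hc0 : 0 < c)
    (hdec : ∀ τ : ℝ≥0, A τ ≤ D * Real.exp (-(c * τ))) :
    ∃ (L : ℕ) (r : ℝ), 0 < L ∧ 0 < r ∧ r < 1 ∧ ∀ n : ℕ, supPersistenceProb P Z (n * L : ℕ) ≤ r ^ n := by
  have := hZ.gaussian.isProbabilityMeasure
  set p := P.real {ω | Z 0 ω ≤ 1} with hp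
  have hp1 : p < 1 := by
    have h1 : 0 < P.real {ω | Z 0 ω ∈ Set.Ioi (1 : ℝ)} :=
      hZ.measureReal_pos 0 isOpen_Ioi ⟨2, by norm_num [Set.mem_Ioi]⟩
    have h2 : {ω | Z 0 ω ∈ Set.Ioi (1 : ℝ)} = {ω | Z 0 ω ≤ 1}ᶜ := by
      ext ω; simp
    have h3 : NullMeasurableSet {ω | Z 0 ω ≤ 1} P :=
      (hZ.aemeasurable 0).nullMeasurableSet_preimage measurableSet_Iic
    rw [h2, probReal_compl_eq_one_sub₀ h3] at h1
    linarith
  have hp0 : 0 ≤ p := measureReal_nonneg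
  -- For points spaced by L the correlation ratio is e^(-cL) = s². A large L makes the decoupling
  -- error smaller than (1 - p)/2, so each point contributes a factor strictly below 1.
  let s : ℕ → ℝ := fun L => Real.exp (-(c * L / 2))
  have hs0 : ∀ L, 0 < s L := fun L => Real.exp_pos _
  have hs : Tendsto s atTop (𝓝 0) := by
    refine Real.tendsto_exp_neg_atTop_nhds_zero.comp ?_
    exact ((tendsto_natCast_atTop_atTop (R := ℝ)).const_mul_atTop hc0).atTop_div_const two_pos
  have hs' : Tendsto (fun L => Real.exp (-((1 : ℝ) ^ 2 / (16 * D * s L)))) atTop (𝓝 0) := by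
    refine Real.tendsto_exp_neg_atTop_nhds_zero.comp ?_
    have h1 : Tendsto (fun L => 16 * D * s L) atTop (𝓝[>] 0) := by
      refine tendsto_nhdsWithin_iff.2 ⟨by simpa using hs.const_mul (16 * D), .of_forall fun L => ?_⟩
      have := hs0 L
      simp only [Set.mem_Ioi]
      positivity
    refine (tendsto_inv_nhdsGT_zero.comp h1).congr fun L => ?_
    simp
  have hs2 : Tendsto (fun L => 2 * D * s L) atTop (𝓝 0) := by simpa using hs.const_mul (2 * D)
  obtain ⟨L, hL1, hL2, hL3, hL4⟩ := ((hs.eventually (gt_mem_nhds (show (0 : ℝ) < 1 / 2 by norm_num))).and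
    ((hs2.eventually (gt_mem_nhds one_pos)).and ((hs'.eventually (gt_mem_nhds
      (show 0 < (1 - p) / 2 by linarith))).and (eventually_gt_atTop 0)))).exists
  refine ⟨L, p + (1 - p) / 2, hL4, by linarith, by linarith, fun n => ?_⟩
  let t : Fin n × Unit → ℝ≥0 := fun i => (i.1 : ℕ) * L
  have h1 := (hZ.isCenteredGaussian t).real_forall_nonpos_le_prod (s := s L) (u := 1) (D := D)
    (fun i => by rw [nndist_self, hZ.unit_variance]) hD (hs0 L) hL1.le hL2.le zero_le_one
    (fun i j _ => by
      refine (hdec _).trans (mul_le_mul_of_nonneg_left (le_of_eq ?_) hD.le)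
      rw [← Real.exp_nat_mul, ← Real.exp_nat_mul, coe_nndist, NNReal.dist_eq]
      congr 1
      simp only [t]
      push_cast
      rw [← sub_mul, abs_mul, Nat.abs_cast, Nat.cast_dist_eq_abs]
      ring)
  have h2 : ∀ i : Fin n, P.real {ω | ∀ j : Unit, Z (t (i, j)) ω ≤ 1} = p := by
    intro i
    have h3 := (hZ.map_eval_eq (t (i, ())))
    have h4 := hZ.map_eval_eq 0
    rw [hp, measureReal_def, measureReal_def]
    have e : ∀ s, P {ω | Z s ω ≤ 1} = P.map (Z s) (Set.Iic 1) := fun s => by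
      rw [Measure.map_apply_of_aemeasurable (hZ.aemeasurable s) measurableSet_Iic]; rfl
    have e' : {ω | ∀ j : Unit, Z (t (i, j)) ω ≤ 1} = {ω | Z (t (i, ())) ω ≤ 1} := by
      ext ω; exact ⟨fun h => h (), fun h _ => h⟩
    rw [e', e, e, h3, h4]
  have h3 : supPersistenceProb P Z (n * L : ℕ) ≤ P.real {ω | ∀ i, Z (t i) ω ≤ 0} := by
    rw [supPersistenceProb_eq hc]
    refine measureReal_mono fun ω h i => (h _ ?_).le
    simp only [t]
    push_cast
    gcongr
    exact i.1.2.le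
  refine h3.trans (h1.trans ?_)
  calc _ = ∏ _i : Fin n, (p + Real.exp (-((1 : ℝ) ^ 2 / (16 * D * s L)))) :=
        Finset.prod_congr rfl fun i _ => by rw [h2]
    _ = (p + Real.exp (-((1 : ℝ) ^ 2 / (16 * D * s L)))) ^ n := by simp
    _ ≤ _ := by gcongr

/-- Nonnegative correlations give the limit by Fekete's lemma; their exponential decay makes it
positive. -/
theorem exists_exponent (hZ : IsStationaryGaussian P Z A)
    (hc : ∀ᵐ ω ∂P, Continuous fun t => Z t ω) (hA : ∀ τ, 0 ≤ A τ) {D c : ℝ} (hD : 0 < D)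
    (hc0 : 0 < c) (hdec : ∀ τ : ℝ≥0, A τ ≤ D * Real.exp (-(c * τ))) :
    ∃ θ, 0 < θ ∧ Tendsto (fun T : ℝ≥0 => -(1 / (T : ℝ) * Real.log (supPersistenceProb P Z T)))
      atTop (𝓝 θ) := by
  obtain ⟨θ, hθ⟩ := exists_tendsto_neg_log_div (hZ.supPersistenceProb_pos hc hA)
    hZ.supPersistenceProb_le_one (fun _ _ h => hZ.supPersistenceProb_anti hc h)
    (hZ.mul_supPersistenceProb_le hc hA)
  refine ⟨θ, ?_, hθ⟩
  obtain ⟨L, r, hL, hr0, hr1, h⟩ := hZ.exists_supPersistenceProb_le_pow hc hD hc0 hdec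
  have hL' : (0 : ℝ) < L := by exact_mod_cast hL
  have hlog := Real.log_neg hr0 hr1
  have h1 : Tendsto (fun n : ℕ => ((n * L : ℕ) : ℝ≥0)) atTop atTop :=
    tendsto_natCast_atTop_atTop.comp (tendsto_id.atTop_mul_const' hL)
  refine (div_pos (neg_pos.2 hlog) hL').trans_le (ge_of_tendsto (hθ.comp h1) ?_)
  filter_upwards [eventually_gt_atTop 0] with n hn
  have hn' : (0 : ℝ) < n := by exact_mod_cast hn
  have h2 := Real.log_le_log (hZ.supPersistenceProb_pos hc hA _) (h n)
  rw [Real.log_pow] at h2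
  simp only [Function.comp_apply, NNReal.coe_natCast]
  rw [← mul_neg, one_div, ← div_eq_inv_mul, div_le_div_iff₀ hL' (by positivity)]
  push_cast
  push_cast at h2
  nlinarith

end IsStationaryGaussian

/-! ### Lowering the level by a Cameron-Martin shift. -/

theorem gaussianReal_inter_Ici_le {w : ℝ≥0} (hw : w ≠ 0) {h L : ℝ} (hh : 0 ≤ h) {S : Set ℝ}
    (hS : MeasurableSet S) :
    gaussianReal 0 w (S ∩ Set.Ici (-L))
      ≤ ENNReal.ofReal (Real.exp ((2 * L * h + h ^ 2) / (2 * w))) * gaussianReal h w S := by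
  rw [gaussianReal_apply _ hw, gaussianReal_apply _ hw,
    ← lintegral_const_mul _ (measurable_gaussianPDF h w)]
  refine (setLIntegral_mono' (hS.inter measurableSet_Ici) fun x hx => ?_).trans
    (lintegral_mono_set Set.inter_subset_left)
  rw [gaussianPDF, gaussianPDF, ← ENNReal.ofReal_mul (Real.exp_nonneg _)]
  refine ENNReal.ofReal_le_ofReal ?_
  simp only [gaussianPDFReal]
  -- The ratio of the densities centered at 0 and at h is exp((h² - 2hx)/(2w)), largest at x = -L on
  -- the half-line.
  rw [mul_left_comm, ← Real.exp_add, ← add_div]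
  have hx : -L ≤ x := hx.2
  gcongr
  nlinarith

namespace IsCenteredGaussian

/-- Lowering a Gaussian vector from level `u` to level `-u` by a Cameron–Martin shift along the
coordinate `none`. -/
theorem real_le_shift {ι : Type*} [Fintype ι] {Ω : Type u} [MeasurableSpace Ω] {P : Measure Ω}
    {X : Option ι → Ω → ℝ} {K : Option ι → Option ι → ℝ} (hX : IsCenteredGaussian P X K)
    (hw : 0 < K none none) {u h L : ℝ} (hh : 0 ≤ h) (hL : 0 ≤ L)
    (hb : ∀ i : ι, 2 * u * K none none ≤ K (some i) none * h) :
    P.real {ω | ∀ i : ι, X (some i) ω ≤ u}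
      ≤ Real.exp ((2 * L * h + h ^ 2) / (2 * K none none)) * P.real {ω | ∀ i : ι, X (some i) ω ≤ -u}
        + Real.exp (-(L ^ 2 / (2 * K none none))) := by
  classical
  set w := K none none with hwd
  let γ := gaussianReal 0 w.toNNReal
  have hwn : w.toNNReal ≠ 0 := by simpa using hw
  -- These are the coefficients of the regression on the coordinate `none`. The residual is
  -- uncorrelated with that coordinate, which may thus be replaced by an independent variable and
  -- shifted alone.
  let b : Option ι → ℝ := fun o => K o none / w
  have hc := hX.canonical
  set μ := P.map (fun ω i => X i ω)
  have := hc.isProbabilityMeasure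
  have hγ : IsCenteredGaussian γ (fun (_ : Unit) y => y) (fun _ _ => w) := by
    refine ⟨fun _ => aemeasurable_id, fun _ _ => rfl, fun c => ?_, fun c => ?_⟩
    · simpa using mul_nonneg (mul_self_nonneg (c ())) hw.le
    · have h1 := gaussianReal_map_const_mul (μ := 0) (v := w.toNNReal) (c ())
      simp only [Finset.univ_unique, Finset.sum_singleton]
      rw [h1, mul_zero]
      congr 1
      rw [Real.toNNReal_mul (mul_self_nonneg _)]
      congr 1
      ext
      rw [Real.coe_toNNReal _ (mul_self_nonneg _)]
      simp [sq]
  have hR := hc.comp_linear fun (o o' : Option ι) =>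
    (if o' = o then 1 else 0) - b o * (if o' = none then 1 else 0)
  have hbY := hγ.comp_linear fun (o : Option ι) (_ : Unit) => b o
  have hY : IsCenteredGaussian (μ.prod γ)
      (fun o z => (z.1 o - b o * z.1 none) + b o * z.2) K := by
    have := (hR.add_prod hbY).congr_cov (K' := K) fun o o' => ?_
    · convert this using 3 with o z
      simp [sub_mul, Finset.sum_sub_distrib, ite_mul]
    · simp only [sub_mul, mul_sub, Finset.sum_sub_distrib, ite_mul, mul_ite, one_mul, zero_mul,
        mul_one, mul_zero, Finset.sum_ite_eq', Finset.mem_univ, if_true, Finset.univ_unique,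
        Finset.sum_singleton, b]
      rw [hX.symm none o', ← hwd]
      field_simp
      ring
  have key : ∀ c : ℝ, P.real {ω | ∀ i : ι, X (some i) ω ≤ c}
      = (μ.prod γ).real {z | ∀ i : ι, (z.1 (some i) - b (some i) * z.1 none) + b (some i) * z.2 ≤ c} := by
    intro c
    refine le_antisymm ?_ ?_
    · exact (hX.reindex some).real_le_of_cov_le (hY.reindex some) (fun _ _ _ => le_rfl)
        (fun _ => rfl) fun _ => c
    · exact (hY.reindex some).real_le_of_cov_le (hX.reindex some) (fun _ _ _ => le_rfl)
        (fun _ => rfl) fun _ => c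
  rw [key, key]
  let S : ℝ → (Option ι → ℝ) → Set ℝ := fun c x =>
    {y | ∀ i : ι, (x (some i) - b (some i) * x none) + b (some i) * y ≤ c}
  have hSm : ∀ c, MeasurableSet {z : (Option ι → ℝ) × ℝ |
      ∀ i : ι, (z.1 (some i) - b (some i) * z.1 none) + b (some i) * z.2 ≤ c} := fun c => by
    simp only [Set.ofPred_forall]
    exact MeasurableSet.iInter fun i => measurableSet_le (by fun_prop) measurable_const
  have hSm' : ∀ c x, MeasurableSet (S c x) := fun c x => measurable_prodMk_left (hSm c)
  have htail : γ (Set.Iio (-L)) ≤ ENNReal.ofReal (Real.exp (-(L ^ 2 / (2 * w)))) := by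
    have h1 := hγ.real_forall_lt_le {()} (R := w) hw hL (by simp)
    simp only [Finset.mem_singleton, Finset.card_singleton, pow_one] at h1
    have e : {y : ℝ | ∀ _ : Unit, True → y < -L} = Set.Iio (-L) := by
      ext y; exact ⟨fun h => h () trivial, fun h _ _ => h⟩
    rw [e] at h1
    rw [← ENNReal.ofReal_toReal (measure_ne_top γ (Set.Iio (-L)))]
    exact ENNReal.ofReal_le_ofReal h1
  set E := Real.exp ((2 * L * h + h ^ 2) / (2 * w)) with hE
  have hslice : ∀ x, γ (S u x) ≤ ENNReal.ofReal E * γ (S (-u) x)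
      + ENNReal.ofReal (Real.exp (-(L ^ 2 / (2 * w)))) := by
    intro x
    -- Moving the independent variable up by h raises each coordinate by at least 2u; to lie below u
    -- after the shift is to lie below -u before it.
    have h1 : gaussianReal h w.toNNReal (S u x) ≤ γ (S (-u) x) := by
      have h2 := gaussianReal_map_add_const (μ := 0) (v := w.toNNReal) h
      rw [zero_add] at h2
      rw [← h2, Measure.map_apply (by fun_prop) (hSm' u x)]
      refine measure_mono fun y hy i => ?_
      have h3 := hy i
      have h4 : 2 * u ≤ b (some i) * h := by
        simp only [b]
        rw [div_mul_eq_mul_div, le_div_iff₀ hw]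
        exact hb i
      simp only at h3
      linarith
    have h5 := gaussianReal_inter_Ici_le hwn (h := h) (L := L) hh (hSm' u x)
    rw [Real.coe_toNNReal _ hw.le] at h5
    calc γ (S u x) ≤ γ (S u x ∩ Set.Ici (-L) ∪ Set.Iio (-L)) := measure_mono fun y hy => by
          rcases lt_or_ge y (-L) with h | h
          · exact Or.inr h
          · exact Or.inl ⟨hy, h⟩
      _ ≤ γ (S u x ∩ Set.Ici (-L)) + γ (Set.Iio (-L)) := measure_union_le _ _
      _ ≤ _ := add_le_add (h5.trans (mul_le_mul_right h1 _)) htail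
  have hint : (μ.prod γ) {z | ∀ i : ι, (z.1 (some i) - b (some i) * z.1 none) + b (some i) * z.2 ≤ u}
      ≤ ENNReal.ofReal E * (μ.prod γ) {z | ∀ i : ι,
        (z.1 (some i) - b (some i) * z.1 none) + b (some i) * z.2 ≤ -u}
      + ENNReal.ofReal (Real.exp (-(L ^ 2 / (2 * w)))) := by
    rw [Measure.prod_apply (hSm u), Measure.prod_apply (hSm (-u))]
    refine (lintegral_mono hslice).trans (le_of_eq ?_)
    rw [lintegral_add_right _ measurable_const, lintegral_const, measure_univ, mul_one,
      lintegral_const_mul' _ _ ENNReal.ofReal_ne_top]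
    rfl
  have hfin := ENNReal.toReal_mono (by finiteness) hint
  rw [ENNReal.toReal_add (by finiteness) (by finiteness), ENNReal.toReal_mul,
    ENNReal.toReal_ofReal (Real.exp_nonneg _), ENNReal.toReal_ofReal (Real.exp_nonneg _)] at hfin
  exact hfin

end IsCenteredGaussian

/-- The shift direction is the sum of Z over a δ-grid of [0, M]. Its variance w is at most BM by
exponential decay, and its covariance with each Z(t) is at least 1/2: the neighboring grid point
alone contributes that much. So a shift changing the level by 2u costs only e^(O(u) M). -/
theorem IsStationaryGaussian.exists_real_le_shift {Ω : Type u} [MeasurableSpace Ω] {P : Measure Ω}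
    {Z : ℝ≥0 → Ω → ℝ} {A : ℝ≥0 → ℝ} (hZ : IsStationaryGaussian P Z A) (hA : ∀ τ, 0 ≤ A τ)
    (hAc : ContinuousAt A 0) {D c : ℝ} (hD : 0 < D) (hc0 : 0 < c)
    (hdec : ∀ τ : ℝ≥0, A τ ≤ D * Real.exp (-(c * τ))) {β κ : ℝ} (hβ : 0 < β) (hκ : 0 < κ) :
    ∃ u > 0, ∀ (M : ℝ≥0), 1 ≤ M → ∀ {ι : Type} [Fintype ι] (t : ι → ℝ≥0), (∀ i, t i ≤ M) →
      P.real {ω | ∀ i, Z (t i) ω ≤ u}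
        ≤ Real.exp (β * M) * P.real {ω | ∀ i, Z (t i) ω ≤ -u} + Real.exp (-(κ * M)) := by
  classical
  obtain ⟨δ, hδ, hδA⟩ : ∃ δ : ℝ≥0, 0 < δ ∧ ∀ τ ≤ δ, 1 / 2 ≤ A τ := by
    have h1 : ∀ᶠ τ in 𝓝 (0 : ℝ≥0), 1 / 2 < A τ :=
      hAc.eventually (lt_mem_nhds (by rw [hZ.unit_variance]; norm_num))
    obtain ⟨η, hη, h2⟩ := Metric.eventually_nhds_iff.1 h1
    refine ⟨(η / 2).toNNReal, Real.toNNReal_pos.2 (half_pos hη), fun τ hτ => (h2 ?_).le⟩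
    rw [NNReal.dist_eq, NNReal.coe_zero, sub_zero, abs_of_nonneg τ.coe_nonneg]
    have : (τ : ℝ) ≤ η / 2 := (Real.le_toNNReal_iff_coe_le (half_pos hη).le).1 hτ
    linarith
  have hδ' : (0 : ℝ) < δ := hδ
  set r := Real.exp (-(c * δ)) with hr
  have hr1 : r < 1 := by
    rw [hr, ← Real.exp_zero]
    exact Real.exp_lt_exp.2 (by simpa using mul_pos hc0 hδ')
  have hr0 : 0 < r := Real.exp_pos _
  set B : ℝ := (1 / δ + 1) * (D * (2 * (1 - r)⁻¹)) with hB
  have hB0 : 0 < B := by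
    have : 0 < (1 - r)⁻¹ := inv_pos.2 (by linarith)
    positivity
  -- With truncation at L = lM, the Gaussian tail exp(-L²/(2w)) is at most e^(-κM), since w ≤ BM.
  set l := √(2 * B * κ) with hl
  have hl0 : 0 < l := by positivity
  have hl2 : l ^ 2 = 2 * B * κ := Real.sq_sqrt (by positivity)
  -- The shift costs exp(4ulM + 8u²w), and u ≤ 1 bounds the exponent by u (4l + 8B) M ≤ βM.
  set u := min 1 (β / (4 * l + 8 * B)) with hu
  have hu0 : 0 < u := lt_min one_pos (by positivity)
  have hu1 : u ≤ 1 := min_le_left _ _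
  have hu2 : u * (4 * l + 8 * B) ≤ β := by
    have := min_le_right 1 (β / (4 * l + 8 * B))
    rw [← hu, le_div_iff₀ (by positivity)] at this
    exact this
  refine ⟨u, hu0, fun M hM ι _ t ht => ?_⟩
  have hM' : (1 : ℝ) ≤ M := hM
  set J := ⌊M / δ⌋₊ + 1 with hJ
  let g : Fin J → ℝ≥0 := fun j => (j : ℕ) * δ
  have hJM : (J : ℝ) ≤ (1 / δ + 1) * M := by
    have h1 : ((⌊M / δ⌋₊ : ℝ≥0) : ℝ) ≤ (M / δ : ℝ≥0) :=
      NNReal.coe_le_coe.2 (Nat.floor_le zero_le)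
    rw [NNReal.coe_natCast, NNReal.coe_div] at h1
    rw [hJ]
    push_cast
    calc (⌊M / δ⌋₊ : ℝ) + 1 ≤ M / δ + M := add_le_add h1 hM'
      _ = _ := by ring
  have hG := (hZ.isCenteredGaussian (Sum.elim t g)).comp_linear
    fun (o : Option ι) (p : ι ⊕ Fin J) => Option.elim o (Sum.elim 0 1 p)
      fun i => Sum.elim (fun i' => if i' = i then 1 else 0) 0 p
  set w := ∑ i : Fin J, ∑ j : Fin J, A (nndist (g i) (g j)) with hw
  have hgd : ∀ i j : Fin J, A (nndist (g i) (g j)) ≤ D * r ^ Nat.dist i j := fun i j => by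
    refine (hdec _).trans (mul_le_mul_of_nonneg_left (le_of_eq ?_) hD.le)
    rw [← Real.exp_nat_mul, coe_nndist, NNReal.dist_eq]
    congr 1
    simp only [g]
    push_cast
    rw [← sub_mul, abs_mul, NNReal.abs_eq, Nat.cast_dist_eq_abs]
    ring
  have hwB : w ≤ B * M := by
    calc w ≤ ∑ i : Fin J, D * (2 * (1 - r)⁻¹) := Finset.sum_le_sum fun i _ => by
          refine (Finset.sum_le_sum fun j _ => hgd i j).trans ?_
          rw [← Finset.mul_sum, Fin.sum_univ_eq_sum_range fun j => r ^ Nat.dist i j]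
          exact mul_le_mul_of_nonneg_left (sum_pow_dist_le hr0.le hr1 _ _) hD.le
      _ = J * (D * (2 * (1 - r)⁻¹)) := by simp
      _ ≤ ((1 / δ + 1) * M) * (D * (2 * (1 - r)⁻¹)) := by
          have : 0 < (1 - r)⁻¹ := inv_pos.2 (by linarith)
          gcongr
      _ = B * M := by rw [hB]; ring
  have hw0 : 0 < w := by
    have h0 : 0 < A (nndist (g 0) (g 0)) := by
      rw [nndist_self, hZ.unit_variance]; exact one_pos
    refine h0.trans_le ((Finset.single_le_sum (f := fun j => A (nndist (g 0) (g j)))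
      (fun j _ => hA _) (Finset.mem_univ 0)).trans ?_)
    exact Finset.single_le_sum (f := fun i => ∑ j, A (nndist (g i) (g j)))
      (fun i _ => Finset.sum_nonneg fun j _ => hA _) (Finset.mem_univ 0)
  -- With covariances at least 1/2, the choice h = 4uw meets the requirement 2uw ≤ Cov · h.
  have hshift := hG.real_le_shift (u := u) (h := 4 * u * w) (L := l * M)
    (by simpa [Fintype.sum_sum_type] using hw0) (by positivity) (by positivity) (fun i => by
      simp only [Fintype.sum_sum_type, Option.elim_none, Option.elim_some, Sum.elim_inl,
        Sum.elim_inr, Pi.zero_apply, Pi.one_apply, zero_mul, mul_zero, one_mul, mul_one, ite_mul,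
        Finset.sum_const_zero, add_zero, zero_add]
      rw [← hw, Finset.sum_comm]
      simp only [Finset.sum_ite_eq', Finset.mem_univ, if_true]
      have h1 : 1 / 2 ≤ ∑ j : Fin J, A (nndist (t i) (g j)) := by
        have h2 : ⌊t i / δ⌋₊ < J := Nat.lt_succ_of_le (Nat.floor_mono (by gcongr; exact ht i))
        refine le_trans (hδA _ ?_) (Finset.single_le_sum (f := fun j => A (nndist (t i) (g j)))
          (fun j _ => hA _) (Finset.mem_univ (⟨_, h2⟩ : Fin J)))
        rw [← NNReal.coe_le_coe, coe_nndist, NNReal.dist_eq]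
        have h3 : ((⌊t i / δ⌋₊ : ℝ≥0) : ℝ) ≤ (t i / δ : ℝ≥0) :=
          NNReal.coe_le_coe.2 (Nat.floor_le zero_le)
        have h4 : ((t i / δ : ℝ≥0) : ℝ) < ((⌊t i / δ⌋₊ + 1 : ℝ≥0) : ℝ) :=
          NNReal.coe_lt_coe.2 (Nat.lt_floor_add_one _)
        simp only [g]
        push_cast at h3 h4 ⊢
        rw [le_div_iff₀ hδ'] at h3
        rw [div_lt_iff₀ hδ'] at h4
        rw [abs_of_nonneg (by linarith)]
        linarith
      nlinarith [mul_pos hu0 hw0])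
  simp only [Fintype.sum_sum_type, Option.elim_none, Option.elim_some, Sum.elim_inl,
    Sum.elim_inr, Pi.zero_apply, Pi.one_apply, zero_mul, one_mul, ite_mul,
    Finset.sum_const_zero, add_zero, zero_add, Finset.sum_ite_eq', Finset.mem_univ, if_true]
    at hshift
  rw [← hw] at hshift
  refine hshift.trans (add_le_add (mul_le_mul_of_nonneg_right (Real.exp_le_exp.2 ?_)
    measureReal_nonneg) (Real.exp_le_exp.2 (neg_le_neg ?_)))
  · have e : (2 * (l * M) * (4 * u * w) + (4 * u * w) ^ 2) / (2 * w) = 4 * u * (l * M) + 8 * u ^ 2 * w := by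
      field_simp; ring
    rw [e]
    have h1 : u ^ 2 * w ≤ u * (B * M) := by
      calc u ^ 2 * w = u * (u * w) := by ring
        _ ≤ u * (1 * (B * M)) := by gcongr
        _ = _ := by ring
    nlinarith [mul_le_mul_of_nonneg_right hu2 (zero_le_one.trans hM')]
  · rw [mul_pow, hl2, le_div_iff₀ (by positivity)]
    nlinarith [mul_le_mul_of_nonneg_left hwB (show 0 ≤ 2 * κ * M by positivity)]

/-! ### Power sums and covariances of weighted sums. -/

section PowerSums

open Finset

/-- For s ≥ 1 each term is bounded by the last one. For s ≤ 1 the bound telescopes, by Bernoulli's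
inequality for (1 - 1/(n+1))^s. -/
theorem exists_sum_rpow_le {s : ℝ} (hs : 0 < s) :
    ∃ C > 0, ∀ n : ℕ, ∑ k ∈ Ioc 0 n, (k : ℝ) ^ (s - 1) ≤ C * (n : ℝ) ^ s := by
  rcases le_total 1 s with h1 | h1
  · refine ⟨1, one_pos, fun n => ?_⟩
    calc ∑ k ∈ Ioc 0 n, (k : ℝ) ^ (s - 1) ≤ ∑ k ∈ Ioc 0 n, (n : ℝ) ^ (s - 1) := by
          refine sum_le_sum fun k hk => Real.rpow_le_rpow k.cast_nonneg ?_ (by linarith)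
          exact_mod_cast (mem_Ioc.1 hk).2
      _ = n * (n : ℝ) ^ (s - 1) := by simp
      _ = 1 * (n : ℝ) ^ s := by
          rcases n.eq_zero_or_pos with rfl | hn
          · simp [Real.zero_rpow hs.ne']
          · have hn' : (0 : ℝ) < n := by exact_mod_cast hn
            rw [Real.rpow_sub_one hn'.ne']
            field_simp
  · refine ⟨s⁻¹, inv_pos.2 hs, fun n => ?_⟩
    induction n with
    | zero => simp [Real.zero_rpow hs.ne']
    | succ n ih =>
      rw [Finset.sum_Ioc_succ_top (Nat.zero_le n)]
      have hn : (0 : ℝ) < (n + 1 : ℕ) := by positivity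
      have h2 : -1 ≤ -((n + 1 : ℕ) : ℝ)⁻¹ :=
        neg_le_neg (inv_le_one_of_one_le₀ (by exact_mod_cast Nat.le_add_left 1 n))
      have h3 := rpow_one_add_le_one_add_mul_self h2 hs.le h1
      have e1 : (n : ℝ) = (n + 1 : ℕ) * (1 + -((n + 1 : ℕ) : ℝ)⁻¹) := by
        field_simp; push_cast; ring
      have h4 : (n : ℝ) ^ s ≤ ((n + 1 : ℕ) : ℝ) ^ s * (1 + s * -((n + 1 : ℕ) : ℝ)⁻¹) := by
        rw [e1, Real.mul_rpow hn.le (by linarith)]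
        gcongr
      rw [Real.rpow_sub_one hn.ne']
      calc ∑ k ∈ Ioc 0 n, (k : ℝ) ^ (s - 1) + ((n + 1 : ℕ) : ℝ) ^ s / (n + 1 : ℕ)
          ≤ s⁻¹ * (((n + 1 : ℕ) : ℝ) ^ s * (1 + s * -((n + 1 : ℕ) : ℝ)⁻¹))
            + ((n + 1 : ℕ) : ℝ) ^ s / (n + 1 : ℕ) := by
            refine add_le_add (ih.trans ?_) le_rfl
            gcongr
        _ = s⁻¹ * ((n + 1 : ℕ) : ℝ) ^ s := by field_simp; ring

/-- On either side of i the map j ↦ 1 + |i - j| is injective into (0, m - l], which reduces each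
half to a plain power sum. -/
theorem exists_sum_dist_rpow_le {e : ℝ} (he : 0 < e) :
    ∃ C > 0, ∀ l m i : ℕ, l < i → i ≤ m →
      ∑ j ∈ Ioc l m, (1 + (Nat.dist i j : ℝ)) ^ (e - 1) ≤ C * ((m - l : ℕ) : ℝ) ^ e := by
  obtain ⟨C, hC, h⟩ := exists_sum_rpow_le he
  refine ⟨2 * C, by positivity, fun l m i hl hm => ?_⟩
  have hterm : ∀ j, (1 + (Nat.dist i j : ℝ)) ^ (e - 1) = ((1 + Nat.dist i j : ℕ) : ℝ) ^ (e - 1) :=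
    fun j => by push_cast; rfl
  have himg : ∀ s : Finset ℕ, s ⊆ Ioc l m → Set.InjOn (fun j => 1 + Nat.dist i j) s →
      ∑ j ∈ s, (1 + (Nat.dist i j : ℝ)) ^ (e - 1) ≤ C * ((m - l : ℕ) : ℝ) ^ e := by
    intro s hs hinj
    refine le_trans ?_ (h (m - l))
    simp only [hterm]
    rw [← sum_image (f := fun k : ℕ => (k : ℝ) ^ (e - 1)) hinj]
    refine sum_le_sum_of_subset_of_nonneg ?_ fun _ _ _ => by positivity
    intro k hk
    obtain ⟨j, hj, rfl⟩ := mem_image.1 hk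
    have := mem_Ioc.1 (hs hj)
    rw [mem_Ioc]
    rcases le_total i j with hij | hij
    · rw [Nat.dist_eq_sub_of_le hij]; omega
    · rw [Nat.dist_eq_sub_of_le_right hij]; omega
  rw [← sum_filter_add_sum_filter_not (Ioc l m) (fun j => j ≤ i), mul_assoc, two_mul]
  refine add_le_add (himg _ (filter_subset _ _) ?_) (himg _ (filter_subset _ _) ?_)
  · intro j hj j' hj' hjj
    simp only [coe_filter, Set.mem_ofPred_eq] at hj hj'
    simp only [Nat.dist_eq_sub_of_le_right hj.2, Nat.dist_eq_sub_of_le_right hj'.2] at hjj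
    omega
  · intro j hj j' hj' hjj
    simp only [coe_filter, Set.mem_ofPred_eq, not_le] at hj hj'
    simp only [Nat.dist_eq_sub_of_le hj.2.le, Nat.dist_eq_sub_of_le hj'.2.le] at hjj
    omega

theorem rpow_le_two_rpow_abs_mul {x y p : ℝ} (hx : 0 < x) (hxy : x ≤ 2 * y) (hyx : y ≤ 2 * x) :
    x ^ p ≤ 2 ^ |p| * y ^ p := by
  have hy : 0 < y := by linarith
  rcases le_total 0 p with hp | hp
  · rw [abs_of_nonneg hp, ← Real.mul_rpow two_pos.le hy.le]
    exact Real.rpow_le_rpow hx.le hxy hp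
  · have h1 : x ^ p ≤ (y / 2) ^ p :=
      Real.rpow_le_rpow_of_nonpos (by positivity) (by linarith) hp
    refine h1.trans (le_of_eq ?_)
    rw [abs_of_nonpos hp, Real.div_rpow hy.le two_pos.le, Real.rpow_neg two_pos.le]
    field_simp

/-- If 2j ≤ i the distance is comparable to i; otherwise j is. In either range one factor can be
frozen at its value for i. -/
theorem exists_sum_rpow_mul_dist_rpow_le {p e : ℝ} (hp : -1 < p) (he : 0 < e) (he1 : e ≤ 1) :
    ∃ C > 0, ∀ i : ℕ, ∑ j ∈ Ioc 0 i, (j : ℝ) ^ p * (1 + (Nat.dist i j : ℝ)) ^ (e - 1)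
      ≤ C * (i : ℝ) ^ (p + e) := by
  obtain ⟨C₁, hC₁, h1⟩ := exists_sum_rpow_le (s := p + 1) (by linarith)
  obtain ⟨C₂, hC₂, h2⟩ := exists_sum_dist_rpow_le he
  refine ⟨2 ^ (1 - e) * C₁ + 2 ^ |p| * C₂, by positivity, fun i => ?_⟩
  rcases i.eq_zero_or_pos with rfl | hi
  · simp only [Ioc_self, sum_empty]; positivity
  have hi' : (0 : ℝ) < i := by exact_mod_cast hi
  have hterm : ∀ j ∈ Ioc 0 i, (j : ℝ) ^ p * (1 + (Nat.dist i j : ℝ)) ^ (e - 1)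
      ≤ 2 ^ (1 - e) * (i : ℝ) ^ (e - 1) * (j : ℝ) ^ (p + 1 - 1)
        + 2 ^ |p| * (i : ℝ) ^ p * (1 + (Nat.dist i j : ℝ)) ^ (e - 1) := by
    intro j hj
    obtain ⟨hj0, hji⟩ := mem_Ioc.1 hj
    have hj' : (0 : ℝ) < j := by exact_mod_cast hj0
    have hji' : (j : ℝ) ≤ i := by exact_mod_cast hji
    rw [add_sub_cancel_right]
    rcases le_or_gt (2 * j) i with h | h
    · have h3 : (1 + (Nat.dist i j : ℝ)) ^ (e - 1) ≤ 2 ^ (1 - e) * (i : ℝ) ^ (e - 1) := by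
        have h4 : (i : ℝ) / 2 ≤ 1 + (Nat.dist i j : ℝ) := by
          rw [Nat.cast_dist_eq_abs, abs_of_nonneg (by linarith)]
          have : (2 : ℝ) * j ≤ i := by exact_mod_cast h
          linarith
        refine (Real.rpow_le_rpow_of_nonpos (by positivity) h4 (by linarith)).trans (le_of_eq ?_)
        rw [Real.div_rpow hi'.le two_pos.le, div_eq_inv_mul, ← Real.rpow_neg two_pos.le, neg_sub]
      have h5 : 0 ≤ 2 ^ |p| * (i : ℝ) ^ p * (1 + (Nat.dist i j : ℝ)) ^ (e - 1) := by positivity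
      nlinarith [mul_le_mul_of_nonneg_left h3 (show 0 ≤ (j : ℝ) ^ p by positivity)]
    · have h3 : (j : ℝ) ^ p ≤ 2 ^ |p| * (i : ℝ) ^ p :=
        rpow_le_two_rpow_abs_mul hj' (by linarith) (by exact_mod_cast h.le)
      have h5 : 0 ≤ 2 ^ (1 - e) * (i : ℝ) ^ (e - 1) * (j : ℝ) ^ p := by positivity
      nlinarith [mul_le_mul_of_nonneg_right h3
        (show 0 ≤ (1 + (Nat.dist i j : ℝ)) ^ (e - 1) by positivity)]
  refine (sum_le_sum hterm).trans ?_
  rw [sum_add_distrib, ← mul_sum, ← mul_sum]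
  have h3 := h2 0 i i hi le_rfl
  rw [Nat.sub_zero] at h3
  calc 2 ^ (1 - e) * (i : ℝ) ^ (e - 1) * ∑ j ∈ Ioc 0 i, (j : ℝ) ^ (p + 1 - 1)
        + 2 ^ |p| * (i : ℝ) ^ p * ∑ j ∈ Ioc 0 i, (1 + (Nat.dist i j : ℝ)) ^ (e - 1)
      ≤ 2 ^ (1 - e) * (i : ℝ) ^ (e - 1) * (C₁ * (i : ℝ) ^ (p + 1))
        + 2 ^ |p| * (i : ℝ) ^ p * (C₂ * (i : ℝ) ^ e) := by
        gcongr
        exact h1 i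
    _ = _ := by
        rw [Real.rpow_add hi', Real.rpow_add hi', Real.rpow_sub hi', Real.rpow_one]
        field_simp

/-- The covariance of `∑ i ∈ s, σ i ξ_i` and `∑ j ∈ t, σ j ξ_j` for correlations `ρ`. -/
def weightedCov (σ ρ : ℕ → ℝ) (s t : Finset ℕ) : ℝ :=
  ∑ i ∈ s, ∑ j ∈ t, σ i * σ j * ρ (Nat.dist i j)

theorem weightedCov_comm (σ ρ : ℕ → ℝ) (s t : Finset ℕ) :
    weightedCov σ ρ s t = weightedCov σ ρ t s := by
  rw [weightedCov, weightedCov, sum_comm]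
  exact sum_congr rfl fun i _ => sum_congr rfl fun j _ => by rw [Nat.dist_comm]; ring

theorem weightedCov_mono {σ ρ : ℕ → ℝ} (hσ : ∀ i, 1 ≤ i → 0 ≤ σ i) (hρ : ∀ i, 0 ≤ ρ i)
    {s s' t t' : Finset ℕ} (hs : s ⊆ s') (ht : t ⊆ t') (hs' : ∀ i ∈ s', 1 ≤ i)
    (ht' : ∀ i ∈ t', 1 ≤ i) : weightedCov σ ρ s t ≤ weightedCov σ ρ s' t' := by
  have h0 : ∀ i ∈ s', ∀ j ∈ t', 0 ≤ σ i * σ j * ρ (Nat.dist i j) := fun i hi j hj =>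
    mul_nonneg (mul_nonneg (hσ i (hs' i hi)) (hσ j (ht' j hj))) (hρ _)
  calc _ ≤ ∑ i ∈ s, ∑ j ∈ t', σ i * σ j * ρ (Nat.dist i j) := sum_le_sum fun i hi =>
        sum_le_sum_of_subset_of_nonneg ht fun j hj _ => h0 i (hs hi) j hj
    _ ≤ _ := sum_le_sum_of_subset_of_nonneg hs fun i hi _ => sum_nonneg fun j hj => h0 i hi j hj

theorem weightedCov_le {σ ρ σ' ρ' : ℕ → ℝ} {A B : ℝ} (hσ : ∀ i, 1 ≤ i → 0 ≤ σ i)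
    (hρ : ∀ i, 0 ≤ ρ i) (hσ' : ∀ i, 1 ≤ i → σ i ≤ A * σ' i) (hρ' : ∀ i, ρ i ≤ B * ρ' i)
    {s t : Finset ℕ} (hs : ∀ i ∈ s, 1 ≤ i) (ht : ∀ i ∈ t, 1 ≤ i) :
    weightedCov σ ρ s t ≤ A ^ 2 * B * weightedCov σ' ρ' s t := by
  rw [weightedCov, weightedCov, mul_sum]
  refine sum_le_sum fun i hi => ?_
  rw [mul_sum]
  refine sum_le_sum fun j hj => ?_
  have h1 := hσ i (hs i hi)
  have h2 := hσ j (ht j hj)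
  calc σ i * σ j * ρ (Nat.dist i j)
      ≤ (A * σ' i) * (A * σ' j) * (B * ρ' (Nat.dist i j)) := by
        have h3 := hσ' i (hs i hi)
        have h4 := hσ' j (ht j hj)
        exact mul_le_mul (mul_le_mul h3 h4 h2 (h1.trans h3)) (hρ' _) (hρ _)
          (mul_nonneg (h1.trans h3) (h2.trans h4))
    _ = _ := by ring

/-- By symmetry only j ≤ i matters. There the inner sum has order i^(p+2H-1), leaving a power sum of
exponent 2(p+H) - 1. -/
theorem exists_weightedCov_rpow_self_le {p H : ℝ} (hH₁ : 1 / 2 < H) (hH₂ : H < 1)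
    (hpH : 0 < p + H) : ∃ C > 0, ∀ l : ℕ,
      weightedCov (fun i => (i : ℝ) ^ p) (fun i => (1 + (i : ℝ)) ^ (2 * H - 2)) (Ioc 0 l) (Ioc 0 l)
        ≤ C * (l : ℝ) ^ (2 * (p + H)) := by
  obtain ⟨C₁, hC₁, h1⟩ := exists_sum_rpow_mul_dist_rpow_le (p := p) (e := 2 * H - 1) (by linarith)
    (by linarith) (by linarith)
  obtain ⟨C₂, hC₂, h2⟩ := exists_sum_rpow_le (s := 2 * (p + H)) (by linarith)
  refine ⟨2 * (C₁ * C₂), by positivity, fun l => ?_⟩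
  set T : ℕ → ℕ → ℝ := fun i j => (i : ℝ) ^ p * (j : ℝ) ^ p * (1 + (Nat.dist i j : ℝ)) ^ (2 * H - 2)
    with hT
  have hT0 : ∀ i j, 0 ≤ T i j := fun i j => by positivity
  have hTs : ∀ i j, T i j = T j i := fun i j => by simp only [hT, Nat.dist_comm i j]; ring
  have hlow : ∑ i ∈ Ioc 0 l, ∑ j ∈ Ioc 0 l, (if j ≤ i then T i j else 0)
      ≤ C₁ * C₂ * (l : ℝ) ^ (2 * (p + H)) := by
    calc _ ≤ ∑ i ∈ Ioc 0 l, C₁ * (i : ℝ) ^ (2 * (p + H) - 1) := by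
          refine sum_le_sum fun i hi => ?_
          obtain ⟨hi0, hil⟩ := mem_Ioc.1 hi
          have hi' : (0 : ℝ) < i := by exact_mod_cast hi0
          rw [← sum_filter]
          have e : (Ioc 0 l).filter (fun j => j ≤ i) = Ioc 0 i := by
            ext j; simp only [mem_filter, mem_Ioc]; omega
          rw [e]
          have e2 : ∑ j ∈ Ioc 0 i, T i j = (i : ℝ) ^ p * ∑ j ∈ Ioc 0 i, (j : ℝ) ^ p *
              (1 + (Nat.dist i j : ℝ)) ^ (2 * H - 1 - 1) := by
            rw [mul_sum]
            refine sum_congr rfl fun j _ => ?_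
            rw [hT, ← mul_assoc, sub_sub]
            norm_num
          rw [e2]
          refine (mul_le_mul_of_nonneg_left (h1 i) (by positivity)).trans (le_of_eq ?_)
          rw [mul_left_comm, ← Real.rpow_add hi']
          congr 2
          ring
      _ ≤ _ := by
          rw [← mul_sum, mul_assoc]
          exact mul_le_mul_of_nonneg_left (h2 l) hC₁.le
  calc _ ≤ ∑ i ∈ Ioc 0 l, ∑ j ∈ Ioc 0 l, ((if j ≤ i then T i j else 0) +
        if i ≤ j then T j i else 0) := by
        refine sum_le_sum fun i _ => sum_le_sum fun j _ => ?_
        change T i j ≤ _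
        rcases le_total j i with h | h
        · rw [if_pos h]
          have : 0 ≤ if i ≤ j then T j i else 0 := by split_ifs <;> simp [hT0]
          linarith
        · rw [if_pos h, hTs i j]
          have : 0 ≤ if j ≤ i then T j i else 0 := by split_ifs <;> simp [hT0]
          linarith
    _ = ∑ i ∈ Ioc 0 l, ∑ j ∈ Ioc 0 l, (if j ≤ i then T i j else 0)
        + ∑ i ∈ Ioc 0 l, ∑ j ∈ Ioc 0 l, (if j ≤ i then T i j else 0) := by
        simp only [sum_add_distrib]
        congr 1
        rw [sum_comm]
    _ ≤ _ := by linarith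

/-- Indices j ≤ 2l fall under the diagonal estimate. For j > 2l the kernel is of order j^(2H-2);
then c ≤ 1 - H allows j^(H-1+c) to be replaced by l^(H-1+c), and c < p + H keeps the remaining sum
over j of order m^(p+H-c). After normalization this becomes the decay (l/m)^c. -/
theorem exists_weightedCov_rpow_le {p H c : ℝ} (hH₁ : 1 / 2 < H) (hH₂ : H < 1) (hpH : 0 < p + H)
    (hc₁ : c ≤ 1 - H) (hc₂ : c < p + H) : ∃ C > 0, ∀ l m : ℕ, 1 ≤ l → l ≤ m →
      weightedCov (fun i => (i : ℝ) ^ p) (fun i => (1 + (i : ℝ)) ^ (2 * H - 2)) (Ioc 0 l) (Ioc 0 m)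
        ≤ C * ((l : ℝ) ^ (p + H + c) * (m : ℝ) ^ (p + H - c)) := by
  obtain ⟨C₀, hC₀, h0⟩ := exists_weightedCov_rpow_self_le hH₁ hH₂ hpH
  obtain ⟨C₁, hC₁, h1⟩ := exists_sum_rpow_le (s := p + 1) (by linarith)
  obtain ⟨C₂, hC₂, h2⟩ := exists_sum_rpow_le (s := p + H - c) (by linarith)
  refine ⟨C₀ * 2 ^ (2 * (p + H)) + 2 ^ (2 - 2 * H) * C₁ * C₂, by positivity, fun l m hl hlm => ?_⟩
  have hl' : (0 : ℝ) < l := by exact_mod_cast hl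
  have hm' : (0 : ℝ) < m := by exact_mod_cast hl.trans hlm
  have hlm' : (l : ℝ) ≤ m := by exact_mod_cast hlm
  set T : ℕ → ℕ → ℝ := fun i j => (i : ℝ) ^ p * (j : ℝ) ^ p * (1 + (Nat.dist i j : ℝ)) ^ (2 * H - 2)
    with hT
  have hT0 : ∀ i j, 0 ≤ T i j := fun i j => by positivity
  have hfar : ∀ i ∈ Ioc 0 l, ∀ j, 2 * l < j → T i j ≤ 2 ^ (2 - 2 * H) * (l : ℝ) ^ (H - 1 + c) *
      ((i : ℝ) ^ (p + 1 - 1) * (j : ℝ) ^ (p + H - c - 1)) := by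
    intro i hi j hj
    obtain ⟨hi0, hil⟩ := mem_Ioc.1 hi
    have hil' : (i : ℝ) ≤ l := by exact_mod_cast hil
    have hj' : (2 : ℝ) * l < j := by exact_mod_cast hj
    have hj0 : (0 : ℝ) < j := by linarith
    have h3 : (1 + (Nat.dist i j : ℝ)) ^ (2 * H - 2) ≤ 2 ^ (2 - 2 * H) * (j : ℝ) ^ (2 * H - 2) := by
      have h4 : (j : ℝ) / 2 ≤ 1 + (Nat.dist i j : ℝ) := by
        rw [Nat.cast_dist_eq_abs, abs_sub_comm, abs_of_nonneg (by linarith)]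
        linarith
      refine (Real.rpow_le_rpow_of_nonpos (by positivity) h4 (by linarith)).trans (le_of_eq ?_)
      rw [Real.div_rpow hj0.le two_pos.le, div_eq_inv_mul, ← Real.rpow_neg two_pos.le, neg_sub]
    have h4 : (j : ℝ) ^ (H - 1 + c) ≤ (l : ℝ) ^ (H - 1 + c) :=
      Real.rpow_le_rpow_of_nonpos hl' (by linarith) (by linarith)
    have e : (j : ℝ) ^ p * (j : ℝ) ^ (2 * H - 2) = (j : ℝ) ^ (p + H - c - 1) * (j : ℝ) ^ (H - 1 + c) := by
      rw [← Real.rpow_add hj0, ← Real.rpow_add hj0]; congr 1; ring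
    rw [add_sub_cancel_right]
    calc T i j ≤ (i : ℝ) ^ p * (j : ℝ) ^ p * (2 ^ (2 - 2 * H) * (j : ℝ) ^ (2 * H - 2)) := by
          simp only [hT]; gcongr
      _ = 2 ^ (2 - 2 * H) * (i : ℝ) ^ p * ((j : ℝ) ^ (p + H - c - 1) * (j : ℝ) ^ (H - 1 + c)) := by
          rw [← e]; ring
      _ ≤ 2 ^ (2 - 2 * H) * (i : ℝ) ^ p * ((j : ℝ) ^ (p + H - c - 1) * (l : ℝ) ^ (H - 1 + c)) := by
          gcongr
      _ = _ := by ring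
  have hnear : ∑ i ∈ Ioc 0 l, ∑ j ∈ (Ioc 0 m).filter (fun j => j ≤ 2 * l), T i j
      ≤ C₀ * 2 ^ (2 * (p + H)) * ((l : ℝ) ^ (p + H + c) * (m : ℝ) ^ (p + H - c)) := by
    calc _ ≤ weightedCov (fun i => (i : ℝ) ^ p) (fun i => (1 + (i : ℝ)) ^ (2 * H - 2))
          (Ioc 0 (2 * l)) (Ioc 0 (2 * l)) := by
          refine weightedCov_mono (σ := fun i => (i : ℝ) ^ p)
            (ρ := fun i => (1 + (i : ℝ)) ^ (2 * H - 2)) (s := Ioc 0 l)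
            (t := (Ioc 0 m).filter fun j => j ≤ 2 * l)
            (fun i _ => by positivity) (fun i => by positivity) ?_ ?_
            (fun i hi => (mem_Ioc.1 hi).1) (fun i hi => (mem_Ioc.1 hi).1)
          · intro i hi; simp only [mem_Ioc] at hi ⊢; omega
          · intro i hi; simp only [mem_filter, mem_Ioc] at hi ⊢; omega
      _ ≤ C₀ * ((2 * l : ℕ) : ℝ) ^ (2 * (p + H)) := h0 _
      _ = C₀ * 2 ^ (2 * (p + H)) * ((l : ℝ) ^ (p + H + c) * (l : ℝ) ^ (p + H - c)) := by
          push_cast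
          rw [Real.mul_rpow two_pos.le hl'.le, ← Real.rpow_add hl', mul_assoc]
          congr 3; ring
      _ ≤ _ := by gcongr
  have hfar' : ∑ i ∈ Ioc 0 l, ∑ j ∈ (Ioc 0 m).filter (fun j => ¬ j ≤ 2 * l), T i j
      ≤ 2 ^ (2 - 2 * H) * C₁ * C₂ * ((l : ℝ) ^ (p + H + c) * (m : ℝ) ^ (p + H - c)) := by
    calc _ ≤ ∑ i ∈ Ioc 0 l, ∑ j ∈ Ioc 0 m, 2 ^ (2 - 2 * H) * (l : ℝ) ^ (H - 1 + c) *
          ((i : ℝ) ^ (p + 1 - 1) * (j : ℝ) ^ (p + H - c - 1)) := by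
          refine sum_le_sum fun i hi => (sum_le_sum fun j hj => hfar i hi j ?_).trans
            (sum_le_sum_of_subset_of_nonneg (filter_subset _ _) fun _ _ _ => by positivity)
          have := (mem_filter.1 hj).2
          omega
      _ = 2 ^ (2 - 2 * H) * (l : ℝ) ^ (H - 1 + c) * ((∑ i ∈ Ioc 0 l, (i : ℝ) ^ (p + 1 - 1)) *
          ∑ j ∈ Ioc 0 m, (j : ℝ) ^ (p + H - c - 1)) := by
          rw [sum_mul_sum, mul_sum]
          exact sum_congr rfl fun i _ => (mul_sum _ _ _).symm
      _ ≤ 2 ^ (2 - 2 * H) * (l : ℝ) ^ (H - 1 + c) * ((C₁ * (l : ℝ) ^ (p + 1)) *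
          (C₂ * (m : ℝ) ^ (p + H - c))) := by
          gcongr
          · exact h1 l
          · exact h2 m
      _ = _ := by
          have e : (l : ℝ) ^ (p + H + c) = (l : ℝ) ^ (H - 1 + c) * (l : ℝ) ^ (p + 1) := by
            rw [← Real.rpow_add hl']; congr 1; ring
          rw [e]; ring
  have hsplit : weightedCov (fun i => (i : ℝ) ^ p) (fun i => (1 + (i : ℝ)) ^ (2 * H - 2))
      (Ioc 0 l) (Ioc 0 m) = ∑ i ∈ Ioc 0 l, ∑ j ∈ (Ioc 0 m).filter (fun j => j ≤ 2 * l), T i j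
        + ∑ i ∈ Ioc 0 l, ∑ j ∈ (Ioc 0 m).filter (fun j => ¬ j ≤ 2 * l), T i j := by
    rw [← sum_add_distrib]
    exact sum_congr rfl fun i _ => (sum_filter_add_sum_filter_not _ _ _).symm
  rw [hsplit]
  linarith

/-- Variance of an increment of weighted sums over indices comparable to `a`. -/
theorem exists_weightedCov_rpow_Ioc_le (p : ℝ) {H : ℝ} (hH₁ : 1 / 2 < H) {R : ℝ} (hR : 1 ≤ R) :
    ∃ C > 0, ∀ (a : ℝ) (l m : ℕ), 0 < a → a ≤ l → (m : ℝ) ≤ R * a →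
      weightedCov (fun i => (i : ℝ) ^ p) (fun i => (1 + (i : ℝ)) ^ (2 * H - 2)) (Ioc l m) (Ioc l m)
        ≤ C * (a ^ (2 * p) * ((m - l : ℕ) : ℝ) ^ (2 * H)) := by
  obtain ⟨C, hC, h⟩ := exists_sum_dist_rpow_le (e := 2 * H - 1) (by linarith)
  set B := max 1 (R ^ p) with hB
  have hB0 : 0 < B := lt_max_of_lt_left one_pos
  refine ⟨B ^ 2 * C, by positivity, fun a l m ha hal hma => ?_⟩
  have hpow : ∀ i ∈ Ioc l m, (i : ℝ) ^ p ≤ B * a ^ p := by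
    intro i hi
    obtain ⟨h1, h2⟩ := mem_Ioc.1 hi
    have h1' : a ≤ i := hal.trans (by exact_mod_cast h1.le)
    have h2' : (i : ℝ) ≤ R * a := le_trans (by exact_mod_cast h2) hma
    have hap : 0 < a ^ p := by positivity
    rcases le_total 0 p with hp | hp
    · calc (i : ℝ) ^ p ≤ (R * a) ^ p := Real.rpow_le_rpow i.cast_nonneg h2' hp
        _ = R ^ p * a ^ p := Real.mul_rpow (by linarith) ha.le
        _ ≤ B * a ^ p := by gcongr; exact le_max_right _ _
    · calc (i : ℝ) ^ p ≤ a ^ p := Real.rpow_le_rpow_of_nonpos ha h1' hp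
        _ = 1 * a ^ p := (one_mul _).symm
        _ ≤ B * a ^ p := by gcongr; exact le_max_left _ _
  calc _ ≤ ∑ i ∈ Ioc l m, ∑ j ∈ Ioc l m, (B * a ^ p) * (B * a ^ p) *
        (1 + (Nat.dist i j : ℝ)) ^ (2 * H - 1 - 1) := by
        refine sum_le_sum fun i hi => sum_le_sum fun j hj => ?_
        have e : 2 * H - 1 - 1 = 2 * H - 2 := by ring
        rw [e]
        exact mul_le_mul_of_nonneg_right (mul_le_mul (hpow i hi) (hpow j hj) (by positivity)
          (by positivity)) (by positivity)
    _ ≤ ∑ i ∈ Ioc l m, (B * a ^ p) * (B * a ^ p) * (C * ((m - l : ℕ) : ℝ) ^ (2 * H - 1)) := by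
        refine sum_le_sum fun i hi => ?_
        obtain ⟨h1, h2⟩ := mem_Ioc.1 hi
        rw [← mul_sum]
        exact mul_le_mul_of_nonneg_left (h l m i h1 h2) (by positivity)
    _ = (m - l : ℕ) * ((B * a ^ p) * (B * a ^ p) * (C * ((m - l : ℕ) : ℝ) ^ (2 * H - 1))) := by
        simp
    _ = B ^ 2 * C * (a ^ (2 * p) * ((m - l : ℕ) : ℝ) ^ (2 * H)) := by
        rcases (m - l).eq_zero_or_pos with h0 | h0
        · rw [h0]; simp [Real.zero_rpow (show 2 * H ≠ 0 by linarith)]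
        · have h0' : (0 : ℝ) < (m - l : ℕ) := by exact_mod_cast h0
          rw [Real.rpow_sub_one h0'.ne', two_mul p, Real.rpow_add ha]
          field_simp

end PowerSums

/-! ### Covariances as integrals of step functions. -/

section StepKernel

open Finset

theorem lintegral_ceil_mul {a : ℝ} (ha : 0 < a) (F : ℕ → ENNReal) (l : ℕ) :
    ∫⁻ u in Set.Ioc 0 (l / a), F ⌈a * u⌉₊ = ∑ i ∈ Ioc 0 l, F i * ENNReal.ofReal a⁻¹ := by
  induction l with
  | zero => simp
  | succ l ih =>
    have h1 : Set.Ioc 0 (((l + 1 : ℕ) : ℝ) / a)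
        = Set.Ioc 0 ((l : ℝ) / a) ∪ Set.Ioc ((l : ℝ) / a) (((l + 1 : ℕ) : ℝ) / a) := by
      rw [Set.Ioc_union_Ioc_eq_Ioc (by positivity)]
      push_cast
      gcongr
      linarith
    rw [h1, lintegral_union measurableSet_Ioc (Set.Ioc_disjoint_Ioc_of_le le_rfl), ih,
      sum_Ioc_succ_top (Nat.zero_le l)]
    congr 1
    rw [setLIntegral_congr_fun (g := fun _ => F (l + 1)) measurableSet_Ioc, lintegral_const,
      Measure.restrict_apply_univ, Real.volume_Ioc]
    · congr 2
      push_cast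
      field_simp
      ring
    · intro u hu
      have h2 := hu.1
      have h3 := hu.2
      rw [div_lt_iff₀ ha] at h2
      rw [le_div_iff₀ ha] at h3
      change F _ = F _
      congr 1
      rw [Nat.ceil_eq_iff (by omega)]
      push_cast at h3 ⊢
      exact ⟨by linarith, by linarith⟩

/-- The indicator discards the incomplete last cell (⌊ax⌋/a, x]. -/
theorem lintegral_ceil_mul_ite {a x : ℝ} (ha : 0 < a) (hx : 0 ≤ x) (F : ℕ → ENNReal) :
    ∫⁻ u in Set.Ioc 0 x, (if ⌈a * u⌉₊ ≤ ⌊a * x⌋₊ then F ⌈a * u⌉₊ else 0)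
      = ∑ i ∈ Ioc 0 ⌊a * x⌋₊, F i * ENNReal.ofReal a⁻¹ := by
  rw [← lintegral_ceil_mul ha]
  have h0 : (⌊a * x⌋₊ : ℝ) ≤ a * x := Nat.floor_le (by positivity)
  have h1 : Set.Ioc 0 x ∩ {u : ℝ | ⌈a * u⌉₊ ≤ ⌊a * x⌋₊} = Set.Ioc 0 ((⌊a * x⌋₊ : ℝ) / a) := by
    ext u
    simp only [Set.mem_inter_iff, Set.mem_Ioc, Set.mem_ofPred_eq, Nat.ceil_le, le_div_iff₀ ha]
    constructor
    · rintro ⟨⟨h2, h3⟩, h4⟩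
      exact ⟨h2, by linarith⟩
    · rintro ⟨h2, h3⟩
      refine ⟨⟨h2, ?_⟩, by linarith⟩
      by_contra! h4
      nlinarith
  have hm : MeasurableSet {u : ℝ | ⌈a * u⌉₊ ≤ ⌊a * x⌋₊} :=
    measurableSet_le (Nat.measurable_ceil.comp (measurable_const_mul a)) measurable_const
  have h2 : (fun u => if ⌈a * u⌉₊ ≤ ⌊a * x⌋₊ then F ⌈a * u⌉₊ else 0)
      = Set.indicator {u : ℝ | ⌈a * u⌉₊ ≤ ⌊a * x⌋₊} (fun u => F ⌈a * u⌉₊) := by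
    ext u
    simp [Set.indicator_apply]
  rw [h2, setLIntegral_indicator hm, Set.inter_comm, h1]

/-- Lebesgue measure on the box `(0,x] × (0,y]`. -/
noncomputable def boxMeasure (x y : ℝ) : Measure (ℝ × ℝ) :=
  (volume.restrict (Set.Ioc 0 x)).prod (volume.restrict (Set.Ioc 0 y))

/-- The step function on `(0,x] × (0,y]` whose integral is the covariance of the weighted sums
up to `⌊ax⌋` and `⌊ay⌋`, divided by `a ^ 2`. -/
noncomputable def stepKernel (σ ρ : ℕ → ℝ) (x y a : ℝ) (z : ℝ × ℝ) : ℝ :=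
  if ⌈a * z.1⌉₊ ≤ ⌊a * x⌋₊ ∧ ⌈a * z.2⌉₊ ≤ ⌊a * y⌋₊ then
    σ ⌈a * z.1⌉₊ * σ ⌈a * z.2⌉₊ * ρ (Nat.dist ⌈a * z.1⌉₊ ⌈a * z.2⌉₊) else 0

variable {σ ρ : ℕ → ℝ} {x y a : ℝ}

theorem measurable_stepKernel : Measurable (stepKernel σ ρ x y a) := by
  have h : Measurable fun z : ℝ × ℝ => (⌈a * z.1⌉₊, ⌈a * z.2⌉₊) :=
    (Nat.measurable_ceil.comp (measurable_fst.const_mul a)).prodMk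
      (Nat.measurable_ceil.comp (measurable_snd.const_mul a))
  exact (Measurable.of_discrete (f := fun m : ℕ × ℕ => if m.1 ≤ ⌊a * x⌋₊ ∧ m.2 ≤ ⌊a * y⌋₊ then
    σ m.1 * σ m.2 * ρ (Nat.dist m.1 m.2) else 0)).comp h

theorem stepKernel_nonneg (hσ : ∀ i, 0 ≤ σ i) (hρ : ∀ i, 0 ≤ ρ i) (z : ℝ × ℝ) :
    0 ≤ stepKernel σ ρ x y a z := by
  unfold stepKernel
  split_ifs
  · exact mul_nonneg (mul_nonneg (hσ _) (hσ _)) (hρ _)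
  · exact le_rfl

theorem lintegral_stepKernel (hσ : ∀ i, 0 ≤ σ i) (hρ : ∀ i, 0 ≤ ρ i) (hx : 0 ≤ x) (hy : 0 ≤ y)
    (ha : 0 < a) : ∫⁻ z, ENNReal.ofReal (stepKernel σ ρ x y a z) ∂boxMeasure x y
      = ENNReal.ofReal (weightedCov σ ρ (Ioc 0 ⌊a * x⌋₊) (Ioc 0 ⌊a * y⌋₊) / a ^ 2) := by
  rw [boxMeasure, lintegral_prod _ measurable_stepKernel.ennreal_ofReal.aemeasurable]
  have h1 : ∀ u v : ℝ, ENNReal.ofReal (stepKernel σ ρ x y a (u, v)) = if ⌈a * u⌉₊ ≤ ⌊a * x⌋₊ then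
      (if ⌈a * v⌉₊ ≤ ⌊a * y⌋₊ then
        ENNReal.ofReal (σ ⌈a * u⌉₊ * σ ⌈a * v⌉₊ * ρ (Nat.dist ⌈a * u⌉₊ ⌈a * v⌉₊)) else 0) else 0 := by
    intro u v
    simp only [stepKernel, ite_and]
    split_ifs <;> simp
  have h2 : ∀ u : ℝ, ∫⁻ v in Set.Ioc 0 y, ENNReal.ofReal (stepKernel σ ρ x y a (u, v))
      = if ⌈a * u⌉₊ ≤ ⌊a * x⌋₊ then ∑ j ∈ Ioc 0 ⌊a * y⌋₊,
        ENNReal.ofReal (σ ⌈a * u⌉₊ * σ j * ρ (Nat.dist ⌈a * u⌉₊ j)) * ENNReal.ofReal a⁻¹ else 0 := by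
    intro u
    simp only [h1]
    split_ifs with h
    · exact lintegral_ceil_mul_ite ha hy
        (fun j => ENNReal.ofReal (σ ⌈a * u⌉₊ * σ j * ρ (Nat.dist ⌈a * u⌉₊ j)))
    · simp
  simp only [h2]
  rw [lintegral_ceil_mul_ite ha hx (fun i => ∑ j ∈ Ioc 0 ⌊a * y⌋₊,
        ENNReal.ofReal (σ i * σ j * ρ (Nat.dist i j)) * ENNReal.ofReal a⁻¹), weightedCov,
    Finset.sum_div, ENNReal.ofReal_sum_of_nonneg]
  · refine sum_congr rfl fun i _ => ?_
    rw [Finset.sum_div, ENNReal.ofReal_sum_of_nonneg, Finset.sum_mul]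
    · refine sum_congr rfl fun j _ => ?_
      rw [mul_assoc, ← ENNReal.ofReal_mul (by positivity), ← ENNReal.ofReal_mul
        (mul_nonneg (mul_nonneg (hσ _) (hσ _)) (hρ _))]
      congr 1
      field_simp
    · exact fun j _ => div_nonneg (mul_nonneg (mul_nonneg (hσ _) (hσ _)) (hρ _)) (by positivity)
  · exact fun i _ => div_nonneg (sum_nonneg fun j _ =>
      mul_nonneg (mul_nonneg (hσ _) (hσ _)) (hρ _)) (by positivity)

theorem weightedCov_nonneg (hσ : ∀ i, 0 ≤ σ i) (hρ : ∀ i, 0 ≤ ρ i) (s t : Finset ℕ) :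
    0 ≤ weightedCov σ ρ s t :=
  sum_nonneg fun _ _ => sum_nonneg fun _ _ => mul_nonneg (mul_nonneg (hσ _) (hσ _)) (hρ _)

theorem integral_stepKernel (hσ : ∀ i, 0 ≤ σ i) (hρ : ∀ i, 0 ≤ ρ i) (hx : 0 ≤ x) (hy : 0 ≤ y)
    (ha : 0 < a) : ∫ z, stepKernel σ ρ x y a z ∂boxMeasure x y
      = weightedCov σ ρ (Ioc 0 ⌊a * x⌋₊) (Ioc 0 ⌊a * y⌋₊) / a ^ 2 := by
  rw [integral_eq_lintegral_of_nonneg_ae (.of_forall (stepKernel_nonneg hσ hρ))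
    measurable_stepKernel.aestronglyMeasurable, lintegral_stepKernel hσ hρ hx hy ha,
    ENNReal.toReal_ofReal (div_nonneg (weightedCov_nonneg hσ hρ _ _) (by positivity))]

theorem tendsto_ceil_mul_div {u : ℝ} (hu : 0 ≤ u) :
    Tendsto (fun a : ℝ => (⌈a * u⌉₊ : ℝ) / a) atTop (𝓝 u) := by
  refine (tendsto_nat_ceil_mul_div_atTop hu).congr fun a => ?_
  rw [mul_comm]

/-- Pointwise scaling limit of the step functions. -/
theorem tendsto_stepKernel {p e κ u v : ℝ} (hu : 0 < u) (hv : 0 < v) (hux : u < x) (hvy : v < y)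
    (huv : u ≠ v) (hσ : Tendsto (fun i : ℕ => σ i / (i : ℝ) ^ p) atTop (𝓝 1))
    (hρ : Tendsto (fun i : ℕ => ρ i / (i : ℝ) ^ e) atTop (𝓝 κ)) :
    Tendsto (fun a => stepKernel σ ρ x y a (u, v) / a ^ (2 * p + e)) atTop
      (𝓝 (κ * (u ^ p * v ^ p * |u - v| ^ e))) := by
  have hlt : ∀ {w z : ℝ}, 0 < w → w < z → ∀ᶠ a : ℝ in atTop, ⌈a * w⌉₊ ≤ ⌊a * z⌋₊ := by
    intro w z hw hwz
    filter_upwards [(tendsto_id.atTop_mul_const (sub_pos.2 hwz)).eventually_ge_atTop 1,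
      eventually_gt_atTop 0] with a h1 h2
    simp only [id] at h1
    refine Nat.le_floor ?_
    have := Nat.ceil_lt_add_one (show 0 ≤ a * w by positivity)
    nlinarith
  have hceil : ∀ {w : ℝ}, 0 < w → Tendsto (fun a : ℝ => ⌈a * w⌉₊) atTop atTop := fun hw =>
    tendsto_nat_ceil_atTop.comp (tendsto_id.atTop_mul_const hw)
  have hpow : ∀ {w : ℝ}, 0 < w →
      Tendsto (fun a : ℝ => σ ⌈a * w⌉₊ / a ^ p) atTop (𝓝 (w ^ p)) := by
    intro w hw
    have h1 := (hσ.comp (hceil hw)).mul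
      ((tendsto_ceil_mul_div hw.le).rpow_const (p := p) (Or.inl hw.ne'))
    rw [one_mul] at h1
    refine h1.congr' ?_
    filter_upwards [eventually_gt_atTop 0] with a ha
    have h2 : (0 : ℝ) < ⌈a * w⌉₊ := by
      have : 0 < a * w := by positivity
      exact this.trans_le (Nat.le_ceil _)
    simp only [Function.comp_apply]
    rw [Real.div_rpow h2.le ha.le]
    have := Real.rpow_pos_of_pos h2 p
    field_simp
  have hd : Tendsto (fun a : ℝ => (Nat.dist ⌈a * u⌉₊ ⌈a * v⌉₊ : ℝ) / a) atTop (𝓝 |u - v|) := by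
    refine ((tendsto_ceil_mul_div hu.le).sub (tendsto_ceil_mul_div hv.le)).abs.congr' ?_
    filter_upwards [eventually_gt_atTop 0] with a ha
    rw [Nat.cast_dist_eq_abs, ← sub_div, abs_div, abs_of_pos ha]
  have hd0 : 0 < |u - v| := abs_pos.2 (sub_ne_zero.2 huv)
  have hdt : Tendsto (fun a : ℝ => Nat.dist ⌈a * u⌉₊ ⌈a * v⌉₊) atTop atTop := by
    rw [← tendsto_natCast_atTop_iff (R := ℝ)]
    refine (hd.pos_mul_atTop hd0 tendsto_id).congr' ?_
    filter_upwards [eventually_gt_atTop 0] with a ha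
    simp only [id]
    field_simp
  have hrho : Tendsto (fun a : ℝ => ρ (Nat.dist ⌈a * u⌉₊ ⌈a * v⌉₊) / a ^ e) atTop
      (𝓝 (κ * |u - v| ^ e)) := by
    refine ((hρ.comp hdt).mul (hd.rpow_const (p := e) (Or.inl hd0.ne'))).congr' ?_
    filter_upwards [eventually_gt_atTop 0, hdt.eventually_gt_atTop 0] with a ha ha'
    have h2 : (0 : ℝ) < Nat.dist ⌈a * u⌉₊ ⌈a * v⌉₊ := by exact_mod_cast ha'
    simp only [Function.comp_apply]
    rw [Real.div_rpow h2.le ha.le]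
    have := Real.rpow_pos_of_pos h2 e
    field_simp
  have h := ((hpow hu).mul (hpow hv)).mul hrho
  rw [show u ^ p * v ^ p * (κ * |u - v| ^ e) = κ * (u ^ p * v ^ p * |u - v| ^ e) by ring] at h
  refine h.congr' ?_
  filter_upwards [hlt hu hux, hlt hv hvy, eventually_gt_atTop 0] with a h1 h2 ha
  rw [stepKernel, if_pos ⟨h1, h2⟩, two_mul, Real.rpow_add ha, Real.rpow_add ha]
  field_simp

/-- Almost every point of the box is an interior point off the diagonal. -/
theorem ae_boxMeasure (x y : ℝ) :
    ∀ᵐ z ∂boxMeasure x y, (0 < z.1 ∧ z.1 < x) ∧ (0 < z.2 ∧ z.2 < y) ∧ z.1 ≠ z.2 := by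
  have h1 : ∀ w : ℝ, ∀ᵐ u ∂(volume.restrict (Set.Ioc 0 w)), 0 < u ∧ u < w := by
    intro w
    filter_upwards [ae_restrict_mem measurableSet_Ioc,
      ae_restrict_of_ae (Measure.ae_ne volume w)] with u hu hw
    exact ⟨hu.1, lt_of_le_of_ne hu.2 hw⟩
  have h2 : ∀ᵐ z ∂boxMeasure x y, z.1 ≠ z.2 := by
    have hm : MeasurableSet {z : ℝ × ℝ | z.1 ≠ z.2} :=
      (measurableSet_eq_fun measurable_fst measurable_snd).compl
    rw [boxMeasure, Measure.ae_prod_iff_ae_ae hm]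
    refine .of_forall fun u => ae_restrict_of_ae ?_
    filter_upwards [Measure.ae_ne volume u] with v hv
    exact fun h => hv h.symm
  have h3 := Measure.quasiMeasurePreserving_fst
    (μ := volume.restrict (Set.Ioc (0 : ℝ) x)) (ν := volume.restrict (Set.Ioc (0 : ℝ) y))
  have h4 := Measure.quasiMeasurePreserving_snd
    (μ := volume.restrict (Set.Ioc (0 : ℝ) x)) (ν := volume.restrict (Set.Ioc (0 : ℝ) y))
  filter_upwards [h3.ae (h1 x), h4.ae (h1 y), h2] with z a b c
  exact ⟨a, b, c⟩

end StepKernel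

/-! ### Scaling limit of the covariances. -/

section ScalingLimit

open Finset

variable {σ ρ : ℕ → ℝ} {p H : ℝ}

theorem exists_le_mul_rpow {s : ℕ → ℝ} {p L : ℝ}
    (h : Tendsto (fun i : ℕ => s i / (i : ℝ) ^ p) atTop (𝓝 L)) :
    ∃ A > 0, ∀ i : ℕ, 1 ≤ i → s i ≤ A * (i : ℝ) ^ p := by
  obtain ⟨A, hA⟩ := h.bddAbove_range
  refine ⟨max A 1, lt_max_of_lt_right one_pos, fun i hi => ?_⟩
  have hi' : (0 : ℝ) < i := by exact_mod_cast hi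
  have h1 : s i / (i : ℝ) ^ p ≤ A := hA ⟨i, rfl⟩
  rw [div_le_iff₀ (by positivity)] at h1
  refine h1.trans ?_
  gcongr
  exact le_max_left _ _

theorem exists_le_mul_one_add_rpow {s : ℕ → ℝ} {e L : ℝ} (he : e ≤ 0)
    (h : Tendsto (fun i : ℕ => s i / (i : ℝ) ^ e) atTop (𝓝 L)) :
    ∃ A > 0, ∀ i : ℕ, s i ≤ A * (1 + (i : ℝ)) ^ e := by
  obtain ⟨A, hA, h1⟩ := exists_le_mul_rpow h
  refine ⟨|s 0| + A * 2 ^ (-e), by positivity, fun i => ?_⟩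
  rcases i.eq_zero_or_pos with rfl | hi
  · have h2 : 0 ≤ A * (2 : ℝ) ^ (-e) := by positivity
    simp only [Nat.cast_zero, add_zero, Real.one_rpow, mul_one]
    linarith [le_abs_self (s 0)]
  · have hi' : (1 : ℝ) ≤ i := by exact_mod_cast hi
    have h2 : (i : ℝ) ^ e ≤ 2 ^ (-e) * (1 + (i : ℝ)) ^ e := by
      refine (Real.rpow_le_rpow_of_nonpos (x := (1 + (i : ℝ)) / 2) (by positivity) (by linarith)
        he).trans (le_of_eq ?_)
      rw [Real.div_rpow (by positivity) two_pos.le, div_eq_inv_mul, ← Real.rpow_neg two_pos.le]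
    have h3 : 0 ≤ |s 0| * (1 + (i : ℝ)) ^ e := by positivity
    nlinarith [h1 i hi, mul_le_mul_of_nonneg_left h2 hA.le]

/-- The kernel of `fpH`. -/
noncomputable def powerKernel (p H : ℝ) (z : ℝ × ℝ) : ℝ :=
  z.1 ^ p * z.2 ^ p * |z.1 - z.2| ^ (2 * H - 2)

theorem measurable_powerKernel : Measurable (powerKernel p H) := by
  unfold powerKernel; fun_prop

theorem tendsto_rpow_div_rpow_self (p : ℝ) :
    Tendsto (fun i : ℕ => (i : ℝ) ^ p / (i : ℝ) ^ p) atTop (𝓝 1) := by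
  refine tendsto_const_nhds.congr' ?_
  filter_upwards [eventually_gt_atTop 0] with i hi
  have hi' : (0 : ℝ) < i := by exact_mod_cast hi
  rw [div_self (by positivity)]

theorem tendsto_one_add_rpow_div_rpow (e : ℝ) :
    Tendsto (fun i : ℕ => (1 + (i : ℝ)) ^ e / (i : ℝ) ^ e) atTop (𝓝 1) := by
  have h1 : Tendsto (fun i : ℕ => (1 + 1 / (i : ℝ))) atTop (𝓝 (1 + 0)) :=
    tendsto_const_nhds.add tendsto_one_div_atTop_nhds_zero_nat
  rw [add_zero] at h1
  have h2 := h1.rpow_const (p := e) (Or.inl one_ne_zero)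
  rw [Real.one_rpow] at h2
  refine h2.congr' ?_
  filter_upwards [eventually_gt_atTop 0] with i hi
  have hi' : (0 : ℝ) < i := by exact_mod_cast hi
  rw [← Real.div_rpow (by positivity) hi'.le]
  congr 1
  field_simp
  ring

/-- Fatou's lemma along the rescaled step functions of the model weights, whose integrals are
bounded by the discrete diagonal estimate. -/
theorem integrable_powerKernel (hH₁ : 1 / 2 < H) (hH₂ : H < 1) (hpH : 0 < p + H) {x y : ℝ}
    (hx : 0 ≤ x) (hy : 0 ≤ y) : Integrable (powerKernel p H) (boxMeasure x y) := by
  obtain ⟨C, hC, hCb⟩ := exists_weightedCov_rpow_self_le hH₁ hH₂ hpH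
  set M := max x y with hM
  have hM0 : 0 ≤ M := hx.trans (le_max_left _ _)
  let σ : ℕ → ℝ := fun i => (i : ℝ) ^ p
  let ρ : ℕ → ℝ := fun i => (1 + (i : ℝ)) ^ (2 * H - 2)
  have hσ0 : ∀ i, 0 ≤ σ i := fun i => by positivity
  have hρ0 : ∀ i, 0 ≤ ρ i := fun i => by positivity
  let g : ℕ → ℝ × ℝ → ENNReal := fun n z =>
    ENNReal.ofReal (stepKernel σ ρ x y (n + 1) z) * ENNReal.ofReal ((((n : ℝ) + 1) ^ (2 * p + (2 * H - 2)))⁻¹)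
  have hgint : ∀ n, ∫⁻ z, g n z ∂boxMeasure x y ≤ ENNReal.ofReal (C * M ^ (2 * (p + H))) := by
    intro n
    have hn : (0 : ℝ) < n + 1 := by positivity
    rw [lintegral_mul_const _ measurable_stepKernel.ennreal_ofReal,
      lintegral_stepKernel hσ0 hρ0 hx hy hn, ← ENNReal.ofReal_mul
      (div_nonneg (weightedCov_nonneg hσ0 hρ0 _ _) (by positivity))]
    refine ENNReal.ofReal_le_ofReal ?_
    have h1 : weightedCov σ ρ (Ioc 0 ⌊((n : ℝ) + 1) * x⌋₊) (Ioc 0 ⌊((n : ℝ) + 1) * y⌋₊)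
        ≤ C * ((((n : ℝ) + 1)) ^ (2 * (p + H)) * M ^ (2 * (p + H))) := by
      refine (weightedCov_mono (fun i _ => hσ0 i) hρ0
        (Finset.Ioc_subset_Ioc_right (Nat.floor_mono (mul_le_mul_of_nonneg_left (le_max_left x y)
          hn.le)))
        (Finset.Ioc_subset_Ioc_right (Nat.floor_mono (mul_le_mul_of_nonneg_left (le_max_right x y)
          hn.le))) (fun i hi => (mem_Ioc.1 hi).1)
        (fun i hi => (mem_Ioc.1 hi).1)).trans ((hCb _).trans ?_)
      rw [← Real.mul_rpow hn.le hM0]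
      have : (⌊((n : ℝ) + 1) * max x y⌋₊ : ℝ) ≤ ((n : ℝ) + 1) * M := Nat.floor_le (by positivity)
      gcongr
    have e : (((n : ℝ) + 1)) ^ (2 * (p + H))
        = ((n : ℝ) + 1) ^ 2 * ((n : ℝ) + 1) ^ (2 * p + (2 * H - 2)) := by
      rw [← Real.rpow_natCast, ← Real.rpow_add hn]; congr 1; push_cast; ring
    rw [e] at h1
    have h2 : 0 < ((n : ℝ) + 1) ^ (2 * p + (2 * H - 2)) := by positivity
    rw [div_mul_eq_mul_div, div_le_iff₀ (by positivity), ← div_eq_mul_inv, div_le_iff₀ h2]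
    linarith
  have hfin : ∫⁻ z, ENNReal.ofReal (powerKernel p H z) ∂boxMeasure x y
      ≤ ENNReal.ofReal (C * M ^ (2 * (p + H))) := by
    have hlim : ∀ᵐ z ∂boxMeasure x y,
        ENNReal.ofReal (powerKernel p H z) = liminf (fun n => g n z) atTop := by
      filter_upwards [ae_boxMeasure x y] with z ⟨h1, h2, h3⟩
      have h4 := tendsto_stepKernel (x := x) (y := y) (κ := 1) (e := 2 * H - 2) h1.1 h2.1 h1.2 h2.2
        h3 (tendsto_rpow_div_rpow_self p) (tendsto_one_add_rpow_div_rpow (2 * H - 2))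
      rw [one_mul] at h4
      have h5 : Tendsto (fun n : ℕ => (n : ℝ) + 1) atTop atTop :=
        tendsto_atTop_add_const_right _ _ tendsto_natCast_atTop_atTop
      refine Tendsto.liminf_eq ?_ |>.symm
      refine (ENNReal.tendsto_ofReal (h4.comp h5)).congr fun n => ?_
      simp only [Function.comp_apply, g]
      rw [div_eq_mul_inv, ENNReal.ofReal_mul (stepKernel_nonneg hσ0 hρ0 _)]
    rw [lintegral_congr_ae hlim]
    refine (lintegral_liminf_le fun n =>
      measurable_stepKernel.ennreal_ofReal.mul_const _).trans ?_
    exact (liminf_le_liminf (.of_forall hgint)).trans (by rw [liminf_const])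
  refine ⟨measurable_powerKernel.aestronglyMeasurable, ?_⟩
  rw [hasFiniteIntegral_iff_ofReal]
  · exact hfin.trans_lt ENNReal.ofReal_lt_top
  · filter_upwards [ae_boxMeasure x y] with z ⟨h1, h2, h3⟩
    have := h1.1
    have := h2.1
    simp only [powerKernel, Pi.zero_apply]
    positivity

theorem integral_powerKernel (hH₁ : 1 / 2 < H) (hH₂ : H < 1) (hpH : 0 < p + H) {x y : ℝ}
    (hx : 0 ≤ x) (hy : 0 ≤ y) : ∫ z, powerKernel p H z ∂boxMeasure x y = fpH p H x y := by
  have h := integrable_powerKernel (p := p) hH₁ hH₂ hpH hx hy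
  rw [boxMeasure] at h ⊢
  rw [integral_prod _ h, fpH, intervalIntegral.integral_of_le hx]
  refine integral_congr_ae (.of_forall fun u => ?_)
  simp only
  rw [intervalIntegral.integral_of_le hy]
  rfl

/-- For p ≥ 0 the right endpoint x controls the power; for p ≤ 0 the point u itself does. The
exponent `min p 0` treats both signs together. -/
theorem ceil_rpow_le {a u x : ℝ} (ha : 0 < a) (hu : 0 < u) (h : ⌈a * u⌉₊ ≤ ⌊a * x⌋₊) (hx : 0 < x) :
    (⌈a * u⌉₊ : ℝ) ^ p ≤ a ^ p * ((1 + x ^ p) * u ^ min p 0) := by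
  have h1 : a * u ≤ ⌈a * u⌉₊ := Nat.le_ceil _
  have h2 : (⌈a * u⌉₊ : ℝ) ≤ a * x :=
    le_trans (by exact_mod_cast h) (Nat.floor_le (by positivity))
  have hxp : 0 < x ^ p := by positivity
  rcases le_total 0 p with hp | hp
  · rw [min_eq_right hp, Real.rpow_zero, mul_one]
    calc (⌈a * u⌉₊ : ℝ) ^ p ≤ (a * x) ^ p := Real.rpow_le_rpow (Nat.cast_nonneg _) h2 hp
      _ = a ^ p * x ^ p := Real.mul_rpow ha.le hx.le
      _ ≤ _ := by gcongr; linarith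
  · rw [min_eq_left hp]
    calc (⌈a * u⌉₊ : ℝ) ^ p ≤ (a * u) ^ p := Real.rpow_le_rpow_of_nonpos (by positivity) h1 hp
      _ = a ^ p * (1 * u ^ p) := by rw [one_mul, Real.mul_rpow ha.le hu.le]
      _ ≤ _ := by gcongr; linarith

/-- Rounding up does not spoil the singularity, since 1 + |⌈au⌉ - ⌈av⌉| ≥ a|u - v|. The result is
the dominating function for the scaling limit. -/
theorem stepKernel_le {A B : ℝ} (hσ0 : ∀ i, 0 ≤ σ i) (hρ0 : ∀ i, 0 ≤ ρ i) (hA : 0 < A)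
    (hB : 0 < B) (hσA : ∀ i : ℕ, 1 ≤ i → σ i ≤ A * (i : ℝ) ^ p)
    (hρB : ∀ i : ℕ, ρ i ≤ B * (1 + (i : ℝ)) ^ (2 * H - 2)) (hH₂ : H < 1) {x y a : ℝ} (ha : 0 < a)
    {z : ℝ × ℝ} (h1 : 0 < z.1 ∧ z.1 < x) (h2 : 0 < z.2 ∧ z.2 < y) (h3 : z.1 ≠ z.2) :
    stepKernel σ ρ x y a z / a ^ (2 * p + (2 * H - 2))
      ≤ A ^ 2 * B * (1 + x ^ p) * (1 + y ^ p) * powerKernel (min p 0) H z := by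
  obtain ⟨u, v⟩ := z
  obtain ⟨hu, hux⟩ := h1
  obtain ⟨hv, hvy⟩ := h2
  simp only at hu hv hux hvy h3
  have hx : 0 < x := hu.trans hux
  have hy : 0 < y := hv.trans hvy
  have hd0 : 0 < |u - v| := abs_pos.2 (sub_ne_zero.2 h3)
  rw [div_le_iff₀ (by positivity), stepKernel]
  simp only
  split_ifs with h
  · have hi : 1 ≤ ⌈a * u⌉₊ := Nat.ceil_pos.2 (by positivity)
    have hj : 1 ≤ ⌈a * v⌉₊ := Nat.ceil_pos.2 (by positivity)
    have e1 := (hσA _ hi).trans (mul_le_mul_of_nonneg_left (ceil_rpow_le (p := p) ha hu h.1 hx) hA.le)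
    have e2 := (hσA _ hj).trans (mul_le_mul_of_nonneg_left (ceil_rpow_le (p := p) ha hv h.2 hy) hA.le)
    have e3 : ρ (Nat.dist ⌈a * u⌉₊ ⌈a * v⌉₊) ≤ B * (a ^ (2 * H - 2) * |u - v| ^ (2 * H - 2)) := by
      refine (hρB _).trans (mul_le_mul_of_nonneg_left ?_ hB.le)
      rw [← Real.mul_rpow ha.le hd0.le]
      refine Real.rpow_le_rpow_of_nonpos (by positivity) ?_ (by linarith)
      rw [Nat.cast_dist_eq_abs]
      have c1 := Nat.le_ceil (a * u)
      have c2 := Nat.le_ceil (a * v)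
      have c3 := Nat.ceil_lt_add_one (show 0 ≤ a * u by positivity)
      have c4 := Nat.ceil_lt_add_one (show 0 ≤ a * v by positivity)
      rw [show a * |u - v| = |a * u - a * v| by rw [← mul_sub, abs_mul, abs_of_pos ha]]
      rcases abs_cases (a * u - a * v) with ⟨h4, _⟩ | ⟨h4, _⟩ <;> rw [h4]
      · linarith [le_abs_self ((⌈a * u⌉₊ : ℝ) - ⌈a * v⌉₊)]
      · linarith [neg_le_abs ((⌈a * u⌉₊ : ℝ) - ⌈a * v⌉₊)]
    calc σ ⌈a * u⌉₊ * σ ⌈a * v⌉₊ * ρ (Nat.dist ⌈a * u⌉₊ ⌈a * v⌉₊)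
        ≤ (A * (a ^ p * ((1 + x ^ p) * u ^ min p 0))) * (A * (a ^ p * ((1 + y ^ p) * v ^ min p 0))) *
          (B * (a ^ (2 * H - 2) * |u - v| ^ (2 * H - 2))) :=
          mul_le_mul (mul_le_mul e1 e2 (hσ0 _) ((hσ0 _).trans e1)) e3 (hρ0 _)
            (mul_nonneg ((hσ0 _).trans e1) ((hσ0 _).trans e2))
      _ = _ := by
          simp only [powerKernel]
          rw [two_mul p, Real.rpow_add ha, Real.rpow_add ha]
          ring
  · simp only [powerKernel]
    positivity

/-- The covariances of weighted sums converge, after scaling, to `κ f_{p,H}`. -/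
theorem tendsto_weightedCov {κ : ℝ} (hH₁ : 1 / 2 < H) (hH₂ : H < 1) (hpH : 0 < p + H)
    (hσ0 : ∀ i, 0 ≤ σ i) (hρ0 : ∀ i, 0 ≤ ρ i)
    (hσ : Tendsto (fun i : ℕ => σ i / (i : ℝ) ^ p) atTop (𝓝 1))
    (hρ : Tendsto (fun i : ℕ => ρ i / (i : ℝ) ^ (2 * H - 2)) atTop (𝓝 κ)) {x y : ℝ}
    (hx : 0 ≤ x) (hy : 0 ≤ y) :
    Tendsto (fun a : ℝ => weightedCov σ ρ (Ioc 0 ⌊a * x⌋₊) (Ioc 0 ⌊a * y⌋₊) / a ^ (2 * (p + H)))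
      atTop (𝓝 (κ * fpH p H x y)) := by
  obtain ⟨A, hA, hσA⟩ := exists_le_mul_rpow hσ
  obtain ⟨B, hB, hρB⟩ := exists_le_mul_one_add_rpow (by linarith) hρ
  -- The dominating kernel has exponent min(p, 0), still admissible for integrability.
  have hq : 0 < min p 0 + H := by
    rcases min_choice p 0 with h | h <;> rw [h] <;> linarith
  have hlim : Tendsto (fun a : ℝ => ∫ z, stepKernel σ ρ x y a z / a ^ (2 * p + (2 * H - 2))
      ∂boxMeasure x y) atTop (𝓝 (∫ z, κ * powerKernel p H z ∂boxMeasure x y)) := by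
    refine tendsto_integral_filter_of_dominated_convergence
      (fun z => A ^ 2 * B * (1 + x ^ p) * (1 + y ^ p) * powerKernel (min p 0) H z)
      (.of_forall fun a => (measurable_stepKernel.div_const _).aestronglyMeasurable) ?_
      ((integrable_powerKernel hH₁ hH₂ hq hx hy).const_mul _) ?_
    · filter_upwards [eventually_gt_atTop 0] with a ha
      filter_upwards [ae_boxMeasure x y] with z ⟨h1, h2, h3⟩
      rw [Real.norm_of_nonneg (div_nonneg (stepKernel_nonneg hσ0 hρ0 z) (by positivity))]
      exact stepKernel_le hσ0 hρ0 hA hB hσA hρB hH₂ ha h1 h2 h3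
    · filter_upwards [ae_boxMeasure x y] with z ⟨h1, h2, h3⟩
      exact tendsto_stepKernel h1.1 h2.1 h1.2 h2.2 h3 hσ hρ
  rw [integral_const_mul, integral_powerKernel hH₁ hH₂ hpH hx hy] at hlim
  refine hlim.congr' ?_
  filter_upwards [eventually_gt_atTop 0] with a ha
  rw [integral_div, integral_stepKernel hσ0 hρ0 hx hy ha, div_div]
  congr 1
  rw [← Real.rpow_natCast, ← Real.rpow_add ha]
  congr 1
  push_cast
  ring

end ScalingLimit

/-! ### Regular weights and the self-similar kernel. -/

/-- Weights `σ(i) ~ i ^ p` and non-negative correlations `ρ(i) ~ κ i ^ (2H - 2)`. -/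
structure RegularWeights (p H κ : ℝ) (σ ρ : ℕ → ℝ) : Prop where
  half_lt : 1 / 2 < H
  lt_one : H < 1
  add_pos : 0 < p + H
  kappa_pos : 0 < κ
  sigma_nonneg : ∀ i, 0 ≤ σ i
  sigma_pos : ∀ i, 1 ≤ i → 0 < σ i
  rho_nonneg : ∀ i, 0 ≤ ρ i
  rho_zero : ρ 0 = 1
  sigma_lim : Tendsto (fun i : ℕ => σ i / (i : ℝ) ^ p) atTop (𝓝 1)
  rho_lim : Tendsto (fun i : ℕ => ρ i / (i : ℝ) ^ (2 * H - 2)) atTop (𝓝 κ)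

theorem regularWeights_rpow {p H : ℝ} (hH₁ : 1 / 2 < H) (hH₂ : H < 1) (hpH : 0 < p + H) :
    RegularWeights p H 1 (fun i => (i : ℝ) ^ p) (fun i => (1 + (i : ℝ)) ^ (2 * H - 2)) where
  half_lt := hH₁
  lt_one := hH₂
  add_pos := hpH
  kappa_pos := one_pos
  sigma_nonneg i := by positivity
  sigma_pos i hi := by
    have : (0 : ℝ) < i := by exact_mod_cast hi
    positivity
  rho_nonneg i := by positivity
  rho_zero := by simp
  sigma_lim := tendsto_rpow_div_rpow_self p
  rho_lim := tendsto_one_add_rpow_div_rpow _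

/-- The covariance of the weighted sums up to `l` and up to `m`. -/
def sumCov (σ ρ : ℕ → ℝ) (l m : ℕ) : ℝ :=
  weightedCov σ ρ (Finset.Ioc 0 l) (Finset.Ioc 0 m)

theorem sumCov_comm (σ ρ : ℕ → ℝ) (l m : ℕ) : sumCov σ ρ l m = sumCov σ ρ m l :=
  weightedCov_comm _ _ _ _

/-- The correlation of the weighted sums up to `l` and up to `m`. -/
noncomputable def sumCorr (σ ρ : ℕ → ℝ) (l m : ℕ) : ℝ :=
  (√(sumCov σ ρ l l))⁻¹ * (√(sumCov σ ρ m m))⁻¹ * sumCov σ ρ l m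

theorem sumCorr_comm (σ ρ : ℕ → ℝ) (l m : ℕ) : sumCorr σ ρ l m = sumCorr σ ρ m l := by
  rw [sumCorr, sumCorr, sumCov_comm σ ρ l m]; ring

section FpH

variable {p H : ℝ}

theorem fpH_comm (hH₁ : 1 / 2 < H) (hH₂ : H < 1) (hpH : 0 < p + H) {x y : ℝ} (hx : 0 ≤ x)
    (hy : 0 ≤ y) : fpH p H x y = fpH p H y x := by
  have h := regularWeights_rpow hH₁ hH₂ hpH
  have h1 := tendsto_weightedCov hH₁ hH₂ hpH h.sigma_nonneg h.rho_nonneg h.sigma_lim h.rho_lim hx hy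
  have h2 := tendsto_weightedCov hH₁ hH₂ hpH h.sigma_nonneg h.rho_nonneg h.sigma_lim h.rho_lim hy hx
  rw [one_mul] at h1 h2
  refine tendsto_nhds_unique h1 (h2.congr fun a => ?_)
  rw [weightedCov_comm]

/-- Rescaling the parameter a in the discrete limit gives homogeneity by uniqueness of limits,
without a change of variables in the singular integral. -/
theorem fpH_mul (hH₁ : 1 / 2 < H) (hH₂ : H < 1) (hpH : 0 < p + H) {x y r : ℝ} (hx : 0 ≤ x)
    (hy : 0 ≤ y) (hr : 0 < r) : fpH p H (r * x) (r * y) = r ^ (2 * (p + H)) * fpH p H x y := by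
  have h := regularWeights_rpow hH₁ hH₂ hpH
  have h1 := tendsto_weightedCov hH₁ hH₂ hpH h.sigma_nonneg h.rho_nonneg h.sigma_lim h.rho_lim
    (mul_nonneg hr.le hx) (mul_nonneg hr.le hy)
  have h2 := ((tendsto_weightedCov hH₁ hH₂ hpH h.sigma_nonneg h.rho_nonneg h.sigma_lim h.rho_lim
    hx hy).comp (tendsto_id.atTop_mul_const hr)).const_mul (r ^ (2 * (p + H)))
  rw [one_mul] at h1 h2
  refine tendsto_nhds_unique h1 (h2.congr' ?_)
  filter_upwards [eventually_gt_atTop 0] with a ha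
  simp only [Function.comp_apply, id]
  rw [Real.mul_rpow ha.le hr.le, mul_assoc, mul_assoc]
  have : 0 < r ^ (2 * (p + H)) := by positivity
  field_simp

theorem fpH_nonneg {x y : ℝ} (hx : 0 ≤ x) (hy : 0 ≤ y) : 0 ≤ fpH p H x y := by
  refine intervalIntegral.integral_nonneg hx fun u hu => intervalIntegral.integral_nonneg hy
    fun v hv => ?_
  have := hu.1
  have := hv.1
  positivity

theorem fpH_one_pos (hH₁ : 1 / 2 < H) (hH₂ : H < 1) (hpH : 0 < p + H) : 0 < fpH p H 1 1 := by
  rw [← integral_powerKernel hH₁ hH₂ hpH zero_le_one zero_le_one]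
  have hpos : ∀ᵐ z ∂boxMeasure 1 1, 0 < powerKernel p H z := by
    filter_upwards [ae_boxMeasure 1 1] with z ⟨h1, h2, h3⟩
    have := h1.1
    have := h2.1
    have : 0 < |z.1 - z.2| := abs_pos.2 (sub_ne_zero.2 h3)
    simp only [powerKernel]
    positivity
  rw [integral_pos_iff_support_of_nonneg_ae (hpos.mono fun z hz => hz.le)
    (integrable_powerKernel hH₁ hH₂ hpH zero_le_one zero_le_one)]
  have h1 : boxMeasure 1 1 (Function.support (powerKernel p H)) = boxMeasure 1 1 Set.univ :=
    measure_congr (eventuallyEq_univ.2 (hpos.mono fun z hz => Function.mem_support.2 hz.ne'))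
  rw [h1, boxMeasure, ← Set.univ_prod_univ, Measure.prod_prod]
  simp

theorem CpH_zero (hH₁ : 1 / 2 < H) (hH₂ : H < 1) (hpH : 0 < p + H) : CpH p H 0 = 1 := by
  have := fpH_one_pos hH₁ hH₂ hpH
  simp only [CpH, NNReal.coe_zero, neg_zero, zero_mul, Real.exp_zero, one_mul]
  exact div_self this.ne'

theorem CpH_nonneg (τ : ℝ≥0) : 0 ≤ CpH p H τ :=
  mul_nonneg (Real.exp_nonneg _) (div_nonneg (fpH_nonneg zero_le_one (Real.exp_nonneg _))
    (fpH_nonneg zero_le_one zero_le_one))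

/-- The Lamperti transformation: homogeneity of the kernel becomes stationarity in logarithmic time.
-/
theorem fpH_exp (hH₁ : 1 / 2 < H) (hH₂ : H < 1) (hpH : 0 < p + H) (s t : ℝ≥0) :
    fpH p H (Real.exp s) (Real.exp t)
      = fpH p H 1 1 * (Real.exp (s * (p + H)) * Real.exp (t * (p + H)) * CpH p H (nndist s t)) := by
  wlog h : s ≤ t generalizing s t
  · rw [fpH_comm hH₁ hH₂ hpH (Real.exp_nonneg _) (Real.exp_nonneg _), this t s (le_of_not_ge h),
      nndist_comm]
    ring
  have e1 : ((nndist s t : ℝ≥0) : ℝ) = t - s := by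
    rw [coe_nndist, NNReal.dist_eq, abs_sub_comm, abs_of_nonneg (sub_nonneg.2 (by exact_mod_cast h))]
  have e2 : fpH p H (Real.exp s) (Real.exp t)
      = fpH p H (Real.exp s * 1) (Real.exp s * Real.exp (t - s)) := by
    rw [mul_one, ← Real.exp_add, add_sub_cancel]
  have h0 := fpH_one_pos hH₁ hH₂ hpH
  rw [e2, fpH_mul hH₁ hH₂ hpH zero_le_one (Real.exp_nonneg _) (Real.exp_pos _), CpH, e1,
    ← Real.exp_mul]
  have e3 : Real.exp (s * (2 * (p + H))) = Real.exp (s * (p + H)) * Real.exp (t * (p + H)) *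
      Real.exp (-(t - s) * (p + H)) := by
    rw [← Real.exp_add, ← Real.exp_add]; congr 1; ring
  rw [e3]
  field_simp

end FpH

/-! ### Correlations of the partial sums. -/

namespace RegularWeights

open Finset

variable {p H κ : ℝ} {σ ρ : ℕ → ℝ}

theorem sumCov_nonneg (h : RegularWeights p H κ σ ρ) (l m : ℕ) : 0 ≤ sumCov σ ρ l m :=
  weightedCov_nonneg h.sigma_nonneg h.rho_nonneg _ _

theorem sumCov_self_pos (h : RegularWeights p H κ σ ρ) {l : ℕ} (hl : 1 ≤ l) :
    0 < sumCov σ ρ l l := by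
  have h1 : weightedCov σ ρ {l} {l} ≤ sumCov σ ρ l l :=
    weightedCov_mono (fun i _ => h.sigma_nonneg i) h.rho_nonneg (by simp; omega)
      (by simp; omega) (fun i hi => (mem_Ioc.1 hi).1) (fun i hi => (mem_Ioc.1 hi).1)
  refine lt_of_lt_of_le ?_ h1
  have := h.sigma_pos l hl
  simp only [weightedCov, sum_singleton, Nat.dist_self, h.rho_zero]
  positivity

theorem sumCorr_self (h : RegularWeights p H κ σ ρ) {l : ℕ} (hl : 1 ≤ l) :
    sumCorr σ ρ l l = 1 := by
  have h1 := h.sumCov_self_pos hl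
  rw [sumCorr, ← mul_inv, Real.mul_self_sqrt h1.le, inv_mul_cancel₀ h1.ne']

theorem tendsto_sumCov (h : RegularWeights p H κ σ ρ) (s t : ℝ≥0) :
    Tendsto (fun a : ℝ => sumCov σ ρ ⌊a * Real.exp s⌋₊ ⌊a * Real.exp t⌋₊ / a ^ (2 * (p + H))) atTop
      (𝓝 (κ * (fpH p H 1 1 * (Real.exp (s * (p + H)) * Real.exp (t * (p + H)) *
        CpH p H (nndist s t))))) := by
  rw [← fpH_exp h.half_lt h.lt_one h.add_pos]
  exact tendsto_weightedCov h.half_lt h.lt_one h.add_pos h.sigma_nonneg h.rho_nonneg h.sigma_lim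
    h.rho_lim (Real.exp_nonneg _) (Real.exp_nonneg _)

/-- The factor κ f(1,1) and the exponential growth factors cancel between the covariance and the two
standard deviations. -/
theorem tendsto_sumCorr (h : RegularWeights p H κ σ ρ) (s t : ℝ≥0) :
    Tendsto (fun a : ℝ => sumCorr σ ρ ⌊a * Real.exp s⌋₊ ⌊a * Real.exp t⌋₊) atTop
      (𝓝 (CpH p H (nndist s t))) := by
  have hf := fpH_one_pos h.half_lt h.lt_one h.add_pos
  have hκ := h.kappa_pos
  have hC := CpH_zero h.half_lt h.lt_one h.add_pos
  have hsq : ∀ r : ℝ≥0, Tendsto (fun a : ℝ => (√(sumCov σ ρ ⌊a * Real.exp r⌋₊ ⌊a * Real.exp r⌋₊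
      / a ^ (2 * (p + H))))⁻¹) atTop (𝓝 ((√(κ * fpH p H 1 1) * Real.exp (r * (p + H)))⁻¹)) := by
    intro r
    have h1 := (h.tendsto_sumCov r r).sqrt
    rw [nndist_self, hC, mul_one, ← mul_assoc, Real.sqrt_mul (by positivity),
      Real.sqrt_mul_self (Real.exp_nonneg _)] at h1
    exact h1.inv₀ (by positivity)
  have h2 := ((hsq s).mul (hsq t)).mul (h.tendsto_sumCov s t)
  have e : (√(κ * fpH p H 1 1) * Real.exp (s * (p + H)))⁻¹ *
      (√(κ * fpH p H 1 1) * Real.exp (t * (p + H)))⁻¹ * (κ * (fpH p H 1 1 *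
      (Real.exp (s * (p + H)) * Real.exp (t * (p + H)) * CpH p H (nndist s t))))
      = CpH p H (nndist s t) := by
    have h3 : √(κ * fpH p H 1 1) * √(κ * fpH p H 1 1) = κ * fpH p H 1 1 :=
      Real.mul_self_sqrt (by positivity)
    have h4 : 0 < √(κ * fpH p H 1 1) := by positivity
    generalize √(κ * fpH p H 1 1) = q at h3 h4 ⊢
    rw [← mul_assoc κ, ← h3]
    field_simp
  rw [e] at h2
  refine h2.congr' ?_
  filter_upwards [eventually_gt_atTop 0] with a ha
  have h5 : 0 < a ^ (2 * (p + H)) := by positivity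
  rw [sumCorr, Real.sqrt_div (h.sumCov_nonneg _ _), Real.sqrt_div (h.sumCov_nonneg _ _)]
  have h6 : √(a ^ (2 * (p + H))) * √(a ^ (2 * (p + H))) = a ^ (2 * (p + H)) :=
    Real.mul_self_sqrt h5.le
  have h7 : 0 < √(a ^ (2 * (p + H))) := by positivity
  rw [inv_div, inv_div]
  have h8 : ∀ q r x y V : ℝ, q * q = r → r ≠ 0 → q / x * (q / y) * (V / r) = x⁻¹ * y⁻¹ * V := by
    intro q r x y V hq hr
    rw [show q / x * (q / y) * (V / r) = (q * q / r) * (x⁻¹ * y⁻¹ * V) by ring, hq, div_self hr,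
      one_mul]
  exact h8 _ _ _ _ _ h6 h5.ne'

theorem exists_weight_bounds (h : RegularWeights p H κ σ ρ) : ∃ D > 0, ∀ s t : Finset ℕ,
    (∀ i ∈ s, 1 ≤ i) → (∀ i ∈ t, 1 ≤ i) → weightedCov σ ρ s t ≤ D *
      weightedCov (fun i => (i : ℝ) ^ p) (fun i => (1 + (i : ℝ)) ^ (2 * H - 2)) s t := by
  obtain ⟨A, hA, hσA⟩ := exists_le_mul_rpow h.sigma_lim
  obtain ⟨B, hB, hρB⟩ := exists_le_mul_one_add_rpow (by linarith [h.lt_one]) h.rho_lim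
  exact ⟨A ^ 2 * B, by positivity, fun s t hs ht => weightedCov_le (fun i _ => h.sigma_nonneg i)
    h.rho_nonneg hσA hρB hs ht⟩

theorem exists_le_sumCov_self (h : RegularWeights p H κ σ ρ) : ∃ c > (0 : ℝ), ∃ k₀ : ℕ, 1 ≤ k₀ ∧
    ∀ l, k₀ ≤ l → c * (l : ℝ) ^ (2 * (p + H)) ≤ sumCov σ ρ l l := by
  have hf := fpH_one_pos h.half_lt h.lt_one h.add_pos
  have hκ := h.kappa_pos
  have h1 := (h.tendsto_sumCov 0 0).comp (tendsto_natCast_atTop_atTop (R := ℝ))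
  simp only [nndist_self, CpH_zero h.half_lt h.lt_one h.add_pos, NNReal.coe_zero, zero_mul,
    Real.exp_zero, mul_one] at h1
  have h2 : κ * fpH p H 1 1 / 2 < κ * fpH p H 1 1 := half_lt_self (by positivity)
  obtain ⟨k, hk⟩ := eventually_atTop.1 (h1.eventually (lt_mem_nhds h2))
  refine ⟨κ * fpH p H 1 1 / 2, by positivity, max k 1, le_max_right _ _, fun l hl => ?_⟩
  have hl' : (0 : ℝ) < l := by exact_mod_cast (le_max_right k 1).trans hl
  have h3 := hk l ((le_max_left k 1).trans hl)
  simp only [Function.comp_apply, Nat.floor_natCast] at h3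
  rw [lt_div_iff₀ (by positivity)] at h3
  exact h3.le

theorem exists_sumCorr_le (h : RegularWeights p H κ σ ρ) : ∃ c > (0 : ℝ), ∃ D > (0 : ℝ), ∃ k₀ : ℕ,
    1 ≤ k₀ ∧ ∀ l m, k₀ ≤ l → l ≤ m → sumCorr σ ρ l m ≤ D * ((l : ℝ) / m) ^ c := by
  obtain ⟨D₁, hD₁, h1⟩ := h.exists_weight_bounds
  obtain ⟨c₀, hc₀, k₀, hk₀, h2⟩ := h.exists_le_sumCov_self
  have hH₂ := h.lt_one
  have hpH := h.add_pos
  -- Any positive exponent allowed by the covariance estimate will do; halving p + H secures the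
  -- strict inequality.
  set c := min (1 - H) ((p + H) / 2) with hc
  have hcpos : 0 < c := lt_min (by linarith) (by linarith)
  obtain ⟨C, hC, h3⟩ := exists_weightedCov_rpow_le h.half_lt hH₂ hpH (c := c) (min_le_left _ _)
    ((min_le_right _ _).trans_lt (by linarith))
  refine ⟨c, hcpos, D₁ * C / c₀, by positivity, k₀, hk₀, fun l m hl hlm => ?_⟩
  have hl' : (0 : ℝ) < l := by exact_mod_cast hk₀.trans hl
  have hm' : (0 : ℝ) < m := by exact_mod_cast (hk₀.trans hl).trans hlm
  have h4 : sumCov σ ρ l m ≤ D₁ * (C * ((l : ℝ) ^ (p + H + c) * (m : ℝ) ^ (p + H - c))) :=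
    (h1 _ _ (fun i hi => (mem_Ioc.1 hi).1) (fun i hi => (mem_Ioc.1 hi).1)).trans
      (mul_le_mul_of_nonneg_left (h3 l m (hk₀.trans hl) hlm) hD₁.le)
  have h5 : ∀ n : ℕ, k₀ ≤ n → (√(sumCov σ ρ n n))⁻¹ ≤ (√c₀ * (n : ℝ) ^ (p + H))⁻¹ := by
    intro n hn
    have hn' : (0 : ℝ) < n := by exact_mod_cast hk₀.trans hn
    refine inv_anti₀ (by positivity) ?_
    rw [← Real.sqrt_sq (show 0 ≤ (n : ℝ) ^ (p + H) by positivity), ← Real.sqrt_mul hc₀.le]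
    refine Real.sqrt_le_sqrt (le_trans (le_of_eq ?_) (h2 n hn))
    rw [← Real.rpow_natCast, ← Real.rpow_mul hn'.le]
    congr 2
    push_cast
    ring
  calc sumCorr σ ρ l m ≤ (√c₀ * (l : ℝ) ^ (p + H))⁻¹ * (√c₀ * (m : ℝ) ^ (p + H))⁻¹ *
        (D₁ * (C * ((l : ℝ) ^ (p + H + c) * (m : ℝ) ^ (p + H - c)))) := by
        rw [sumCorr]
        exact mul_le_mul (mul_le_mul (h5 l hl) (h5 m (hl.trans hlm)) (by positivity) (by positivity))
          h4 (h.sumCov_nonneg _ _) (by positivity)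
    _ = D₁ * C / c₀ * ((l : ℝ) / m) ^ c := by
        have e : √c₀ * √c₀ = c₀ := Real.mul_self_sqrt hc₀.le
        rw [Real.rpow_add hl' (p + H) c, Real.rpow_sub hm' (p + H) c, Real.div_rpow hl'.le hm'.le]
        have := Real.rpow_pos_of_pos hl' (p + H)
        have := Real.rpow_pos_of_pos hm' (p + H)
        have := Real.rpow_pos_of_pos hm' c
        have : 0 < √c₀ := by positivity
        nth_rewrite 3 [← e]
        field_simp

theorem weightedCov_Ioc_self (σ ρ : ℕ → ℝ) {l m : ℕ} (hlm : l ≤ m) :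
    weightedCov σ ρ (Ioc l m) (Ioc l m)
      = sumCov σ ρ m m + sumCov σ ρ l l - 2 * sumCov σ ρ l m := by
  have hsum : ∀ f : ℕ → ℝ, ∑ i ∈ Ioc 0 m, f i = ∑ i ∈ Ioc 0 l, f i + ∑ i ∈ Ioc l m, f i :=
    fun f => (sum_Ioc_consecutive f (Nat.zero_le l) hlm).symm
  have h1 : sumCov σ ρ l m = sumCov σ ρ l l + weightedCov σ ρ (Ioc 0 l) (Ioc l m) := by
    simp only [sumCov, weightedCov, ← sum_add_distrib]
    exact sum_congr rfl fun i _ => hsum _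
  have h2 : sumCov σ ρ m m = sumCov σ ρ l m + weightedCov σ ρ (Ioc l m) (Ioc 0 l)
      + weightedCov σ ρ (Ioc l m) (Ioc l m) := by
    have h3 : weightedCov σ ρ (Ioc l m) (Ioc 0 m) = weightedCov σ ρ (Ioc l m) (Ioc 0 l)
        + weightedCov σ ρ (Ioc l m) (Ioc l m) := by
      simp only [weightedCov, ← sum_add_distrib]
      exact sum_congr rfl fun i _ => hsum _
    rw [add_assoc, ← h3]
    exact hsum _
  rw [weightedCov_comm σ ρ (Ioc l m) (Ioc 0 l)] at h2
  linarith

theorem exists_increment_le (h : RegularWeights p H κ σ ρ) {R : ℝ} (hR : 1 ≤ R) :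
    ∃ C > 0, ∀ (a : ℝ) (l m : ℕ), 0 < a → a ≤ l → (m : ℝ) ≤ R * a →
      weightedCov σ ρ (Ioc l m) (Ioc l m)
        ≤ C * (a ^ (2 * p) * ((m - l : ℕ) : ℝ) ^ (2 * H)) := by
  obtain ⟨D₁, hD₁, h1⟩ := h.exists_weight_bounds
  obtain ⟨C, hC, h2⟩ := exists_weightedCov_rpow_Ioc_le p h.half_lt hR
  refine ⟨D₁ * C, by positivity, fun a l m ha hl hm => ?_⟩
  have h3 : ∀ i ∈ Ioc l m, 1 ≤ i := fun i hi => by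
    have := (mem_Ioc.1 hi).1
    omega
  rw [mul_assoc]
  exact (h1 _ _ h3 h3).trans (mul_le_mul_of_nonneg_left (h2 a l m ha hl hm) hD₁.le)

/-- The arithmetic-geometric mean inequality bounds the correlation defect by the increment
variance, and nonnegativity makes the variances monotone, so both can be replaced by the smaller
one. -/
theorem one_sub_sumCorr_le (h : RegularWeights p H κ σ ρ) {l m : ℕ} (hl : 1 ≤ l) (hlm : l ≤ m) :
    1 - sumCorr σ ρ l m ≤ weightedCov σ ρ (Ioc l m) (Ioc l m) / (2 * sumCov σ ρ l l) := by
  have h1 := h.sumCov_self_pos hl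
  have h2 : sumCov σ ρ l l ≤ sumCov σ ρ m m :=
    weightedCov_mono (fun i _ => h.sigma_nonneg i) h.rho_nonneg (Ioc_subset_Ioc_right hlm)
      (Ioc_subset_Ioc_right hlm) (fun i hi => (mem_Ioc.1 hi).1) (fun i hi => (mem_Ioc.1 hi).1)
  have h2' := h1.trans_le h2
  have hw := weightedCov_Ioc_self σ ρ hlm
  set x := √(sumCov σ ρ l l) with hx
  set y := √(sumCov σ ρ m m) with hy
  have hx2 : x ^ 2 = sumCov σ ρ l l := Real.sq_sqrt h1.le
  have hy2 : y ^ 2 = sumCov σ ρ m m := Real.sq_sqrt h2'.le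
  have hx0 : 0 < x := Real.sqrt_pos.2 h1
  have hxy : x ≤ y := Real.sqrt_le_sqrt h2
  have hy0 : 0 < y := hx0.trans_le hxy
  have hW : 2 * (x * y - sumCov σ ρ l m) ≤ weightedCov σ ρ (Ioc l m) (Ioc l m) := by
    rw [hw, ← hx2, ← hy2]
    nlinarith [sq_nonneg (x - y)]
  have hW0 := weightedCov_nonneg h.sigma_nonneg h.rho_nonneg (Ioc l m) (Ioc l m)
  have e : 1 - sumCorr σ ρ l m = (x * y - sumCov σ ρ l m) / (x * y) := by
    rw [sumCorr, ← hx, ← hy]; field_simp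
  rw [e, ← hx2]
  calc (x * y - sumCov σ ρ l m) / (x * y)
      ≤ (weightedCov σ ρ (Ioc l m) (Ioc l m) / 2) / (x * y) := by gcongr; linarith
    _ ≤ (weightedCov σ ρ (Ioc l m) (Ioc l m) / 2) / (x * x) := by gcongr
    _ = _ := by field_simp

end RegularWeights

/-! ### Gaussian vectors of weighted sums. -/

section WeightedSums

open Finset

theorem isCenteredGaussian_weightedSum {Ω ι : Type*} [MeasurableSpace Ω] [Fintype ι] {P : Measure Ω}
    {ξ : ℕ → Ω → ℝ} {ρ : ℕ → ℝ}
    (hξ : ∀ n, IsCenteredGaussian P (fun i : Fin n => ξ i) (fun i j => ρ (Nat.dist i j)))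
    (σ : ℕ → ℝ) (s : ι → Finset ℕ) :
    IsCenteredGaussian P (fun i ω => ∑ k ∈ s i, σ k * ξ k ω)
      (fun i j => weightedCov σ ρ (s i) (s j)) := by
  classical
  obtain ⟨n, hn⟩ : ∃ n, ∀ i, s i ⊆ range n := by
    obtain ⟨n, hn⟩ := (univ.biUnion s).exists_nat_subset_range
    exact ⟨n, fun i => (subset_biUnion_of_mem s (mem_univ i)).trans hn⟩
  have hsum : ∀ i (f : ℕ → ℝ), ∑ k : Fin n, (if (k : ℕ) ∈ s i then f k else 0) = ∑ k ∈ s i, f k := by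
    intro i f
    rw [Fin.sum_univ_eq_sum_range fun k => if k ∈ s i then f k else 0, ← sum_filter]
    congr 1
    ext k
    simp only [mem_filter]
    exact ⟨fun h => h.2, fun h => ⟨hn i h, h⟩⟩
  have h := (hξ n).comp_linear fun (i : ι) (k : Fin n) => if (k : ℕ) ∈ s i then σ k else 0
  have e : (fun i ω => ∑ k ∈ s i, σ k * ξ k ω)
      = fun i ω => ∑ k : Fin n, (if (k : ℕ) ∈ s i then σ k else 0) * ξ k ω := by
    funext i ω
    simp only [ite_mul, zero_mul]
    exact (hsum i fun k => σ k * ξ k ω).symm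
  rw [e]
  refine h.congr_cov fun i j => ?_
  simp only [ite_mul, mul_ite, zero_mul, mul_zero]
  rw [weightedCov, ← hsum i]
  refine sum_congr rfl fun k _ => ?_
  by_cases hk : (k : ℕ) ∈ s i
  · simp only [hk, if_true]
    exact hsum j fun k' => σ k * σ k' * ρ (Nat.dist k k')
  · simp [hk]

theorem IsStationaryGaussian.isCenteredGaussian_nat {Ω : Type*} [MeasurableSpace Ω] {P : Measure Ω}
    {ξ : ℕ → Ω → ℝ} {ρ : ℕ → ℝ} (h : IsStationaryGaussian P ξ ρ) (n : ℕ) :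
    IsCenteredGaussian P (fun i : Fin n => ξ i) (fun i j => ρ (Nat.dist i j)) := by
  refine .of_gaussian_family (A := fun i j => ρ (Nat.dist i j)) h.gaussian h.centered
    (fun i j => ?_) (fun i : Fin n => (i : ℕ))
  wlog hij : i ≤ j generalizing i j
  · rw [Nat.dist_comm, ← this j i (le_of_not_ge hij)]
    simp only [mul_comm]
  obtain ⟨d, rfl⟩ := Nat.exists_eq_add_of_le hij
  rw [h.covariance, Nat.dist_eq_sub_of_le hij, Nat.add_sub_cancel_left]

/-- The normalized weighted sums. -/
theorem isCenteredGaussian_normalizedSum {Ω ι : Type*} [MeasurableSpace Ω] [Fintype ι]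
    {P : Measure Ω} {ξ : ℕ → Ω → ℝ} {ρ : ℕ → ℝ}
    (hξ : ∀ n, IsCenteredGaussian P (fun i : Fin n => ξ i) (fun i j => ρ (Nat.dist i j)))
    (σ : ℕ → ℝ) (l : ι → ℕ) :
    IsCenteredGaussian P
      (fun i ω => (√(sumCov σ ρ (l i) (l i)))⁻¹ * ∑ k ∈ Ioc 0 (l i), σ k * ξ k ω)
      (fun i j => sumCorr σ ρ (l i) (l j)) :=
  (isCenteredGaussian_weightedSum hξ σ fun i => Ioc 0 (l i)).smul
    fun i => (√(sumCov σ ρ (l i) (l i)))⁻¹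

/-- The Gamma integral represents (1 + d)^(-β) as a positive mixture of the geometric correlations
e^(-sd). -/
theorem one_add_dist_rpow_nonneg_definite {β : ℝ} (hβ : 0 < β) {ι : Type*} [Fintype ι] (t : ι → ℕ)
    (c : ι → ℝ) : 0 ≤ ∑ i, ∑ j, c i * c j * (1 + (Nat.dist (t i) (t j) : ℝ)) ^ (-β) := by
  have hG := Real.Gamma_pos_of_pos hβ
  have hint : ∀ d : ℕ, ∫ s in Set.Ioi (0 : ℝ), s ^ (β - 1) * Real.exp (-((1 + (d : ℝ)) * s))
      = (1 + (d : ℝ)) ^ (-β) * Real.Gamma β := by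
    intro d
    have hd : (0 : ℝ) < 1 + d := by positivity
    rw [Real.integral_rpow_mul_exp_neg_mul_Ioi hβ hd, Real.rpow_neg hd.le, one_div,
      Real.inv_rpow hd.le]
  -- A non-integrable function would have integral 0 by convention, but the evaluated integral is
  -- positive.
  have hI : ∀ d : ℕ, IntegrableOn (fun s : ℝ => s ^ (β - 1) * Real.exp (-((1 + (d : ℝ)) * s)))
      (Set.Ioi 0) := by
    intro d
    by_contra h
    have h1 := hint d
    rw [integral_undef h] at h1
    have : 0 < (1 + (d : ℝ)) ^ (-β) * Real.Gamma β := by positivity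
    linarith
  have key : (∑ i, ∑ j, c i * c j * (1 + (Nat.dist (t i) (t j) : ℝ)) ^ (-β)) * Real.Gamma β
      = ∫ s in Set.Ioi (0 : ℝ), ∑ i, ∑ j, c i * c j *
        (s ^ (β - 1) * Real.exp (-((1 + (Nat.dist (t i) (t j) : ℝ)) * s))) := by
    rw [integral_finsetSum _ fun i _ => integrable_finsetSum _ fun j _ => (hI _).const_mul _,
      Finset.sum_mul]
    refine sum_congr rfl fun i _ => ?_
    rw [integral_finsetSum _ fun j _ => (hI _).const_mul _, Finset.sum_mul]
    refine sum_congr rfl fun j _ => ?_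
    rw [integral_const_mul, hint, mul_assoc]
  refine nonneg_of_mul_nonneg_left ?_ hG
  rw [key]
  refine setIntegral_nonneg measurableSet_Ioi fun s hs => ?_
  have hs' : (0 : ℝ) < s := hs
  have h1 := pow_dist_nonneg_definite (r := Real.exp (-s)) (Real.exp_nonneg _)
    (Real.exp_le_one_iff.2 (by linarith)) t c
  have e : ∑ i, ∑ j, c i * c j * (s ^ (β - 1) *
      Real.exp (-((1 + (Nat.dist (t i) (t j) : ℝ)) * s))) = s ^ (β - 1) * Real.exp (-s) *
      ∑ i, ∑ j, c i * c j * Real.exp (-s) ^ Nat.dist (t i) (t j) := by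
    simp only [mul_sum]
    refine sum_congr rfl fun i _ => sum_congr rfl fun j _ => ?_
    rw [← Real.exp_nat_mul, show -((1 + (Nat.dist (t i) (t j) : ℝ)) * s)
      = -s + (Nat.dist (t i) (t j) : ℝ) * -s by ring, Real.exp_add]
    ring
  rw [e]
  positivity

end WeightedSums

/-! ### Analytic properties of the limiting correlation. -/

section CpH

variable {p H : ℝ}

/-- A pointwise limit of correlation matrices of actual normalized sums, built from a model Gaussian
sequence with correlations (1 + i)^(2H-2). -/
theorem isNonnegDefinite_CpH (hH₁ : 1 / 2 < H) (hH₂ : H < 1) (hpH : 0 < p + H) :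
    IsNonnegDefinite (CpH p H) := by
  intro ι _ t c
  have h := regularWeights_rpow hH₁ hH₂ hpH
  set ρ : ℕ → ℝ := fun i => (1 + (i : ℝ)) ^ (2 * H - 2) with hρ
  obtain ⟨M, hM, hG⟩ := exists_gaussian_sequence (K := fun i j => ρ (Nat.dist i j))
    (fun i j => by rw [Nat.dist_comm]) fun n c => by
      have := one_add_dist_rpow_nonneg_definite (β := 2 - 2 * H) (by linarith)
        (fun i : Finset.Iic n => (i : ℕ)) c
      rw [neg_sub] at this
      exact this
  have hξ : ∀ n, IsCenteredGaussian M (fun (i : Fin n) x => x i) (fun i j => ρ (Nat.dist i j)) :=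
    fun n => hG fun i : Fin n => (i : ℕ)
  refine ge_of_tendsto' (x := atTop) (f := fun a : ℝ => ∑ i, ∑ j, c i * c j *
    sumCorr (fun i => (i : ℝ) ^ p) ρ ⌊a * Real.exp (t i)⌋₊ ⌊a * Real.exp (t j)⌋₊)
    (tendsto_finsetSum _ fun i _ => tendsto_finsetSum _ fun j _ =>
      (h.tendsto_sumCorr (t i) (t j)).const_mul _) fun a => ?_
  -- No lower bound on a is needed: an empty sum has zero variance and is normalized to 0.
  exact (isCenteredGaussian_normalizedSum (ξ := fun k (x : ℕ → ℝ) => x k) hξ _ fun i => ⌊a * Real.exp (t i)⌋₊).nonneg c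

theorem tendsto_floor_mul_div {u : ℝ} (hu : 0 ≤ u) :
    Tendsto (fun a : ℝ => (⌊a * u⌋₊ : ℝ) / a) atTop (𝓝 u) := by
  refine (tendsto_nat_floor_mul_div_atTop hu).congr fun a => ?_
  rw [mul_comm]

theorem exists_CpH_le (hH₁ : 1 / 2 < H) (hH₂ : H < 1) (hpH : 0 < p + H) :
    ∃ c > 0, ∃ D > 0, ∀ τ : ℝ≥0, CpH p H τ ≤ D * Real.exp (-(c * τ)) := by
  have h := regularWeights_rpow hH₁ hH₂ hpH
  obtain ⟨c, hc, D, hD, k₀, hk₀, hle⟩ := h.exists_sumCorr_le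
  refine ⟨c, hc, D, hD, fun τ => ?_⟩
  have h1 := h.tendsto_sumCorr 0 τ
  have e : nndist 0 τ = τ := by rw [nndist_comm, NNReal.nndist_eq]; simp
  rw [e] at h1
  have h2 : Tendsto (fun a : ℝ => D * (((⌊a * Real.exp (0 : ℝ≥0)⌋₊ : ℝ) / a) /
      ((⌊a * Real.exp τ⌋₊ : ℝ) / a)) ^ c) atTop (𝓝 (D * (Real.exp (0 : ℝ≥0) / Real.exp τ) ^ c)) :=
    (((tendsto_floor_mul_div (Real.exp_nonneg _)).div (tendsto_floor_mul_div (Real.exp_nonneg _))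
      (Real.exp_pos _).ne').rpow_const (Or.inr hc.le)).const_mul D
  have e2 : (Real.exp (0 : ℝ≥0) / Real.exp τ) ^ c = Real.exp (-(c * τ)) := by
    rw [← Real.exp_sub, ← Real.exp_mul]
    congr 1
    simp
    ring
  rw [e2] at h2
  refine le_of_tendsto_of_tendsto h1 h2 ?_
  filter_upwards [eventually_gt_atTop 0, eventually_ge_atTop (k₀ : ℝ)] with a ha hak
  rw [div_div_div_cancel_right₀ ha.ne']
  refine hle _ _ ?_ (Nat.floor_mono ?_)
  · simpa using Nat.le_floor hak
  · exact mul_le_mul_of_nonneg_left (Real.exp_le_exp.2 (by simp)) ha.le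

/-- The discrete increment estimate passes to the limit. Its exponent 2H exceeds 1, as path
continuity requires. -/
theorem exists_one_sub_CpH_le (hH₁ : 1 / 2 < H) (hH₂ : H < 1) (hpH : 0 < p + H) :
    ∃ C, ∀ τ : ℝ≥0, τ ≤ 1 → 1 - CpH p H τ ≤ C * (τ : ℝ) ^ (2 * H) := by
  have h := regularWeights_rpow hH₁ hH₂ hpH
  obtain ⟨c₀, hc₀, k₀, hk₀, hlow⟩ := h.exists_le_sumCov_self
  obtain ⟨C, hC, hinc⟩ := h.exists_increment_le (R := 2 * Real.exp 1)
    (by linarith [Real.one_le_exp (zero_le_one (α := ℝ))])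
  refine ⟨C / (2 * c₀) * 2 ^ (2 * H), fun τ hτ => ?_⟩
  have hτ' : (τ : ℝ) ≤ 1 := hτ
  have h1 := (h.tendsto_sumCorr 0 τ).const_sub 1
  have e : nndist 0 τ = τ := by rw [nndist_comm, NNReal.nndist_eq]; simp
  simp only [e, NNReal.coe_zero, Real.exp_zero, mul_one] at h1
  have h2 : Tendsto (fun a : ℝ => C / (2 * c₀) * ((((⌊a * Real.exp τ⌋₊ : ℝ) / a) - (⌊a * 1⌋₊ : ℝ) / a) /
      ((⌊a * 1⌋₊ : ℝ) / a)) ^ (2 * H)) atTop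
      (𝓝 (C / (2 * c₀) * ((Real.exp τ - 1) / 1) ^ (2 * H))) :=
    ((((tendsto_floor_mul_div (Real.exp_nonneg _)).sub (tendsto_floor_mul_div zero_le_one)).div
      (tendsto_floor_mul_div zero_le_one) one_ne_zero).rpow_const (Or.inr (by linarith))).const_mul _
  have h3 : C / (2 * c₀) * ((Real.exp τ - 1) / 1) ^ (2 * H)
      ≤ C / (2 * c₀) * 2 ^ (2 * H) * (τ : ℝ) ^ (2 * H) := by
    rw [mul_assoc, ← Real.mul_rpow two_pos.le τ.coe_nonneg, div_one]
    have h4 := Real.abs_exp_sub_one_le (x := (τ : ℝ)) (by rw [NNReal.abs_eq]; exact hτ')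
    rw [NNReal.abs_eq] at h4
    have h5 : 0 ≤ Real.exp τ - 1 := by linarith [Real.one_le_exp τ.coe_nonneg]
    have h6 := (le_abs_self _).trans h4
    gcongr
  refine le_trans (le_of_tendsto_of_tendsto h1 h2 ?_) h3
  filter_upwards [eventually_ge_atTop (k₀ : ℝ), eventually_ge_atTop 1] with a hak ha1
  have ha : 0 < a := by linarith
  rw [← sub_div, div_div_div_cancel_right₀ ha.ne', mul_one]
  set l := ⌊a⌋₊ with hl
  set m := ⌊a * Real.exp τ⌋₊ with hm
  have hkl : k₀ ≤ l := Nat.le_floor hak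
  have hl1 : 1 ≤ l := hk₀.trans hkl
  have hl0 : (0 : ℝ) < l := by exact_mod_cast hl1
  have hlm : l ≤ m := Nat.floor_mono (by nlinarith [Real.one_le_exp τ.coe_nonneg])
  have hal : a ≤ 2 * l := by
    have h6 := Nat.lt_floor_add_one a
    have h7 : (1 : ℝ) ≤ l := by exact_mod_cast hl1
    rw [← hl] at h6
    linarith
  have hmR : (m : ℝ) ≤ 2 * Real.exp 1 * l := by
    calc (m : ℝ) ≤ a * Real.exp τ := Nat.floor_le (by positivity)
      _ ≤ (2 * l) * Real.exp 1 := by gcongr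
      _ = _ := by ring
  refine (h.one_sub_sumCorr_le hl1 hlm).trans ?_
  calc _ ≤ C * ((l : ℝ) ^ (2 * p) * ((m - l : ℕ) : ℝ) ^ (2 * H)) / (2 * (c₀ * (l : ℝ) ^ (2 * (p + H)))) := by
        have := hinc l l m hl0 le_rfl hmR
        have := hlow l hkl
        gcongr
    _ = _ := by
        rw [Nat.cast_sub hlm, Real.div_rpow (sub_nonneg.2 (by exact_mod_cast hlm)) hl0.le, mul_add,
          Real.rpow_add hl0]
        field_simp

end CpH

/-! ### Fluctuations between grid points and the lower bound on one block. -/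

/-- Dyadic bisection: a second moment bound for the maximal increment over `2 ^ r` steps. -/
theorem exists_maximal_second_moment {e : ℝ} (he : 1 < e) :
    ∃ B > 0, ∀ {Ω : Type u} [MeasurableSpace Ω] (P : Measure Ω) (x : ℕ → Ω → ℝ) (A : ℝ) (lo hi : ℕ),
      0 ≤ A → (∀ l m, lo ≤ l → l ≤ m → m ≤ hi → Integrable (fun ω => (x m ω - x l ω) ^ 2) P ∧
        ∫ ω, (x m ω - x l ω) ^ 2 ∂P ≤ A * ((m - l : ℕ) : ℝ) ^ e) →
      ∀ r l, lo ≤ l → l + 2 ^ r ≤ hi → ∃ Q : Ω → ℝ, Integrable Q P ∧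
        ∫ ω, Q ω ∂P ≤ B * A * ((2 : ℝ) ^ r) ^ e ∧ ∀ ω, ∀ j ≤ 2 ^ r, (x (l + j) ω - x l ω) ^ 2 ≤ Q ω := by
  have h2e : (2 : ℝ) < 2 ^ e := by
    conv_lhs => rw [← Real.rpow_one 2]
    exact Real.rpow_lt_rpow_of_exponent_lt one_lt_two he
  -- Doubling the length multiplies the target by 2^e = 2 + 4θ, whereas the two halves use (1 + θ) ·
  -- 2 = 2 + 2θ. The spare 2θB pays for the middle increment with weight 1 + θ⁻¹.
  obtain ⟨θ, hθ0, hθ⟩ : ∃ θ : ℝ, 0 < θ ∧ 4 * θ = 2 ^ e - 2 :=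
    ⟨(2 ^ e - 2) / 4, by linarith, by ring⟩
  set B := max 1 ((1 + θ⁻¹) / (2 * θ)) with hB
  have hB1 : 1 ≤ B := le_max_left _ _
  have hB2 : 1 + θ⁻¹ ≤ B * (2 * θ) := by
    rw [← div_le_iff₀ (by positivity)]
    exact le_max_right _ _
  refine ⟨B, by linarith, fun {Ω} _ P x A lo hi hA hx r => ?_⟩
  induction r with
  | zero =>
    intro l hl hhi
    obtain ⟨h1, h2⟩ := hx l (l + 1) hl (Nat.le_succ l) (by simpa using hhi)
    refine ⟨_, h1, h2.trans ?_, fun ω j hj => ?_⟩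
    · simp only [Nat.add_sub_cancel_left, Nat.cast_one, Real.one_rpow, mul_one, pow_zero]
      nlinarith
    · rcases (show j = 0 ∨ j = 1 by simp at hj; omega) with rfl | rfl
      · rw [add_zero, sub_self, zero_pow two_ne_zero]
        exact sq_nonneg _
      · exact le_rfl
  | succ r ih =>
    intro l hl hhi
    have h2r : 2 ^ (r + 1) = 2 ^ r + 2 ^ r := by ring
    have h2r0 : 0 < 2 ^ r := Nat.two_pow_pos r
    obtain ⟨Q, hQ, hQE, hQb⟩ := ih l hl (by omega)
    obtain ⟨Q', hQ', hQE', hQb'⟩ := ih (l + 2 ^ r) (by omega) (by omega)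
    obtain ⟨h1, h2⟩ := hx l (l + 2 ^ r) hl (Nat.le_add_right _ _) (by omega)
    have i1 := h1.const_mul (1 + θ⁻¹)
    have i2 := (hQ.add hQ').const_mul (1 + θ)
    refine ⟨_, i1.add i2, ?_, fun ω j hj => ?_⟩
    · refine (integral_add i1 i2).trans_le ?_
      rw [integral_const_mul, integral_const_mul]
      have e3 : ∫ ω, (Q + Q') ω ∂P = ∫ ω, Q ω ∂P + ∫ ω, Q' ω ∂P := integral_add hQ hQ'
      rw [e3]
      rw [Nat.add_sub_cancel_left, Nat.cast_pow, Nat.cast_ofNat] at h2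
      have e4 : ((2 : ℝ) ^ (r + 1)) ^ e = (2 ^ r) ^ e * 2 ^ e := by
        rw [pow_succ, Real.mul_rpow (by positivity) (by positivity)]
      rw [e4]
      set T := ((2 : ℝ) ^ r) ^ e with hT
      have hT0 : 0 < T := by positivity
      have h5 : (1 + θ⁻¹) * ∫ ω, (x (l + 2 ^ r) ω - x l ω) ^ 2 ∂P ≤ (1 + θ⁻¹) * (A * T) := by
        gcongr
      have h6 : (1 + θ) * (∫ ω, Q ω ∂P + ∫ ω, Q' ω ∂P) ≤ (1 + θ) * (B * A * T + B * A * T) := by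
        gcongr
      have h7 : (1 + θ⁻¹) * (A * T) ≤ B * (2 * θ) * (A * T) := by gcongr
      have h8 : (2 : ℝ) ^ e = 4 * θ + 2 := by linarith
      rw [h8]
      nlinarith
    · have hQ0 : 0 ≤ Q ω := (sq_nonneg _).trans (hQb ω 0 (Nat.zero_le _))
      have hQ0' : 0 ≤ Q' ω := (sq_nonneg _).trans (hQb' ω 0 (Nat.zero_le _))
      have hθi : 0 < θ⁻¹ := by positivity
      simp only [Pi.add_apply]
      rcases le_or_gt j (2 ^ r) with h | h
      · have h3 := hQb ω j h
        nlinarith [sq_nonneg (x (l + 2 ^ r) ω - x l ω)]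
      · obtain ⟨k, rfl⟩ := Nat.exists_eq_add_of_le h.le
        have h3 := hQb' ω k (by omega)
        rw [add_assoc] at h3
        have h4 : ∀ a b : ℝ, (a + b) ^ 2 ≤ (1 + θ⁻¹) * a ^ 2 + (1 + θ) * b ^ 2 := by
          intro a b
          have e5 : (1 + θ⁻¹) * a ^ 2 + (1 + θ) * b ^ 2 - (a + b) ^ 2 = θ⁻¹ * (a - θ * b) ^ 2 := by
            field_simp; ring
          have : 0 ≤ θ⁻¹ * (a - θ * b) ^ 2 := by positivity
          linarith
        have h5 := h4 (x (l + 2 ^ r) ω - x l ω) (x (l + (2 ^ r + k)) ω - x (l + 2 ^ r) ω)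
        rw [show x (l + 2 ^ r) ω - x l ω + (x (l + (2 ^ r + k)) ω - x (l + 2 ^ r) ω)
          = x (l + (2 ^ r + k)) ω - x l ω by ring] at h5
        nlinarith

/-- The weighted sum up to `l`. -/
def partialSum {Ω : Type*} (σ : ℕ → ℝ) (ξ : ℕ → Ω → ℝ) (l : ℕ) (ω : Ω) : ℝ :=
  ∑ k ∈ Finset.Ioc 0 l, σ k * ξ k ω

section PartialSum

open Finset

variable {Ω : Type u} [MeasurableSpace Ω] {P : Measure Ω} {ξ : ℕ → Ω → ℝ} {ρ : ℕ → ℝ}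

theorem integral_sq_partialSum_sub
    (hξ : ∀ n, IsCenteredGaussian P (fun i : Fin n => ξ i) (fun i j => ρ (Nat.dist i j)))
    (σ : ℕ → ℝ) {l m : ℕ} (hlm : l ≤ m) :
    Integrable (fun ω => (partialSum σ ξ m ω - partialSum σ ξ l ω) ^ 2) P ∧
      ∫ ω, (partialSum σ ξ m ω - partialSum σ ξ l ω) ^ 2 ∂P
        = weightedCov σ ρ (Ioc l m) (Ioc l m) := by
  have e : ∀ ω, partialSum σ ξ m ω - partialSum σ ξ l ω = ∑ k ∈ Ioc l m, σ k * ξ k ω := by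
    intro ω
    rw [partialSum, partialSum, ← sum_Ioc_consecutive _ (Nat.zero_le l) hlm, add_sub_cancel_left]
  simp only [e]
  have h := isCenteredGaussian_weightedSum hξ σ fun _ : Unit => Ioc l m
  exact ⟨(h.memLp_two ()).integrable_sq, h.integral_sq ()⟩

end PartialSum

namespace RegularWeights

open Finset

variable {p H κ : ℝ} {σ ρ : ℕ → ℝ}

/-- Grid points `l` of mesh `w a`, together with a bound on the fluctuations of the weighted sums
between them. -/
theorem eventually_fluctuation_le (h : RegularWeights p H κ σ ρ) {E : ℝ} (hE : 1 < E) :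
    ∃ C > 0, ∀ (w : ℝ), 0 < w → w ≤ E → ∀ᶠ a : ℝ in atTop, ∀ {Ω : Type u} [MeasurableSpace Ω]
      {P : Measure Ω} {ξ : ℕ → Ω → ℝ}, IsProbabilityMeasure P →
      (∀ n, IsCenteredGaussian P (fun i : Fin n => ξ i) (fun i j => ρ (Nat.dist i j))) →
      ∀ l : ℕ, ⌊a⌋₊ ≤ l → (l : ℝ) ≤ a * E → ∀ δ : ℝ, 0 < δ → ∃ Bad : Set Ω,
        P.real Bad ≤ C / δ ^ 2 * w ^ (2 * H) ∧ ∀ ω ∉ Bad, ∀ m : ℕ, l ≤ m → (m : ℝ) ≤ l + a * w + 1 →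
          |partialSum σ ξ m ω - partialSum σ ξ l ω| < δ * √(sumCov σ ρ l l) := by
  have hH₁ := h.half_lt
  obtain ⟨c₀, hc₀, k₀, hk₀, hlow⟩ := h.exists_le_sumCov_self
  -- Indices start at ⌊a⌋ ≥ a/2 and end at most at aE + 4aw ≤ 5Ea, a ratio of 10E relative to the
  -- base a/2.
  obtain ⟨C, hC, hinc⟩ := h.exists_increment_le (R := 10 * E) (by linarith)
  obtain ⟨B, hB, hmax⟩ := exists_maximal_second_moment.{u} (e := 2 * H) (by linarith)
  refine ⟨B * C / c₀ * 8 ^ (2 * H), by positivity, fun w hw hwE => ?_⟩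
  filter_upwards [eventually_ge_atTop (k₀ : ℝ), eventually_ge_atTop 2,
    (tendsto_id.atTop_mul_const hw).eventually_ge_atTop 1] with a hak ha2 haw Ω _ P ξ hP hξ l hl hlE δ hδ
  simp only [id] at haw
  have ha : 0 < a := by linarith
  have hlo : ∀ n : ℕ, ⌊a⌋₊ ≤ n → a / 2 ≤ n := by
    intro n hn
    have h1 := Nat.lt_floor_add_one a
    have h2 : (⌊a⌋₊ : ℝ) ≤ n := by exact_mod_cast hn
    linarith
  -- The dyadic length 2^(r+1) lies between 2aw and 4aw. It covers the window aw + 1, because aw ≥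
  -- 1.
  obtain ⟨r, hr1, hr2⟩ := exists_nat_pow_near (x := 2 * (a * w)) (y := 2) (by linarith) one_lt_two
  have hr3 : (2 : ℝ) ^ (r + 1) ≤ 4 * (a * w) := by rw [pow_succ]; linarith
  obtain ⟨Q, hQ, hQE, hQb⟩ := hmax P (partialSum σ ξ) (C * (a / 2) ^ (2 * p)) ⌊a⌋₊ ⌊5 * E * a⌋₊
    (by positivity) (fun n m hn hnm hm => by
      obtain ⟨i1, i2⟩ := integral_sq_partialSum_sub hξ σ hnm
      refine ⟨i1, i2.le.trans ?_⟩
      rw [mul_assoc]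
      refine hinc (a / 2) n m (by positivity) (hlo n hn) ?_
      have : (m : ℝ) ≤ 5 * E * a := le_trans (by exact_mod_cast hm) (Nat.floor_le (by positivity))
      linarith) (r + 1) l hl (by
        refine Nat.le_floor ?_
        push_cast
        have : a * w ≤ a * E := by gcongr
        linarith)
  have hV : c₀ * (a / 2) ^ (2 * (p + H)) ≤ sumCov σ ρ l l := by
    refine le_trans ?_ (hlow l (le_trans (Nat.le_floor hak) hl))
    have := h.add_pos
    have := hlo l hl
    gcongr
  have hV0 : 0 < sumCov σ ρ l l := lt_of_lt_of_le (by positivity) hV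
  have hQ0 : ∀ ω, 0 ≤ Q ω := fun ω => (sq_nonneg _).trans (hQb ω 0 (Nat.zero_le _))
  refine ⟨{ω | δ ^ 2 * sumCov σ ρ l l ≤ Q ω}, ?_, fun ω hω m hlm hm => ?_⟩
  · have hM := mul_meas_ge_le_integral_of_nonneg (.of_forall hQ0) hQ (δ ^ 2 * sumCov σ ρ l l)
    have h1 : ∫ ω, Q ω ∂P ≤ B * (C * (a / 2) ^ (2 * p)) * (8 ^ (2 * H) * w ^ (2 * H) * (a / 2) ^ (2 * H)) := by
      refine hQE.trans ?_
      rw [← Real.mul_rpow (by norm_num) hw.le, ← Real.mul_rpow (by positivity) (by positivity)]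
      gcongr
      linarith
    have e : (a / 2) ^ (2 * (p + H)) = (a / 2) ^ (2 * p) * (a / 2) ^ (2 * H) := by
      rw [mul_add, Real.rpow_add (by positivity)]
    rw [e] at hV
    have h2 : δ ^ 2 * (c₀ * ((a / 2) ^ (2 * p) * (a / 2) ^ (2 * H))) *
        P.real {ω | δ ^ 2 * sumCov σ ρ l l ≤ Q ω}
        ≤ B * (C * (a / 2) ^ (2 * p)) * (8 ^ (2 * H) * w ^ (2 * H) * (a / 2) ^ (2 * H)) := by
      refine le_trans ?_ (hM.trans h1)
      gcongr
    have h3 : 0 < δ ^ 2 * (c₀ * ((a / 2) ^ (2 * p) * (a / 2) ^ (2 * H))) := by positivity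
    rw [← le_div_iff₀' h3] at h2
    refine h2.trans (le_of_eq ?_)
    field_simp
  · obtain ⟨j, rfl⟩ := Nat.exists_eq_add_of_le hlm
    have hj : j ≤ 2 ^ (r + 1) := by
      have : (j : ℝ) ≤ 2 ^ (r + 1) := by
        push_cast at hm
        linarith
      exact_mod_cast this
    have h1 := hQb ω j hj
    have h2 : Q ω < δ ^ 2 * sumCov σ ρ l l := not_le.1 hω
    refine abs_lt_of_sq_lt_sq ?_ (by positivity)
    rw [mul_pow, Real.sq_sqrt hV0.le]
    exact h1.trans_lt h2

/-- Over a block of logarithmic length `M`, the weighted sums are negative with probability at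
least that of the limiting process on `[0, M]`, asymptotically. -/
theorem eventually_block_ge (h : RegularWeights p H κ σ ρ) {Ω : Type u} [MeasurableSpace Ω]
    {P : Measure Ω} {ξ : ℕ → Ω → ℝ}
    (hξ : ∀ n, IsCenteredGaussian P (fun i : Fin n => ξ i) (fun i j => ρ (Nat.dist i j)))
    {Ω' : Type v} [MeasurableSpace Ω'] {P' : Measure Ω'} {Z : ℝ≥0 → Ω' → ℝ}
    (hZ : IsStationaryGaussian P' Z (CpH p H)) (hc : ∀ᵐ ω ∂P', Continuous fun t => Z t ω)
    {M : ℝ≥0} (hM : 0 < M) {ε : ℝ} (hε : 0 < ε) :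
    ∀ᶠ a : ℝ in atTop, supPersistenceProb P' Z M - ε
      ≤ P.real {ω | ∀ l, ⌊a⌋₊ < l → l ≤ ⌊a * Real.exp M⌋₊ → partialSum σ ξ l ω < 0} := by
  have := (hξ 0).isProbabilityMeasure
  have hH₁ := h.half_lt
  set E := Real.exp M with hEdef
  have hE : 1 < E := Real.one_lt_exp_iff.2 (by exact_mod_cast hM)
  -- The gap δ is spent in two halves, on the comparison with Z and on the fluctuations between grid
  -- points. The gap, the comparison and the fluctuations each lose ε/3 in probability.
  obtain ⟨δ, hδ, hgap⟩ := hZ.exists_gap hc M (show 0 < ε / 3 by positivity)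
  obtain ⟨C, hC, hfl⟩ := h.eventually_fluctuation_le.{u} hE
  -- There are N cells, each bad with probability of order N^(-2H); the union bound tends to 0
  -- because 2H > 1.
  obtain ⟨N, hN0, hN⟩ : ∃ N : ℕ, 1 ≤ N ∧
      N * (C / (δ / 2) ^ 2 * ((E - 1) / N) ^ (2 * H)) ≤ ε / 3 := by
    have h1 : Tendsto (fun N : ℕ => C / (δ / 2) ^ 2 * (E - 1) ^ (2 * H) * (N : ℝ) ^ (-(2 * H - 1)))
        atTop (𝓝 (C / (δ / 2) ^ 2 * (E - 1) ^ (2 * H) * 0)) :=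
      ((tendsto_rpow_neg_atTop (by linarith)).comp tendsto_natCast_atTop_atTop).const_mul _
    rw [mul_zero] at h1
    obtain ⟨N, hN1, hN2⟩ := ((h1.eventually (gt_mem_nhds (show 0 < ε / 3 by positivity))).and
      (eventually_ge_atTop 1)).exists
    refine ⟨N, hN2, le_trans (le_of_eq ?_) hN1.le⟩
    have hN' : (0 : ℝ) < N := by exact_mod_cast hN2
    rw [Real.div_rpow (by linarith) hN'.le, neg_sub, Real.rpow_sub hN', Real.rpow_one]
    field_simp
  have hN' : (0 : ℝ) < N := by exact_mod_cast hN0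
  set w := (E - 1) / N with hw
  have hw0 : 0 < w := div_pos (by linarith) hN'
  have hwN : N * w = E - 1 := by rw [hw]; field_simp
  have hwE : w ≤ E := by
    have : w ≤ E - 1 := div_le_self (by linarith) (by exact_mod_cast hN0)
    linarith
  -- Logarithmic times make the grid of indices arithmetic, at a(1 + jw) up to rounding.
  let t : Fin N → ℝ≥0 := fun j => (Real.log (1 + (j : ℕ) * w)).toNNReal
  have hjw : ∀ j : Fin N, (1 : ℝ) ≤ 1 + (j : ℕ) * w ∧ 1 + ((j : ℕ) + 1) * w ≤ E := by
    intro j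
    have h1 : ((j : ℕ) : ℝ) + 1 ≤ N := by exact_mod_cast j.2
    have h2 : 0 ≤ ((j : ℕ) : ℝ) * w := by positivity
    refine ⟨by linarith, ?_⟩
    have := mul_le_mul_of_nonneg_right h1 hw0.le
    linarith
  have htexp : ∀ j, Real.exp (t j) = 1 + (j : ℕ) * w := fun j => by
    rw [Real.coe_toNNReal _ (Real.log_nonneg (hjw j).1), Real.exp_log (by linarith [(hjw j).1])]
  have htM : ∀ j, t j ≤ M := fun j => by
    rw [← NNReal.coe_le_coe, ← Real.exp_le_exp, htexp]
    linarith [(hjw j).2]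
  obtain ⟨Cc, hCc, hcmp⟩ := exists_gaussian_comparison.{v, u} (Fin N) (half_pos hδ)
  set η := ε / (3 * (Cc + 1)) with hη
  have hη0 : 0 < η := by positivity
  have hCη : Cc * η ≤ ε / 3 := by
    rw [hη, mul_div_assoc', div_le_div_iff₀ (by positivity) (by norm_num)]
    nlinarith
  have hcorr : ∀ᶠ a : ℝ in atTop, ∀ i j, |sumCorr σ ρ ⌊a * Real.exp (t i)⌋₊ ⌊a * Real.exp (t j)⌋₊
      - CpH p H (nndist (t i) (t j))| < η := by
    simp only [eventually_all]
    intro i j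
    exact (Metric.tendsto_nhds.1 (h.tendsto_sumCorr (t i) (t j)) η hη0)
  filter_upwards [hcorr, hfl w hw0 hwE, eventually_gt_atTop 0] with a hcor hflu ha
  let l : Fin N → ℕ := fun j => ⌊a * Real.exp (t j)⌋₊
  have hl1 : ∀ j, ⌊a⌋₊ ≤ l j := fun j => Nat.floor_mono (by rw [htexp]; nlinarith [(hjw j).1])
  have hl2 : ∀ j : Fin N, (l j : ℝ) ≤ a * (1 + (j : ℕ) * w) := fun j =>
    (Nat.floor_le (by positivity)).trans_eq (by rw [htexp])
  have hl3 : ∀ j : Fin N, a * (1 + (j : ℕ) * w) < l j + 1 := fun j =>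
    lt_of_eq_of_lt (by rw [htexp]) (Nat.lt_floor_add_one (a * Real.exp (t j)))
  have hbad : ∀ j, ∃ Bad : Set Ω, P.real Bad ≤ C / (δ / 2) ^ 2 * w ^ (2 * H) ∧ ∀ ω ∉ Bad,
      ∀ m : ℕ, l j ≤ m → (m : ℝ) ≤ l j + a * w + 1 →
        |partialSum σ ξ m ω - partialSum σ ξ (l j) ω| < δ / 2 * √(sumCov σ ρ (l j) (l j)) := fun j =>
    hflu this hξ (l j) (hl1 j) ((hl2 j).trans (mul_le_mul_of_nonneg_left
      (by linarith [(hjw j).2]) ha.le)) (δ / 2) (half_pos hδ)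
  choose Bad hBad1 hBad2 using hbad
  have hstep := hcmp (hZ.isCenteredGaussian t) (isCenteredGaussian_normalizedSum hξ σ l) (η := η)
    (fun _ => -δ) (fun i j _ => by
      have := (abs_lt.1 (hcor i j)).1
      linarith) (fun i => by
      rw [abs_sub_comm]; exact (hcor i i).le)
  have hsub : {ω | ∀ i, (√(sumCov σ ρ (l i) (l i)))⁻¹ * ∑ k ∈ Ioc 0 (l i), σ k * ξ k ω ≤ -δ + δ / 2}
      ⊆ {ω | ∀ n, ⌊a⌋₊ < n → n ≤ ⌊a * E⌋₊ → partialSum σ ξ n ω < 0} ∪ ⋃ j, Bad j := by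
    intro ω hω
    by_cases hb : ω ∈ ⋃ j, Bad j
    · exact Or.inr hb
    · refine Or.inl fun n hn1 hn2 => ?_
      have hn1' : a < n := (Nat.floor_lt ha.le).1 hn1
      have hn2' : (n : ℝ) ≤ a * E := le_trans (by exact_mod_cast hn2) (Nat.floor_le (by positivity))
      have hpos : 0 ≤ ((n : ℝ) / a - 1) / w := by
        refine div_nonneg ?_ hw0.le
        rw [sub_nonneg, le_div_iff₀ ha]
        linarith
      obtain ⟨j, hj1, hj2⟩ : ∃ j : Fin N, a * (1 + (j : ℕ) * w) ≤ n ∧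
          (n : ℝ) ≤ a * (1 + ((j : ℕ) + 1) * w) := by
        set q := ⌊((n : ℝ) / a - 1) / w⌋₊ with hq
        have q1 : (q : ℝ) ≤ ((n : ℝ) / a - 1) / w := Nat.floor_le hpos
        have q2 := Nat.lt_floor_add_one (((n : ℝ) / a - 1) / w)
        rw [← hq] at q2
        rw [le_div_iff₀ hw0, le_sub_iff_add_le, le_div_iff₀ ha] at q1
        rw [div_lt_iff₀ hw0, sub_lt_iff_lt_add, div_lt_iff₀ ha] at q2
        rcases lt_or_ge q N with hqN | hqN
        · exact ⟨⟨q, hqN⟩, by simp only; linarith, by simp only; linarith⟩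
        -- This occurs only at the right endpoint n = aE, which is assigned to the last cell.
        · have hcast : ((N - 1 : ℕ) : ℝ) = N - 1 := by rw [Nat.cast_sub hN0, Nat.cast_one]
          refine ⟨⟨N - 1, by omega⟩, ?_, ?_⟩
          · simp only [hcast]
            have h1 : ((N : ℝ) - 1) ≤ q := by
              have : (N : ℝ) ≤ q := by exact_mod_cast hqN
              linarith
            have h2 := mul_le_mul_of_nonneg_right h1 hw0.le
            have h3 := mul_le_mul_of_nonneg_left h2 ha.le
            linarith
          · simp only [hcast]
            have : a * (1 + ((N : ℝ) - 1 + 1) * w) = a * E := by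
              rw [sub_add_cancel, hwN]; ring
            rw [this]
            exact hn2'
      have hlj : l j ≤ n := by
        have := (hl2 j).trans hj1
        exact_mod_cast this
      have h1 := hBad2 j ω (fun h' => hb (Set.mem_iUnion.2 ⟨j, h'⟩)) n hlj (by
        have := hl3 j
        linarith)
      have h2 := hω j
      -- Zero variance would turn the fluctuation bound into a strict inequality |·| < 0.
      have hV0 : 0 < √(sumCov σ ρ (l j) (l j)) := by
        by_contra! h0
        have h00 : √(sumCov σ ρ (l j) (l j)) = 0 := le_antisymm h0 (Real.sqrt_nonneg _)
        rw [h00, mul_zero] at h1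
        exact absurd h1 (not_lt.2 (abs_nonneg _))
      rw [inv_mul_le_iff₀ hV0] at h2
      have h3 := (abs_lt.1 h1).2
      change partialSum σ ξ (l j) ω ≤ _ at h2
      linarith
  have hun : P.real (⋃ j, Bad j) ≤ ε / 3 := by
    refine (measureReal_iUnion_fintype_le _).trans ((sum_le_sum fun j _ => hBad1 j).trans ?_)
    rw [sum_const, card_univ, Fintype.card_fin, nsmul_eq_mul]
    exact hN
  have hfin := (measureReal_mono (μ := P) hsub).trans (measureReal_union_le _ _)
  linarith [hgap t htM]

end RegularWeights

/-! ### The lower bound for the persistence of the sums. -/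

theorem persistenceProb_eq {Ω : Type*} [MeasurableSpace Ω] (P : Measure Ω) (σ : ℕ → ℝ)
    (ξ : ℕ → Ω → ℝ) (n : ℕ) :
    persistenceProb P σ ξ n = P.real {ω | ∀ l, 0 < l → l ≤ n → partialSum σ ξ l ω < 0} := by
  simp only [persistenceProb, partialSum, Finset.mem_Icc, and_imp]
  rfl

theorem persistenceProb_anti {Ω : Type*} [MeasurableSpace Ω] (P : Measure Ω) [IsFiniteMeasure P]
    (σ : ℕ → ℝ) (ξ : ℕ → Ω → ℝ) : Antitone (persistenceProb P σ ξ) := fun m n hmn => by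
  rw [persistenceProb_eq, persistenceProb_eq]
  exact measureReal_mono fun ω hω l h0 hl => hω l h0 (hl.trans hmn)

/-- The exponent is attained up to `ε` at all large time scales, also after adding a constant. -/
theorem exists_scale_of_tendsto {q : ℝ≥0 → ℝ} {θ : ℝ}
    (hθ : Tendsto (fun T : ℝ≥0 => -(1 / (T : ℝ) * Real.log (q T))) atTop (𝓝 θ)) {C ε : ℝ}
    (hε : 0 < ε) : ∀ᶠ M : ℝ≥0 in atTop, 0 < M ∧ |(Real.log (q M) + C) / M + θ| < ε := by
  have h0 : Tendsto (fun M : ℝ≥0 => C / (M : ℝ)) atTop (𝓝 0) :=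
    Tendsto.const_div_atTop (NNReal.tendsto_coe_atTop.2 tendsto_id) C
  have h1 := h0.sub hθ
  rw [zero_sub] at h1
  filter_upwards [Metric.tendsto_nhds.1 h1 ε hε, eventually_gt_atTop 0] with M h2 h3
  refine ⟨h3, ?_⟩
  rw [Real.dist_eq] at h2
  convert h2 using 2
  ring

namespace RegularWeights

variable {p H κ : ℝ} {σ ρ : ℕ → ℝ} {Ω : Type u} [MeasurableSpace Ω] {P : Measure Ω} {ξ : ℕ → Ω → ℝ}

/-- All partial sums have nonnegative covariances, so the strict form of the product inequality
splits the indices at m. -/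
theorem mul_persistenceProb_le (h : RegularWeights p H κ σ ρ)
    (hξ : ∀ n, IsCenteredGaussian P (fun i : Fin n => ξ i) (fun i j => ρ (Nat.dist i j)))
    {m n : ℕ} (hmn : m ≤ n) :
    persistenceProb P σ ξ m * P.real {ω | ∀ l, m < l → l ≤ n → partialSum σ ξ l ω < 0}
      ≤ persistenceProb P σ ξ n := by
  have hG := isCenteredGaussian_weightedSum hξ σ fun i : Fin n => Finset.Ioc 0 ((i : ℕ) + 1)
  have h1 := hG.mul_real_neg_le (fun i => (i : ℕ) < m)
    fun i j _ _ => h.sumCov_nonneg ((i : ℕ) + 1) ((j : ℕ) + 1)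
  rw [persistenceProb_eq, persistenceProb_eq]
  refine le_trans (le_of_eq ?_) (h1.trans (le_of_eq ?_))
  · congr 2
    · ext ω
      refine ⟨fun hω i hi => hω (i + 1) (by omega) (by omega), fun hω l h0 hl => ?_⟩
      have := hω ⟨l - 1, by omega⟩ (by simp only; omega)
      rwa [Nat.sub_add_cancel h0] at this
    · ext ω
      refine ⟨fun hω i hi => hω (i + 1) (by omega) (by omega), fun hω l h0 hl => ?_⟩
      have := hω ⟨l - 1, by omega⟩ (by simp only; omega)
      rwa [Nat.sub_add_cancel (by omega)] at this
  · congr 1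
    ext ω
    refine ⟨fun hω l h0 hl => ?_, fun hω i => hω (i + 1) (by omega) (by omega)⟩
    have := hω ⟨l - 1, by omega⟩
    rwa [Nat.sub_add_cancel h0] at this

theorem persistenceProb_pos (h : RegularWeights p H κ σ ρ)
    (hξ : ∀ n, IsCenteredGaussian P (fun i : Fin n => ξ i) (fun i j => ρ (Nat.dist i j))) (n : ℕ) :
    0 < persistenceProb P σ ξ n := by
  have := (hξ 0).isProbabilityMeasure
  induction n with
  | zero =>
    rw [persistenceProb_eq]
    have : {ω | ∀ l, 0 < l → l ≤ 0 → partialSum σ ξ l ω < 0} = Set.univ :=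
      Set.eq_univ_of_forall fun ω l h0 hl => absurd hl (by omega)
    rw [this]
    simp
  | succ n ih =>
    refine (mul_pos ih ?_).trans_le (h.mul_persistenceProb_le hξ n.le_succ)
    have hG := isCenteredGaussian_weightedSum hξ σ fun _ : Unit => Finset.Ioc 0 (n + 1)
    have h1 := hG.map_sum fun _ => 1
    have hv := h.sumCov_self_pos (l := n + 1) (by omega)
    simp only [Finset.univ_unique, Finset.sum_singleton, one_mul] at h1
    change P.map (partialSum σ ξ (n + 1)) = gaussianReal 0 (sumCov σ ρ (n + 1) (n + 1)).toNNReal at h1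
    have hm : AEMeasurable (partialSum σ ξ (n + 1)) P := hG.aemeasurable ()
    have e : {ω | ∀ l, n < l → l ≤ n + 1 → partialSum σ ξ l ω < 0}
        = partialSum σ ξ (n + 1) ⁻¹' Set.Iio 0 := by
      ext ω
      refine ⟨fun hω => hω _ n.lt_succ_self le_rfl, fun hω l h0 hl => ?_⟩
      obtain rfl : l = n + 1 := by omega
      exact hω
    rw [e]
    refine ENNReal.toReal_pos ?_ (measure_ne_top _ _)
    rw [← Measure.map_apply_of_aemeasurable hm measurableSet_Iio, h1]
    intro h2
    have h3 := gaussianReal_absolutelyContinuous' 0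
      (v := (sumCov σ ρ (n + 1) (n + 1)).toNNReal) (by simpa using hv) h2
    exact (isOpen_Iio.measure_pos volume ⟨-1, by norm_num [Set.mem_Iio]⟩).ne' h3

/-- Geometric blocks of ratio e^M are chained by supermultiplicativity; about (log n)/M of them
reach n, each contributing at least b. -/
theorem eventually_le_log_persistenceProb (h : RegularWeights p H κ σ ρ)
    (hξ : ∀ n, IsCenteredGaussian P (fun i : Fin n => ξ i) (fun i j => ρ (Nat.dist i j)))
    {Ω' : Type v} [MeasurableSpace Ω'] {P' : Measure Ω'} {Z : ℝ≥0 → Ω' → ℝ}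
    (hZ : IsStationaryGaussian P' Z (CpH p H)) (hc : ∀ᵐ ω ∂P', Continuous fun t => Z t ω)
    {θ : ℝ} (hθ : Tendsto (fun T : ℝ≥0 => -(1 / (T : ℝ) * Real.log (supPersistenceProb P' Z T)))
      atTop (𝓝 θ)) {ε : ℝ} (hε : 0 < ε) :
    ∀ᶠ n : ℕ in atTop, -θ - ε ≤ Real.log (persistenceProb P σ ξ n) / Real.log n := by
  have := (hξ 0).isProbabilityMeasure
  have := hZ.gaussian.isProbabilityMeasure
  obtain ⟨M, hM0, hM⟩ := (exists_scale_of_tendsto hθ (C := -Real.log 2) (half_pos hε)).exists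
  have hq := hZ.supPersistenceProb_pos hc (CpH_nonneg (p := p) (H := H)) M
  have hq1 := hZ.supPersistenceProb_le_one M
  -- Half of the limiting probability absorbs the block error. The lost log 2 is divided by M, which
  -- was chosen with this constant in view.
  set b := supPersistenceProb P' Z M / 2 with hb
  have hb0 : 0 < b := half_pos hq
  have hlogb : Real.log b = Real.log (supPersistenceProb P' Z M) + -Real.log 2 := by
    rw [hb, Real.log_div hq.ne' two_ne_zero, sub_eq_add_neg]
  have hM' : (0 : ℝ) < M := by exact_mod_cast hM0
  have hb1 : Real.log b ≤ 0 := Real.log_nonpos hb0.le (by linarith)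
  obtain ⟨a₀, ha₀⟩ := eventually_atTop.1
    ((h.eventually_block_ge hξ hZ hc hM0 hb0).and (eventually_ge_atTop 1))
  set a := max a₀ 1
  have ha1 : 1 ≤ a := le_max_right _ _
  have hstep : ∀ i : ℕ, persistenceProb P σ ξ ⌊a⌋₊ * b ^ i
      ≤ persistenceProb P σ ξ ⌊a * Real.exp (M * i)⌋₊ := by
    intro i
    induction i with
    | zero => simp
    | succ i ih =>
      have hE : 1 ≤ Real.exp (M * i) := Real.one_le_exp (by positivity)
      have h1 := (ha₀ (a * Real.exp (M * i))
        ((le_max_left _ _).trans (le_mul_of_one_le_right (by linarith) hE))).1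
      have e : a * Real.exp (M * i) * Real.exp M = a * Real.exp (M * (i + 1 : ℕ)) := by
        rw [mul_assoc, ← Real.exp_add]
        push_cast
        ring_nf
      rw [e, show supPersistenceProb P' Z M - b = b by rw [hb]; ring] at h1
      refine le_trans ?_ (h.mul_persistenceProb_le hξ (m := ⌊a * Real.exp (M * i)⌋₊) ?_)
      · rw [pow_succ, ← mul_assoc]
        exact mul_le_mul ih h1 hb0.le measureReal_nonneg
      · refine Nat.floor_mono ?_
        gcongr
        simp
  have hp0 := h.persistenceProb_pos hξ ⌊a⌋₊
  have hlog : Tendsto (fun n : ℕ => Real.log n) atTop atTop :=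
    Real.tendsto_log_atTop.comp tendsto_natCast_atTop_atTop
  have hlim : Tendsto (fun n : ℕ => (Real.log (persistenceProb P σ ξ ⌊a⌋₊) + Real.log b) / Real.log n)
      atTop (𝓝 0) := Tendsto.const_div_atTop hlog _
  filter_upwards [hlim.eventually (lt_mem_nhds (show -(ε / 2) < 0 by linarith)),
    hlog.eventually_gt_atTop 0, eventually_gt_atTop 0] with n h1 h2 h3
  have hn : (0 : ℝ) < n := by exact_mod_cast h3
  set i := ⌈Real.log n / M⌉₊
  have hi1 : Real.log n ≤ M * i := by
    rw [mul_comm, ← div_le_iff₀ hM']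
    exact Nat.le_ceil _
  have hi2 : (i : ℝ) ≤ Real.log n / M + 1 := (Nat.ceil_lt_add_one (by positivity)).le
  have h4 : persistenceProb P σ ξ ⌊a⌋₊ * b ^ i ≤ persistenceProb P σ ξ n := by
    refine (hstep i).trans (persistenceProb_anti P σ ξ (Nat.le_floor ?_))
    calc (n : ℝ) = Real.exp (Real.log n) := (Real.exp_log hn).symm
      _ ≤ Real.exp (M * i) := Real.exp_le_exp.2 hi1
      _ ≤ a * Real.exp (M * i) := le_mul_of_one_le_left (Real.exp_nonneg _) ha1
  have h5 := Real.log_le_log (by positivity) h4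
  rw [Real.log_mul hp0.ne' (by positivity), Real.log_pow] at h5
  have h6 := mul_le_mul_of_nonpos_right hi2 hb1
  have h7 : (Real.log (persistenceProb P σ ξ ⌊a⌋₊) + Real.log b) / Real.log n + Real.log b / M
      ≤ Real.log (persistenceProb P σ ξ n) / Real.log n := by
    rw [le_div_iff₀ h2]
    refine le_trans (le_of_eq ?_) (le_trans (add_le_add_right h6 _) h5)
    field_simp
    ring
  rw [← hlogb] at hM
  linarith [(abs_lt.1 hM).1]

end RegularWeights

/-! ### The upper bound for the persistence of the sums. -/

namespace RegularWeights

variable {p H κ : ℝ} {σ ρ : ℕ → ℝ}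

/-- Normalized sums over well separated geometric blocks decorrelate geometrically. -/
theorem exists_sumCorr_blocks_le (h : RegularWeights p H κ σ ρ) :
    ∃ c > (0 : ℝ), ∃ D > (0 : ℝ), ∃ k₀ : ℕ, 1 ≤ k₀ ∧ ∀ a : ℝ, (k₀ : ℝ) ≤ a → ∀ β > (0 : ℝ), ∀ M s t : ℝ≥0,
      s ≤ M → ∀ i j : ℕ, i ≠ j → t ≤ M →
        sumCorr σ ρ ⌊a * Real.exp ((1 + β) * M * i) * Real.exp s⌋₊
            ⌊a * Real.exp ((1 + β) * M * j) * Real.exp t⌋₊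
          ≤ D * (Real.exp (-(c * β * M / 2)) ^ 2) ^ Nat.dist i j := by
  obtain ⟨c, hc, D, hD, k₀, hk₀, hle⟩ := h.exists_sumCorr_le
  -- The factor 2^c compensates for the floor, as m is at least half of the left end of its block.
  refine ⟨c, hc, D * 2 ^ c, by positivity, k₀, hk₀, fun a ha β hβ M s t hs i j hij ht => ?_⟩
  wlog hlt : i < j generalizing i j s t
  · rw [sumCorr_comm, Nat.dist_comm]
    exact this t s ht j i hij.symm hs (by omega)
  have hk : (1 : ℝ) ≤ k₀ := by exact_mod_cast hk₀
  have ha0 : 0 < a := by linarith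
  have hs' : (s : ℝ) ≤ M := by exact_mod_cast hs
  have hM : (0 : ℝ) ≤ M := M.coe_nonneg
  have h1 : ∀ (n : ℕ) (r : ℝ≥0), k₀ ≤ ⌊a * Real.exp ((1 + β) * M * n) * Real.exp r⌋₊ := fun n r => by
    refine Nat.le_floor (ha.trans ?_)
    rw [mul_assoc]
    refine le_mul_of_one_le_right ha0.le (one_le_mul_of_one_le_of_one_le ?_ ?_) <;>
      exact Real.one_le_exp (by positivity)
  set l := ⌊a * Real.exp ((1 + β) * M * i) * Real.exp s⌋₊
  set m := ⌊a * Real.exp ((1 + β) * M * j) * Real.exp t⌋₊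
  have hd : (1 : ℝ) + i ≤ j := by exact_mod_cast (by omega : 1 + i ≤ j)
  have hexp : (1 + β) * M * i + s ≤ (1 + β) * M * j - β * M * (j - i) := by
    nlinarith [mul_le_mul_of_nonneg_left hd hM]
  have hle1 : (1 + β) * M * i + s ≤ (1 + β) * M * j + t := by
    have h2 : 0 ≤ β * M * ((j : ℝ) - i) := mul_nonneg (by positivity) (by linarith)
    have h3 : (0 : ℝ) ≤ t := t.coe_nonneg
    linarith
  have hlm : l ≤ m := by
    refine Nat.floor_mono ?_
    rw [mul_assoc a, mul_assoc a, ← Real.exp_add, ← Real.exp_add]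
    exact mul_le_mul_of_nonneg_left (Real.exp_le_exp.2 hle1) ha0.le
  have hm1 : (1 : ℝ) ≤ m := by exact_mod_cast hk₀.trans (h1 j t)
  have hm2 : a * Real.exp ((1 + β) * M * j) ≤ 2 * m := by
    have h2 : a * Real.exp ((1 + β) * M * j) * Real.exp t < m + 1 := Nat.lt_floor_add_one _
    have h3 : a * Real.exp ((1 + β) * M * j) ≤ a * Real.exp ((1 + β) * M * j) * Real.exp t :=
      le_mul_of_one_le_right (by positivity) (Real.one_le_exp (by positivity))
    linarith
  have hl2 : (l : ℝ) ≤ a * Real.exp ((1 + β) * M * j) * Real.exp (-(β * M * (j - i))) := by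
    refine (Nat.floor_le (by positivity)).trans ?_
    rw [mul_assoc a, mul_assoc a, ← Real.exp_add, ← Real.exp_add]
    refine mul_le_mul_of_nonneg_left (Real.exp_le_exp.2 ?_) ha0.le
    linarith
  have hratio : (l : ℝ) / m ≤ 2 * Real.exp (-(β * M * (j - i))) := by
    rw [div_le_iff₀ (by linarith)]
    refine hl2.trans ?_
    have := mul_le_mul_of_nonneg_right hm2 (Real.exp_nonneg (-(β * M * (j - i))))
    linarith
  refine (hle l m (h1 i s) hlm).trans ?_
  rw [mul_assoc]
  refine mul_le_mul_of_nonneg_left ?_ hD.le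
  refine (Real.rpow_le_rpow (by positivity) hratio hc.le).trans (le_of_eq ?_)
  rw [Real.mul_rpow two_pos.le (Real.exp_nonneg _), ← Real.exp_mul, Nat.dist_eq_sub_of_le hlt.le,
    ← Real.exp_nat_mul, ← Real.exp_nat_mul, Nat.cast_sub hlt.le]
  congr 2
  push_cast
  ring

/-- The persistence probability over geometric blocks is at most the corresponding power of the
persistence probability of the limiting process, up to a subexponential factor. -/
theorem eventually_persistenceProb_le_pow (h : RegularWeights p H κ σ ρ) {Ω : Type u}
    [MeasurableSpace Ω] {P : Measure Ω} {ξ : ℕ → Ω → ℝ}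
    (hξ : ∀ n, IsCenteredGaussian P (fun i : Fin n => ξ i) (fun i j => ρ (Nat.dist i j)))
    {Ω' : Type v} [MeasurableSpace Ω'] {P' : Measure Ω'} {Z : ℝ≥0 → Ω' → ℝ}
    (hZ : IsStationaryGaussian P' Z (CpH p H)) (hc : ∀ᵐ ω ∂P', Continuous fun t => Z t ω)
    {θ : ℝ} (hθ0 : 0 < θ)
    (hθ : Tendsto (fun T : ℝ≥0 => -(1 / (T : ℝ) * Real.log (supPersistenceProb P' Z T)))
      atTop (𝓝 θ)) {β : ℝ} (hβ : 0 < β) :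
    ∀ᶠ M : ℝ≥0 in atTop, ∃ a : ℝ, 1 ≤ a ∧ ∀ J n : ℕ, a * Real.exp ((1 + β) * M * J) ≤ n →
      persistenceProb P σ ξ n ≤ (5 * Real.exp (β * M) * supPersistenceProb P' Z M) ^ J := by
  have := (hξ 0).isProbabilityMeasure
  have := hZ.gaussian.isProbabilityMeasure
  have hH₁ := h.half_lt
  obtain ⟨C₁, hC₁⟩ := exists_one_sub_CpH_le hH₁ h.lt_one h.add_pos
  have hAc := IsNonnegDefinite.continuous (isNonnegDefinite_CpH hH₁ h.lt_one h.add_pos)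
    (CpH_zero hH₁ h.lt_one h.add_pos) (by linarith : 0 < 2 * H) hC₁
  obtain ⟨c₀, hc₀, D₀, hD₀, hdec⟩ := exists_CpH_le hH₁ h.lt_one h.add_pos
  -- The tail rate θ + 1 makes the additive error of the shift smaller than the persistence
  -- probability itself, which decays at rate θ.
  obtain ⟨u₀, hu₀, hshift⟩ := hZ.exists_real_le_shift (CpH_nonneg (p := p) (H := H)) hAc.continuousAt
    hD₀ hc₀ hdec hβ (by linarith : 0 < θ + 1)
  obtain ⟨c, hc0, D, hD, k₀, hk₀, hcross⟩ := h.exists_sumCorr_blocks_le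
  have hs : Tendsto (fun M : ℝ≥0 => Real.exp (-(c * β * M / 2))) atTop (𝓝 0) := by
    refine Real.tendsto_exp_neg_atTop_nhds_zero.comp ?_
    exact ((NNReal.tendsto_coe_atTop.2 tendsto_id).const_mul_atTop (by positivity)).atTop_div_const
      two_pos
  have hMs : Tendsto (fun M : ℝ≥0 => (M : ℝ) * Real.exp (-(c * β * M / 2))) atTop (𝓝 0) := by
    have h1 := (Real.tendsto_pow_mul_exp_neg_atTop_nhds_zero 1).comp
      ((NNReal.tendsto_coe_atTop.2 (tendsto_id (x := atTop))).const_mul_atTop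
        (by positivity : 0 < c * β / 2))
    have h2 := h1.const_mul (2 / (c * β))
    rw [mul_zero] at h2
    refine h2.congr fun M => ?_
    simp only [Function.comp, id, pow_one]
    have e : c * β / 2 * (M : ℝ) = c * β * M / 2 := by ring
    rw [e]
    field_simp
  have hsmall := (hMs.const_mul ((θ + 1) * (16 * D))).eventually
    (gt_mem_nhds (show (θ + 1) * (16 * D) * 0 < (u₀ / 2) ^ 2 by rw [mul_zero]; positivity))
  filter_upwards [hs.eventually (gt_mem_nhds (show (0 : ℝ) < 1 / 2 by norm_num)),
    hs.eventually (gt_mem_nhds (show (0 : ℝ) < 1 / (2 * D) by positivity)), hsmall,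
    exists_scale_of_tendsto hθ (C := 0) one_pos, eventually_ge_atTop 1] with M hs1 hs2 hs3 hM hM1
  obtain ⟨hM0, hM2⟩ := hM
  have hM' : (0 : ℝ) < M := by exact_mod_cast hM0
  have hq := hZ.supPersistenceProb_pos hc (CpH_nonneg (p := p) (H := H)) M
  set q := supPersistenceProb P' Z M
  set s := Real.exp (-(c * β * M / 2))
  have hs0 : 0 < s := Real.exp_pos _
  have hKq : Real.exp (-((θ + 1) * M)) ≤ q := by
    rw [← Real.le_log_iff_exp_le hq]
    have h1 := (abs_lt.1 hM2).1
    rw [add_zero, ← sub_lt_iff_lt_add, lt_div_iff₀ hM'] at h1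
    linarith
  -- The decoupling parameter s is exponentially small in M, so this error is doubly exponentially
  -- small and falls below q.
  have hsq : Real.exp (-((u₀ / 2) ^ 2 / (16 * D * s))) ≤ q := by
    refine (Real.exp_le_exp.2 ?_).trans hKq
    rw [neg_le_neg_iff, le_div_iff₀ (by positivity)]
    linarith
  -- The grid is chosen for Z at fixed M. Only then is the starting scale a taken large enough for
  -- the correlations on this grid to be close to their limits.
  obtain ⟨N, t, ht, hgrid⟩ := hZ.exists_grid hc M (neg_lt_zero.2 hu₀) hq
  obtain ⟨Cc, hCc, hcmp⟩ := exists_gaussian_comparison.{u, v} (Fin N) (half_pos hu₀)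
  have hη0 : 0 < q / (Cc + 1) := by positivity
  have hCη : Cc * (q / (Cc + 1)) ≤ q := by
    rw [mul_div_assoc', div_le_iff₀ (by positivity)]
    nlinarith
  have hcorr : ∀ᶠ a : ℝ in atTop, ∀ i j, |sumCorr σ ρ ⌊a * Real.exp (t i)⌋₊ ⌊a * Real.exp (t j)⌋₊
      - CpH p H (nndist (t i) (t j))| < q / (Cc + 1) := by
    simp only [eventually_all]
    intro i j
    exact (Metric.tendsto_nhds.1 (h.tendsto_sumCorr (t i) (t j)) _ hη0)
  obtain ⟨a₀, ha₀⟩ := eventually_atTop.1 hcorr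
  have hk1 : (1 : ℝ) ≤ k₀ := by exact_mod_cast hk₀
  set a := max a₀ k₀
  have hak : (k₀ : ℝ) ≤ a := le_max_right _ _
  have ha0 : 0 < a := by linarith
  refine ⟨a, by linarith, fun J n hJn => ?_⟩
  let l : Fin J × Fin N → ℕ := fun x => ⌊a * Real.exp ((1 + β) * M * (x.1 : ℕ)) * Real.exp (t x.2)⌋₊
  have hl1 : ∀ x, 1 ≤ l x := fun x => by
    refine Nat.le_floor ?_
    rw [Nat.cast_one, mul_assoc]
    refine one_le_mul_of_one_le_of_one_le (by linarith) (one_le_mul_of_one_le_of_one_le ?_ ?_) <;>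
      exact Real.one_le_exp (by positivity)
  have hln : ∀ x, l x ≤ n := fun x => by
    have h1 : (l x : ℝ) ≤ n := by
      refine (Nat.floor_le (by positivity)).trans (le_trans ?_ hJn)
      rw [mul_assoc, ← Real.exp_add]
      refine mul_le_mul_of_nonneg_left (Real.exp_le_exp.2 ?_) ha0.le
      have h2 : (((x.1 : ℕ) : ℝ) + 1) ≤ J := by exact_mod_cast x.1.2
      have h3 : (t x.2 : ℝ) ≤ M := by exact_mod_cast ht x.2
      have h4 := mul_le_mul_of_nonneg_left h2 (show 0 ≤ (1 + β) * (M : ℝ) by positivity)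
      nlinarith
    exact_mod_cast h1
  have hU := isCenteredGaussian_normalizedSum hξ σ l
  have hprod := hU.real_forall_nonpos_le_prod (fun x => h.sumCorr_self (hl1 x)) hD hs0 hs1.le
    (by rw [lt_div_iff₀ (by positivity)] at hs2; linarith) (half_pos hu₀).le
    (fun x y hxy => hcross a hak β hβ M (t x.2) (t y.2) (ht _) x.1 y.1
      (fun e => hxy (Fin.ext e)) (ht _))
  -- The factor 5 collects one q from the decoupling, one from the comparison, one from the shift,
  -- and two from the grid bound at level -u₀, the last two multiplied by e^(βM).
  have hblock : ∀ i : Fin J, P.real {ω | ∀ j, (√(sumCov σ ρ (l (i, j)) (l (i, j))))⁻¹ *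
      ∑ k ∈ Finset.Ioc 0 (l (i, j)), σ k * ξ k ω ≤ u₀ / 2} + Real.exp (-((u₀ / 2) ^ 2 / (16 * D * s)))
      ≤ 5 * Real.exp (β * M) * q := by
    intro i
    have hai : a₀ ≤ a * Real.exp ((1 + β) * M * (i : ℕ)) :=
      (le_max_left _ _).trans (le_mul_of_one_le_right ha0.le (Real.one_le_exp (by positivity)))
    have hcor := ha₀ _ hai
    have h1 := hcmp (isCenteredGaussian_normalizedSum hξ σ fun j => l (i, j)) (hZ.isCenteredGaussian t)
      (η := q / (Cc + 1)) (fun _ => u₀ / 2)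
      (fun j j' _ => by have := (abs_lt.1 (hcor j j')).2; simp only [l]; linarith)
      (fun j => (hcor j j).le)
    have h2 := hshift M hM1 t ht
    rw [add_halves] at h1
    have h3 := mul_le_mul_of_nonneg_left hgrid (Real.exp_nonneg (β * M))
    have h4 := mul_le_mul_of_nonneg_right (Real.one_le_exp (show 0 ≤ β * M by positivity)) hq.le
    linarith
  rw [persistenceProb_eq]
  refine (measureReal_mono fun ω hω x => ?_).trans (hprod.trans
    ((Finset.prod_le_prod (fun i _ => by positivity) fun i _ => hblock i).trans (by simp)))
  exact mul_nonpos_of_nonneg_of_nonpos (by positivity) (hω (l x) (hl1 x) (hln x)).le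

theorem eventually_log_persistenceProb_le (h : RegularWeights p H κ σ ρ) {Ω : Type u}
    [MeasurableSpace Ω] {P : Measure Ω} {ξ : ℕ → Ω → ℝ}
    (hξ : ∀ n, IsCenteredGaussian P (fun i : Fin n => ξ i) (fun i j => ρ (Nat.dist i j)))
    {Ω' : Type v} [MeasurableSpace Ω'] {P' : Measure Ω'} {Z : ℝ≥0 → Ω' → ℝ}
    (hZ : IsStationaryGaussian P' Z (CpH p H)) (hc : ∀ᵐ ω ∂P', Continuous fun t => Z t ω)
    {θ : ℝ} (hθ0 : 0 < θ)
    (hθ : Tendsto (fun T : ℝ≥0 => -(1 / (T : ℝ) * Real.log (supPersistenceProb P' Z T)))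
      atTop (𝓝 θ)) {ε : ℝ} (hε : 0 < ε) :
    ∀ᶠ n : ℕ in atTop, Real.log (persistenceProb P σ ξ n) / Real.log n ≤ -θ + ε := by
  -- The first constraint keeps the rate 2β - θ negative; the second gives (2β - θ)/(1 + β) ≤ -θ +
  -- ε/2, which pays for the gaps between blocks.
  set β := min (θ / 4) (ε / (2 * (2 + θ)))
  have hβ : 0 < β := lt_min (by positivity) (by positivity)
  have hβ1 : β ≤ θ / 4 := min_le_left _ _
  have hβ2 : (2 + θ) * β ≤ ε / 2 := by
    have : β ≤ ε / (2 * (2 + θ)) := min_le_right _ _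
    rw [le_div_iff₀ (by positivity)] at this
    linarith
  obtain ⟨M, ⟨hM0, hM⟩, a, ha, hpow⟩ := ((exists_scale_of_tendsto hθ (C := Real.log 5) hβ).and
    (h.eventually_persistenceProb_le_pow hξ hZ hc hθ0 hθ hβ)).exists
  have hM' : (0 : ℝ) < M := by exact_mod_cast hM0
  have hq := hZ.supPersistenceProb_pos hc (CpH_nonneg (p := p) (H := H)) M
  set B := 5 * Real.exp (β * M) * supPersistenceProb P' Z M with hB
  set L := (1 + β) * (M : ℝ) with hL
  have hL0 : 0 < L := by positivity
  have hlogB : Real.log B = β * M + (Real.log (supPersistenceProb P' Z M) + Real.log 5) := by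
    rw [hB, Real.log_mul (by positivity) hq.ne', Real.log_mul (by norm_num) (by positivity),
      Real.log_exp]
    ring
  have hlogB1 : Real.log B ≤ (2 * β - θ) * M := by
    have h1 := (abs_lt.1 hM).2
    rw [← lt_sub_iff_add_lt, div_lt_iff₀ hM'] at h1
    rw [hlogB]
    linarith
  have hlogB0 : Real.log B < 0 := hlogB1.trans_lt (mul_neg_of_neg_of_pos (by linarith) hM')
  have hBL : Real.log B / L ≤ -θ + ε / 2 := by
    rw [div_le_iff₀ hL0]
    refine hlogB1.trans ?_
    rw [hL, ← mul_assoc]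
    refine mul_le_mul_of_nonneg_right ?_ hM'.le
    nlinarith [mul_le_mul_of_nonneg_right hβ2 hβ.le, mul_pos hβ hβ, mul_pos hβ hθ0]
  have hlog : Tendsto (fun n : ℕ => Real.log n) atTop atTop :=
    Real.tendsto_log_atTop.comp tendsto_natCast_atTop_atTop
  have hlim : Tendsto (fun n : ℕ => (-(Real.log a / L + 1) * Real.log B) / Real.log n)
      atTop (𝓝 0) := Tendsto.const_div_atTop hlog _
  filter_upwards [hlim.eventually (gt_mem_nhds (half_pos hε)), hlog.eventually_gt_atTop 0,
    hlog.eventually_ge_atTop (Real.log a), eventually_gt_atTop 0] with n h1 h2 h3 h4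
  have hn : (0 : ℝ) < n := by exact_mod_cast h4
  set J := ⌊(Real.log n - Real.log a) / L⌋₊
  have hJ1 : L * J ≤ Real.log n - Real.log a := by
    rw [mul_comm, ← le_div_iff₀ hL0]
    exact Nat.floor_le (div_nonneg (by linarith) hL0.le)
  have hJ2 : (Real.log n - Real.log a) / L - 1 ≤ J := by
    linarith [Nat.lt_floor_add_one ((Real.log n - Real.log a) / L)]
  have h5 := hpow J n (by
    calc a * Real.exp (L * J) ≤ a * Real.exp (Real.log n - Real.log a) :=
          mul_le_mul_of_nonneg_left (Real.exp_le_exp.2 hJ1) (by linarith)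
      _ = n := by
          rw [Real.exp_sub, Real.exp_log hn, Real.exp_log (by linarith)]
          field_simp)
  have h6 := Real.log_le_log (h.persistenceProb_pos hξ n) h5
  rw [Real.log_pow] at h6
  have h7 := mul_le_mul_of_nonpos_right hJ2 hlogB0.le
  have h8 : Real.log (persistenceProb P σ ξ n) / Real.log n
      ≤ (-(Real.log a / L + 1) * Real.log B) / Real.log n + Real.log B / L := by
    rw [div_le_iff₀ h2]
    refine (h6.trans h7).trans (le_of_eq ?_)
    field_simp
    ring
  linarith

end RegularWeights

/-! ### Assembly of the theorem. -/

theorem theorem2 (p H : ℝ) (hH₁ : 1 / 2 < H) (hH₂ : H < 1) (hpH : 0 < p + H) :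
    ∃ θ : ℝ, 0 < θ ∧ HasPersistenceExponent.{u} (CpH p H) θ ∧
      ∀ (Ω : Type v) [MeasurableSpace Ω] (P : Measure Ω) [IsProbabilityMeasure P]
        (ξ : ℕ → Ω → ℝ) (ρ σ : ℕ → ℝ) (κ : ℝ),
        IsStationaryGaussian P ξ ρ → (∀ i, 0 ≤ ρ i) → (∀ i, 1 ≤ i → 0 < σ i) → 0 < κ →
        Tendsto (fun i : ℕ => ρ i / (i : ℝ) ^ (2 * H - 2)) atTop (𝓝 κ) →
        Tendsto (fun i : ℕ => σ i / (i : ℝ) ^ p) atTop (𝓝 1) →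
        Tendsto (fun n : ℕ => Real.log (persistenceProb P σ ξ n) / Real.log n) atTop (𝓝 (-θ)) := by
  have h0 := CpH_zero hH₁ hH₂ hpH
  have hnn : ∀ τ, 0 ≤ CpH p H τ := CpH_nonneg
  obtain ⟨C, hC⟩ := exists_one_sub_CpH_le hH₁ hH₂ hpH
  obtain ⟨c, hc, D, hD, hdec⟩ := exists_CpH_le hH₁ hH₂ hpH
  -- One reference process defines θ and serves as the comparison process in both bounds for q_n.
  obtain ⟨Ω₀, _, P₀, Z₀, hP₀, hZ₀, hc₀⟩ := exists_continuous_stationary_gaussian.{u}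
    (isNonnegDefinite_CpH hH₁ hH₂ hpH) h0 (by linarith : 1 < 2 * H) hC
  obtain ⟨θ, hθ0, hθ⟩ := hZ₀.exists_exponent hc₀ hnn hD hc hdec
  refine ⟨θ, hθ0, ⟨⟨Ω₀, _, P₀, Z₀, hP₀, hZ₀, hc₀⟩, fun Ω _ P _ Z hZ hcZ T =>
    hZ.supPersistenceProb_pos hcZ hnn T, fun Ω _ P _ Z hZ hcZ => ?_⟩, ?_⟩
  · refine hθ.congr fun T => ?_
    rw [(hZ₀.supPersistenceProb_congr hc₀ hZ hcZ T).antisymm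
      (hZ.supPersistenceProb_congr hcZ hZ₀ hc₀ T)]
  intro Ω _ P _ ξ ρ σ κ hξ hρ hσ hκ hρlim hσlim
  -- The value σ(0) is unconstrained and never enters the sums. Absolute values make the weights
  -- nonnegative everywhere without changing them at indices i ≥ 1.
  have hR : RegularWeights p H κ (fun i => |σ i|) ρ :=
    { half_lt := hH₁
      lt_one := hH₂
      add_pos := hpH
      kappa_pos := hκ
      sigma_nonneg := fun i => abs_nonneg _
      sigma_pos := fun i hi => abs_pos_of_pos (hσ i hi)
      rho_nonneg := hρ
      rho_zero := hξ.unit_variance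
      sigma_lim := hσlim.congr' (by
        filter_upwards [eventually_ge_atTop 1] with i hi
        rw [abs_of_pos (hσ i hi)])
      rho_lim := hρlim }
  have e : persistenceProb P (fun i => |σ i|) ξ = persistenceProb P σ ξ := by
    ext n
    unfold persistenceProb
    congr 1
    ext ω
    refine forall₂_congr fun l _ => ?_
    have e1 : ∑ i ∈ Finset.Icc 1 l, |σ i| * ξ i ω = ∑ i ∈ Finset.Icc 1 l, σ i * ξ i ω :=
      Finset.sum_congr rfl fun i hi => by rw [abs_of_pos (hσ i (Finset.mem_Icc.1 hi).1)]
    rw [e1]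
  have hlow := fun ε hε => hR.eventually_le_log_persistenceProb hξ.isCenteredGaussian_nat hZ₀ hc₀ hθ
    (ε := ε) hε
  have hupp := fun ε hε => hR.eventually_log_persistenceProb_le hξ.isCenteredGaussian_nat hZ₀ hc₀ hθ0
    hθ (ε := ε) hε
  rw [e] at hlow hupp
  refine Metric.tendsto_nhds.2 fun ε hε => ?_
  filter_upwards [hlow (ε / 2) (half_pos hε), hupp (ε / 2) (half_pos hε)] with n h1 h2
  rw [Real.dist_eq, abs_lt]
  constructor <;> linarith
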